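/- Let $K$ be a finite extension of $\mathbb{Q}_p$ with valuation $v$, normalized so that prime elements have valuation $1$. Let $V$ be an $n$-dimensional $K$-vector space with a basis $v_1,\dots,v_n$, let $G=PGL(V)$ (the group of $K$-rational points, with the topology coming from $K$), let $T\subset G$ be the diagonal torus and $N\subset G$ the group of classes of monomial matrices, so that $N=T\rtimes S_n$. *The building.* Put $A=X_*(T)\otimes\mathbb{R}=\mathbb{R}^n/\mathbb{R}(1,\dots,1)$ with roots $a_{ij}(x)=x_i-x_j$ $(i\ne j)$ and root groups $U_{a_{ij}}=\{1+uE_{ij}: u\in K\}$, and fix any $S_n$-invariant scalar product on $A$. Let $N$ act on $A$ by affine maps: $\operatorname{diag}(t_1,\dots,t_n)$ acts as translation by the class of $(-v(t_1),\dots,-v(t_n))$, and permutation matrices permute the coordinates. For $x\in A$ let $P_x\subset G$ be the subgroup generated by the stabilizer of $x$ in $N$ and all $1+uE_{ij}$ with $i\neq j$ and $v(u)\ge -a_{ij}(x)$. Let $\overline{A}=A\cup A_\infty$, where $A_\infty$ is the set of directions of half-lines in $A$, with the topology generated by the open subsets of $A$ and all cones $C_x(c,\epsilon)$ ($x\in A$,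 $c\in A_\infty$, $\epsilon>0$) consisting of the points of $\overline A\setminus\{x\}$ seen from $x$ at an angle $<\epsilon$ from the direction $c$. The group $N$ acts on $A_\infty$ through the linear parts of its affine maps; for $c\in A_\infty$ let $P_c\subset G$ be generated by $T$ and the groups $U_a$ for all roots $a$ that are nonnegative on $c$. Let $\overline{X}=G\times\overline{A}/\sim$ with the quotient topology, where $(g,x)\sim(h,y)$ iff there is $m\in N$ with $mx=y$ and $g^{-1}hm\in P_x$. The group $G$ acts on $\overline X$ by left multiplication on the first factor. The Bruhat–Tits building of $G$ is the image $X$ of $G\times A$ in $\overline X$, and its boundary is $X_\infty=\overline X\setminus X$. The metric $d$ on $X$ is the one for which $d([g,a],[g,b])$ is the length of $a-b$, for all $g\in G$ and $a,b\in A$. A geodesic in $X$ is a map $\gamma:\mathbb{R}\to X$ with $d(\gamma(s),\gamma(t))=|s-t|$ for all $s,t$. It connects $y,y'\in X_\infty$ if, in $\overline X$, $\gamma(t)\to y$ as $t\to\infty$ and $\gamma(t)\to y'$ as $t\to-\infty$. *Parabolic subgroups.* For a subspace $W$ with $0\ne W\ne V$ let $P_W\subset G$ be its stabilizer, a maximal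 parabolic subgroup. Two parabolic subgroups are called opposite if their intersection is a Levi subgroup of both, that is, a complement to the unipotent radical in each of them. **Lemma 2.3.** For every subspace $W$ of $V$ with $0\ne W\neq V$ there is exactly one point $y_W\in X_\infty$ whose stabilizer in $G$ is $P_W$ (the vertex of $X_\infty$ corresponding to $W$). Let $W,W'$ be two such subspaces. Then $y_W$ and $y_{W'}$ can be connected by a geodesic in $X$ if and only if $W\oplus W'=V$. Equivalently, $y_W$ and $y_{W'}$ can be connected by a geodesic in $X$ if and only if $P_W$ and $P_{W'}$ are opposite. -/

import Mathlib

open Matrix Topology Filter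

namespace BTBuilding

noncomputable section

/-! ### The empty apartment -/

/-- `Λ = X_*(T) ⊗ ℝ`, where `T` is the diagonal torus of `PGL_n`. As `X_*(T)` is `ℤ ^ n` modulo the
diagonal, this is `ℝ ^ n` modulo the diagonal. The class of the `i`-th unit vector is the
cocharacter `η_i`. -/
abbrev Apt (n : ℕ) : Type :=
  (Fin n → ℝ) ⧸ Submodule.span ℝ {(fun _ => 1 : Fin n → ℝ)}

/-- The class in `Λ` of a vector of `ℝ ^ n`, that is `∑ i, x i • η_i`. -/
def Apt.mk {n : ℕ} (x : Fin n → ℝ) : Apt n :=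
  Submodule.Quotient.mk x

/-- The root `a_{ij} = χ_i - χ_j` as a linear form on `Λ`. -/
def root {n : ℕ} (i j : Fin n) : Apt n →ₗ[ℝ] ℝ :=
  Submodule.liftQ _
    ((LinearMap.proj i : (Fin n → ℝ) →ₗ[ℝ] ℝ) - (LinearMap.proj j : (Fin n → ℝ) →ₗ[ℝ] ℝ)) (by
    rw [Submodule.span_singleton_le_iff_mem]
    simp)

/-- The action of the Weyl group on `Λ`: the permutation `σ` maps `η_i` to `η_{σ i}`. -/
def weyl {n : ℕ} (σ : Equiv.Perm (Fin n)) : Apt n ≃ₗ[ℝ] Apt n :=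
  Submodule.Quotient.equiv _ _ (LinearEquiv.funCongrLeft ℝ ℝ σ.symm) (by
    rw [Submodule.map_span, Set.image_singleton]
    rfl)

/-- A scalar product on `Λ` that is invariant under the Weyl group. -/
structure InvScalarProduct (n : ℕ) where
  form : LinearMap.BilinForm ℝ (Apt n)
  symm : ∀ x y, form x y = form y x
  pos : ∀ x, x ≠ 0 → 0 < form x x
  inv : ∀ (σ : Equiv.Perm (Fin n)) (x y : Apt n), form (weyl σ x) (weyl σ y) = form x y

namespace InvScalarProduct

variable {n : ℕ} (B : InvScalarProduct n)

/-- The length of a vector. -/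
def len (x : Apt n) : ℝ := Real.sqrt (B.form x x)

/-- The angle between two (nonzero) vectors. -/
def angle (x y : Apt n) : ℝ := Real.arccos (B.form x y / (B.len x * B.len y))

end InvScalarProduct

/-! ### The compactified apartment -/

/-- `Ā = A ∪ A_∞`. The boundary `A_∞` is the set of half-lines in `A` starting in a fixed point;
such a half-line is given by its direction, a ray in the vector space `Λ`. -/
abbrev AptBar (n : ℕ) : Type := Apt n ⊕ Module.Ray ℝ (Apt n)

/-- The cone `C_x(c, ε)` in `Ā`: all points different from `x` which are seen from `x` at an angle
less than `ε` from the direction `c`. -/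
def cone {n : ℕ} (B : InvScalarProduct n) (x : Apt n) (c : Module.Ray ℝ (Apt n)) (ε : ℝ) :
    Set (AptBar n) :=
  {z | match z with
    | Sum.inl y => y ≠ x ∧ B.angle c.someVector (y - x) < ε
    | Sum.inr e => B.angle c.someVector e.someVector < ε}

/-- The topology of `Ā`, generated by the open subsets of `A` and all cones. -/
@[reducible] def aptBarTopology {n : ℕ} (B : InvScalarProduct n) : TopologicalSpace (AptBar n) :=
  TopologicalSpace.generateFrom
    ({s | ∃ u : Set (Apt n), IsOpen u ∧ s = Sum.inl '' u} ∪
      {s | ∃ (x : Apt n) (c : Module.Ray ℝ (Apt n)) (ε : ℝ), 0 < ε ∧ s = cone B x c ε})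

/-! ### The group `G = PGL_n(K)` and its subgroups -/

section Group

variable {n : ℕ} {K : Type*} [NormedField K]

/-- The absolute value of a prime element of `K`: the largest absolute value less than one. -/
def primeNorm (K : Type*) [NormedField K] : ℝ := sSup {r : ℝ | r < 1 ∧ ∃ x : K, r = ‖x‖}

/-- The valuation of a nonzero element of `K`, normalized so that prime elements have valuation
one. (It is only used for nonzero elements.) -/
def val (x : K) : ℝ := Real.log ‖x‖ / Real.log (primeNorm K)

/-- The topology of `PGL_n(K)`, the quotient of the topology of `GL_n(K)` that is induced by the
topology of `K`. -/
instance pglTopology : TopologicalSpace (ProjGenLinGroup (Fin n) K) :=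
  TopologicalSpace.coinduced (ProjGenLinGroup.mk : GL (Fin n) K → ProjGenLinGroup (Fin n) K)
    inferInstance

/-- `g ∈ PGL_n(K)` is the class of the (invertible) matrix `M`. -/
def IsClassOf (g : ProjGenLinGroup (Fin n) K) (M : Matrix (Fin n) (Fin n) K) : Prop :=
  ∃ A : GL (Fin n) K, (A : Matrix (Fin n) (Fin n) K) = M ∧ ProjGenLinGroup.mk A = g

/-- The monomial matrix `diag(t) * σ`, where the permutation matrix `σ` maps the `j`-th basis vector
to the `σ j`-th. The classes of these matrices form the normalizer `N` of the torus `T`, and those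
with `σ = 1` form `T`. -/
def monomial (t : Fin n → Kˣ) (σ : Equiv.Perm (Fin n)) : Matrix (Fin n) (Fin n) K :=
  Matrix.of fun i j => if i = σ j then (t i : K) else 0

/-- The map `ν : T → Λ`, characterized by `⟨ν(t), χ⟩ = - v(χ(t))` for all characters `χ`. -/
def nuTorus (t : Fin n → Kˣ) : Apt n := Apt.mk fun i => - val (t i : K)

/-- The action of the class of `monomial t σ` on `Ā` through `ν`: on `A` it is the affine map
`x ↦ ν(t) + σ x`, on `A_∞` the induced action on directions. -/
def nuAct (t : Fin n → Kˣ) (σ : Equiv.Perm (Fin n)) : AptBar n → AptBar n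
  | Sum.inl x => Sum.inl (nuTorus t + weyl σ x)
  | Sum.inr c => Sum.inr (Module.Ray.map (weyl σ) c)

/-- The groups `P_x`. For `x ∈ A` it is generated by the stabilizer of `x` in `N` and the groups
`U_{a,x} = {u ∈ U_a | v(u) ≥ - a(x)}`; for `c ∈ A_∞` it is generated by `T` and those root groups
`U_a` for which `c` lies in the closure of `{x ∈ A | a(x) ≥ 0}`, that is, for which `a` is
nonnegative on the direction `c`. The root group of `a_{ij}` consists of the classes of
the matrices `1 + u E_{ij}`. -/
def stab : AptBar n → Subgroup (ProjGenLinGroup (Fin n) K)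
  | Sum.inl x => Subgroup.closure
      ({g | ∃ t σ, nuAct (K := K) t σ (Sum.inl x) = Sum.inl x ∧ IsClassOf g (monomial t σ)} ∪
        {g | ∃ (i j : Fin n) (u : K), i ≠ j ∧ (u = 0 ∨ - root i j x ≤ val u) ∧
          IsClassOf g (1 + Matrix.single i j u)})
  | Sum.inr c => Subgroup.closure
      ({g | ∃ t : Fin n → Kˣ, IsClassOf g (monomial t 1)} ∪
        {g | ∃ (i j : Fin n) (u : K), i ≠ j ∧ 0 ≤ root i j c.someVector ∧
          IsClassOf g (1 + Matrix.single i j u)})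

/-! ### The building and its compactification -/

/-- The relation on `G × Ā`: `(g, x) ∼ (h, y)` iff there is `m ∈ N` with `ν(m) x = y` and
`g⁻¹ h m ∈ P_x`. -/
def bdRel (p q : ProjGenLinGroup (Fin n) K × AptBar n) : Prop :=
  ∃ (m : ProjGenLinGroup (Fin n) K) (t : Fin n → Kˣ) (σ : Equiv.Perm (Fin n)),
    IsClassOf m (monomial t σ) ∧ nuAct t σ p.2 = q.2 ∧ p.1⁻¹ * q.1 * m ∈ stab p.2

variable (n K) in
/-- The compactified building `X̄ = (G × Ā) / ∼`. -/
def XBar : Type _ := Quot (bdRel (n := n) (K := K))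

/-- The class of `(g, x)` in `X̄`. -/
def XBar.mk (g : ProjGenLinGroup (Fin n) K) (x : AptBar n) : XBar n K := Quot.mk _ (g, x)

/-- `G` acts on `X̄` by left multiplication on the first factor. -/
instance : MulAction (ProjGenLinGroup (Fin n) K) (XBar n K) where
  smul g := Quot.map (fun p => (g * p.1, p.2)) (by
    rintro ⟨h, x⟩ ⟨k, y⟩ ⟨m, t, σ, hm, hxy, hP⟩
    refine ⟨m, t, σ, hm, hxy, ?_⟩
    simpa [mul_assoc] using hP)
  one_smul y := by
    induction y using Quot.ind with
    | mk p => exact congrArg (Quot.mk _) (Prod.ext (one_mul p.1) rfl)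
  mul_smul g h y := by
    induction y using Quot.ind with
    | mk p => exact congrArg (Quot.mk _) (Prod.ext (mul_assoc g h p.1) rfl)

/-- The quotient topology on `X̄`. -/
@[reducible] def xBarTopology (B : InvScalarProduct n) : TopologicalSpace (XBar n K) :=
  TopologicalSpace.coinduced
    (fun p : ProjGenLinGroup (Fin n) K × AptBar n => XBar.mk p.1 p.2)
    (@instTopologicalSpaceProd _ _ pglTopology (aptBarTopology B))

variable (n K) in
/-- The building `X = (G × A) / ∼`, as a subset of `X̄`. -/
def building : Set (XBar n K) := {y | ∃ g x, y = XBar.mk g (Sum.inl x)}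

variable (n K) in
/-- The boundary `X_∞` of `X` in `X̄`. -/
def boundary : Set (XBar n K) := (building n K)ᶜ

/-- The metric on `X`: if `x` and `y` lie in the apartment `g A`, say `x = g a` and `y = g b` with
`a, b ∈ A`, then their distance is the distance of `a` and `b` in `A`. (Any two points lie in a
common apartment, and the number obtained does not depend on its choice, so that the infimum is
over a set with one element.) -/
def bdDist (B : InvScalarProduct n) (x y : building n K) : ℝ :=
  sInf {r | ∃ (g : ProjGenLinGroup (Fin n) K) (a b : Apt n), (x : XBar n K) = XBar.mk g (Sum.inl a) ∧
    (y : XBar n K) = XBar.mk g (Sum.inl b) ∧ r = B.len (a - b)}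

/-- A geodesic in `X`: an isometric map `ℝ → X`. -/
def IsGeodesic (B : InvScalarProduct n) (γ : ℝ → building n K) : Prop :=
  ∀ s t : ℝ, bdDist B (γ s) (γ t) = |s - t|

/-- The points `y` and `y'` of `X̄` can be connected by a geodesic in `X`. -/
def ConnectedByGeodesic (B : InvScalarProduct n) (y y' : XBar n K) : Prop :=
  ∃ γ : ℝ → building n K, IsGeodesic B γ ∧
    Tendsto (fun t => (γ t : XBar n K)) atTop (@nhds _ (xBarTopology B) y) ∧
    Tendsto (fun t => (γ t : XBar n K)) atBot (@nhds _ (xBarTopology B) y')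

/-! ### Parabolic subgroups attached to subspaces, and vertices of the boundary -/

variable {V : Type*} [AddCommGroup V] [Module K V]

/-- The stabilizer of the subspace `W` of `V` in `GL_n(K)`, which acts on `V` through the
basis `b`. -/
def glStabilizer (b : Module.Basis (Fin n) K V) (W : Submodule K V) :
    Subgroup (GL (Fin n) K) where
  carrier := {A | W.map (Matrix.toLin b b (A : Matrix (Fin n) (Fin n) K)) = W}
  one_mem' := by simp
  mul_mem' := by
    intro A C hA hC
    simp only [Set.mem_ofPred_eq, Units.val_mul, Matrix.toLin_mul b b b, Submodule.map_comp] at *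
    rw [hC, hA]
  inv_mem' := by
    intro A hA
    simp only [Set.mem_ofPred_eq] at *
    conv_lhs => rw [← hA]
    rw [← Submodule.map_comp, ← Matrix.toLin_mul b b b, ← Units.val_mul]
    simp

/-- The stabilizer `P_W` of `W` in `PGL(V) = PGL_n(K)`; for nontrivial `W` this is the maximal
parabolic subgroup that corresponds to `W`. -/
def parabolic (b : Module.Basis (Fin n) K V) (W : Submodule K V) :
    Subgroup (ProjGenLinGroup (Fin n) K) :=
  (glStabilizer b W).map ProjGenLinGroup.mk

/-- `y = y_W`: the vertex of `X_∞` corresponding to `W`, i.e. the point of `X_∞` whose stabilizer is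
the parabolic subgroup corresponding to `W`. -/
def IsVertexOf (b : Module.Basis (Fin n) K V) (W : Submodule K V) (y : XBar n K) : Prop :=
  y ∈ boundary n K ∧ MulAction.stabilizer (ProjGenLinGroup (Fin n) K) y = parabolic b W

/-! ### Opposite parabolic subgroups -/

/-- An element of `PGL_n(K)` is unipotent if it is the class of a unipotent matrix. -/
def IsUnipotentElt (g : ProjGenLinGroup (Fin n) K) : Prop :=
  ∃ A : GL (Fin n) K, IsNilpotent ((A : Matrix (Fin n) (Fin n) K) - 1) ∧ ProjGenLinGroup.mk A = g

/-- The unipotent radical of (the group of rational points of) a parabolic subgroup `P`: the largest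
normal subgroup of `P` that consists of unipotent elements. -/
def unipotentRadical (P : Subgroup (ProjGenLinGroup (Fin n) K)) :
    Subgroup (ProjGenLinGroup (Fin n) K) :=
  sSup {U | U ≤ P ∧ (∀ g ∈ P, ∀ u ∈ U, g * u * g⁻¹ ∈ U) ∧ ∀ u ∈ U, IsUnipotentElt u}

/-- `L` is a Levi subgroup of `P`: `P` is the semidirect product of `L` and its unipotent
radical. -/
def IsLevi (L P : Subgroup (ProjGenLinGroup (Fin n) K)) : Prop :=
  L ≤ P ∧ L ⊓ unipotentRadical P = ⊥ ∧ L ⊔ unipotentRadical P = P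

/-- Two parabolic subgroups are opposite if their intersection is a Levi subgroup of both. -/
def IsOpposite (P Q : Subgroup (ProjGenLinGroup (Fin n) K)) : Prop :=
  IsLevi (P ⊓ Q) P ∧ IsLevi (P ⊓ Q) Q

end Group

end

end BTBuilding

/-! The class of `(A, x)` in `X` determines, up to homothety, a norm on `K ^ n`: the columns of `A`
form an orthogonal basis, and the `i`-th of them has length `|π| ^ x i`. A boundary point determines
a flag with real weights, up to increasing affine changes of the weights. The vertex of `W` is the
direction of the indicator vector `ind I` in any basis for which `W` is spanned by the vectors with
index in `I`. Moving towards it shrinks `W` relative to a complement.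

Vertices. For the direction of `ind I`, elimination with transvections shows that `P_c` is the whole
stabilizer of the coordinate subspace, so the point has stabilizer `P_W`. Conversely, if a boundary
point `(A, c)` has stabilizer `P_W`, then invariance under the torus makes `W` a coordinate subspace
in the basis `A`, and the root groups contained in `P_W` force `c` to be the direction of `ind I`.

Complementary subspaces are connected. A basis adapted to `W ⊕ W'` gives one apartment containing
both vertices. They are opposite directions there, since `ind I` and `-ind Iᶜ` differ by a constant
vector, and a straight line joins them.

Connected vertices are complementary. Volumes of `i`-tuples of vectors depend only on the norm, and
comparing them yields majorization inequalities between the sorted coordinate differences of three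
points (`partial_sum_le`). Abel summation and Cauchy-Schwarz turn these into the triangle
inequality, together with its equality case: two differences are parallel up to a permutation
(`len_triangle`). Hence along a geodesic the differences from `γ s` to `γ t` and from `γ s` to `γ T`
have the same shape for all `T > t`. Convergence to the vertex of `W`, expressed by the open
saturated sets coming from `nearSet`, forces this shape to be two-valued, the larger value being
taken `dim W` times (`IsGeodesic.exists_two_valued`). So between two times the norm is multiplied by
`μ` on a subspace of dimension `dim W` and by `μ θ ^ (t - s)` on an orthogonal complement, with one
`θ > 1` for the whole geodesic. A limit argument shows that vectors of `W` are stretched only by `μ`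
after time zero (`IsGeodesic.nrm_le_of_mem`). Applied to both ends, this makes a nonzero vector of
`W ∩ W'` stretch maximally before time zero and minimally after it, contrary to the orthogonal
splitting from time `-1` to time `1`. The dimensions add up to `n` because reversing time
interchanges the large and the small coordinates.

Opposition. The unipotent radical of `P_W` consists of the elements acting trivially on `W` and on
the quotient by `W` (`unipotentRadical_eq`). For complementary subspaces the block diagonal part
splits it off. Otherwise a suitable transvection lies both in the radical of `P_W` and in `P_W'`. -/

namespace BTBuilding

noncomputable section

set_option linter.unusedSectionVars false

/-! ### The absolute value of a prime element -/

/-- The absolute value of a prime element lies strictly between zero and one. -/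
class PrimeNormBounds (K : Type*) [NormedField K] : Prop where
  pos : 0 < primeNorm K
  lt_one : primeNorm K < 1

theorem isUltrametricDist_of_padic (p : ℕ) [Fact p.Prime] (K : Type*) [NormedField K]
    [NormedAlgebra ℚ_[p] K] : IsUltrametricDist K := by
  apply IsUltrametricDist.isUltrametricDist_of_forall_norm_natCast_le_one
  intro m
  have h : ((m : K)) = algebraMap ℚ_[p] K (m : ℚ_[p]) := by simp
  rw [h, norm_algebraMap']
  exact_mod_cast Padic.norm_int_le_one (p := p) (m : ℤ)

/-- The open unit ball is also closed, hence compact, so the norm attains a maximum on it and the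
supremum stays below one. The image of `p` shows that it is positive. -/
theorem primeNormBounds_of_padic (p : ℕ) [Fact p.Prime] (K : Type*) [NormedField K]
    [NormedAlgebra ℚ_[p] K] [FiniteDimensional ℚ_[p] K] : PrimeNormBounds K := by
  have hu := isUltrametricDist_of_padic p K
  have hpr : ProperSpace K := FiniteDimensional.proper ℚ_[p] K
  have hbdd : BddAbove {r : ℝ | r < 1 ∧ ∃ x : K, r = ‖x‖} := ⟨1, fun r hr => hr.1.le⟩
  have hp1 : 1 < p := (Fact.out : p.Prime).one_lt
  have hpm : (p : ℝ)⁻¹ ∈ {r : ℝ | r < 1 ∧ ∃ x : K, r = ‖x‖} := by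
    refine ⟨inv_lt_one_of_one_lt₀ (by exact_mod_cast hp1), algebraMap ℚ_[p] K p, ?_⟩
    rw [norm_algebraMap', Padic.norm_p]
  refine ⟨?_, ?_⟩
  · refine lt_of_lt_of_le ?_ (le_csSup hbdd hpm)
    positivity
  · have hc : IsCompact (Metric.ball (0 : K) 1) :=
      (isCompact_closedBall (0 : K) 1).of_isClosed_subset (IsUltrametricDist.isClosed_ball _ _)
        Metric.ball_subset_closedBall
    obtain ⟨x, hx, hmax⟩ := hc.exists_isMaxOn ⟨0, by simp⟩ continuous_norm.continuousOn
    refine lt_of_le_of_lt (csSup_le ⟨_, hpm⟩ ?_) (by simpa using hx : ‖x‖ < 1)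
    rintro r ⟨hr, y, rfl⟩
    exact hmax (by simpa using hr)

variable {n : ℕ} {K : Type*} [NormedField K]

section PrimeNorm

variable [PrimeNormBounds K]

variable (K) in
theorem primeNorm_pos : 0 < primeNorm K := PrimeNormBounds.pos

variable (K) in
theorem primeNorm_lt_one : primeNorm K < 1 := PrimeNormBounds.lt_one

variable (K) in
theorem primeNorm_rpow_pos (x : ℝ) : 0 < primeNorm K ^ x := Real.rpow_pos_of_pos (primeNorm_pos K) x

variable (K) in
theorem primeNorm_rpow_add (x y : ℝ) : primeNorm K ^ (x + y) = primeNorm K ^ x * primeNorm K ^ y :=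
  Real.rpow_add (primeNorm_pos K) x y

variable (K) in
theorem primeNorm_rpow_neg (x : ℝ) : primeNorm K ^ (-x) = (primeNorm K ^ x)⁻¹ :=
  Real.rpow_neg (primeNorm_pos K).le x

variable (K) in
theorem primeNorm_rpow_le_iff (x y : ℝ) : primeNorm K ^ x ≤ primeNorm K ^ y ↔ y ≤ x :=
  Real.rpow_le_rpow_left_iff_of_base_lt_one (primeNorm_pos K) (primeNorm_lt_one K)

variable (K) in
theorem primeNorm_rpow_lt_iff (x y : ℝ) : primeNorm K ^ x < primeNorm K ^ y ↔ y < x :=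
  Real.rpow_lt_rpow_left_iff_of_base_lt_one (primeNorm_pos K) (primeNorm_lt_one K)

theorem primeNorm_rpow_val {a : K} (ha : a ≠ 0) : primeNorm K ^ val a = ‖a‖ := by
  have h1 : Real.log (primeNorm K) ≠ 0 :=
    (Real.log_neg (primeNorm_pos K) (primeNorm_lt_one K)).ne
  rw [Real.rpow_def_of_pos (primeNorm_pos K), val, mul_div_cancel₀ _ h1,
    Real.exp_log (norm_pos_iff.2 ha)]

variable (K) in
/-- Every positive real number is a power of the absolute value of a prime element. -/
theorem exists_primeNorm_rpow_eq {r : ℝ} (hr : 0 < r) : ∃ x : ℝ, primeNorm K ^ x = r := by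
  have h1 : Real.log (primeNorm K) ≠ 0 :=
    (Real.log_neg (primeNorm_pos K) (primeNorm_lt_one K)).ne
  exact ⟨Real.log r / Real.log (primeNorm K), by
    rw [Real.rpow_def_of_pos (primeNorm_pos K), mul_div_cancel₀ _ h1, Real.exp_log hr]⟩

end PrimeNorm

/-! ### Weighted sup norms -/

/-- The norm on `K ^ n` for which the standard basis is orthogonal and the `i`-th basis vector has
norm `|π| ^ (x i)`. -/
def wnorm (x : Fin n → ℝ) (v : Fin n → K) : ℝ := ‖fun i => ‖v i‖ * primeNorm K ^ x i‖

/-- The norm on `K ^ n` that is attached to the point of the building represented by `(A, x)`. -/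
def nrm (A : GL (Fin n) K) (x : Fin n → ℝ) (u : Fin n → K) : ℝ :=
  wnorm x ((↑A⁻¹ : Matrix (Fin n) (Fin n) K) *ᵥ u)

@[simp] theorem inv_mulVec_mulVec (A : GL (Fin n) K) (v : Fin n → K) :
    (↑A⁻¹ : Matrix (Fin n) (Fin n) K) *ᵥ ((A : Matrix (Fin n) (Fin n) K) *ᵥ v) = v := by
  rw [Matrix.mulVec_mulVec, ← Units.val_mul, inv_mul_cancel, Units.val_one, Matrix.one_mulVec]

@[simp] theorem mulVec_inv_mulVec (A : GL (Fin n) K) (v : Fin n → K) :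
    (A : Matrix (Fin n) (Fin n) K) *ᵥ ((↑A⁻¹ : Matrix (Fin n) (Fin n) K) *ᵥ v) = v := by
  rw [Matrix.mulVec_mulVec, ← Units.val_mul, mul_inv_cancel, Units.val_one, Matrix.one_mulVec]

theorem nrm_mulVec (A : GL (Fin n) K) (x : Fin n → ℝ) (v : Fin n → K) :
    nrm A x ((A : Matrix (Fin n) (Fin n) K) *ᵥ v) = wnorm x v := by
  rw [nrm, inv_mulVec_mulVec]

theorem wnorm_nonneg (x : Fin n → ℝ) (v : Fin n → K) : 0 ≤ wnorm x v := norm_nonneg _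

theorem nrm_nonneg (A : GL (Fin n) K) (x : Fin n → ℝ) (v : Fin n → K) : 0 ≤ nrm A x v :=
  norm_nonneg _

section PrimeNorm

variable [PrimeNormBounds K]

theorem wnorm_le_iff {x : Fin n → ℝ} {v : Fin n → K} {C : ℝ} (hC : 0 ≤ C) :
    wnorm x v ≤ C ↔ ∀ i, ‖v i‖ * primeNorm K ^ x i ≤ C := by
  rw [wnorm, pi_norm_le_iff_of_nonneg hC]
  refine forall_congr' fun i => ?_
  rw [Real.norm_of_nonneg (mul_nonneg (norm_nonneg _) (primeNorm_rpow_pos K _).le)]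

theorem le_wnorm (x : Fin n → ℝ) (v : Fin n → K) (i : Fin n) :
    ‖v i‖ * primeNorm K ^ x i ≤ wnorm x v :=
  (wnorm_le_iff (wnorm_nonneg x v)).1 le_rfl i

theorem exists_eq_wnorm [NeZero n] (x : Fin n → ℝ) (v : Fin n → K) :
    ∃ i, wnorm x v = ‖v i‖ * primeNorm K ^ x i := by
  obtain ⟨i, -, hi⟩ := Finset.exists_max_image (Finset.univ : Finset (Fin n))
    (fun i => ‖v i‖ * primeNorm K ^ x i) ⟨0, Finset.mem_univ _⟩
  refine ⟨i, le_antisymm ?_ (le_wnorm x v i)⟩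
  rw [wnorm_le_iff (mul_nonneg (norm_nonneg _) (primeNorm_rpow_pos K _).le)]
  exact fun j => hi j (Finset.mem_univ _)

theorem wnorm_smul (x : Fin n → ℝ) (a : K) (v : Fin n → K) :
    wnorm x (a • v) = ‖a‖ * wnorm x v := by
  have : (fun i => ‖(a • v) i‖ * primeNorm K ^ x i) =
      ‖a‖ • fun i => ‖v i‖ * primeNorm K ^ x i := by
    ext i
    simp [mul_assoc]
  rw [wnorm, this, norm_smul, wnorm, norm_norm]

theorem nrm_smul (A : GL (Fin n) K) (x : Fin n → ℝ) (a : K) (v : Fin n → K) :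
    nrm A x (a • v) = ‖a‖ * nrm A x v := by
  rw [nrm, Matrix.mulVec_smul, wnorm_smul, nrm]

theorem wnorm_eq_zero {x : Fin n → ℝ} {v : Fin n → K} : wnorm x v = 0 ↔ v = 0 := by
  rw [wnorm, norm_eq_zero]
  simp only [funext_iff, Pi.zero_apply, mul_eq_zero, norm_eq_zero]
  exact forall_congr' fun i => or_iff_left (primeNorm_rpow_pos K _).ne'

theorem nrm_eq_zero {A : GL (Fin n) K} {x : Fin n → ℝ} {v : Fin n → K} :
    nrm A x v = 0 ↔ v = 0 := by
  rw [nrm, wnorm_eq_zero]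
  refine ⟨fun h => ?_, fun h => by rw [h, Matrix.mulVec_zero]⟩
  rw [← mulVec_inv_mulVec A v, h, Matrix.mulVec_zero]

theorem wnorm_pos {x : Fin n → ℝ} {v : Fin n → K} (hv : v ≠ 0) : 0 < wnorm x v :=
  lt_of_le_of_ne (wnorm_nonneg x v) fun h => hv (wnorm_eq_zero.1 h.symm)

theorem nrm_pos {A : GL (Fin n) K} {x : Fin n → ℝ} {v : Fin n → K} (hv : v ≠ 0) :
    0 < nrm A x v :=
  lt_of_le_of_ne (nrm_nonneg A x v) fun h => hv (nrm_eq_zero.1 h.symm)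

theorem wnorm_single (x : Fin n → ℝ) (i : Fin n) (a : K) :
    wnorm x (Pi.single i a) = ‖a‖ * primeNorm K ^ x i := by
  refine le_antisymm ?_ (by simpa using le_wnorm x (Pi.single i a) i)
  rw [wnorm_le_iff (mul_nonneg (norm_nonneg _) (primeNorm_rpow_pos K _).le)]
  intro j
  by_cases h : j = i
  · subst h; simp
  · simp only [Pi.single_eq_of_ne h, norm_zero, zero_mul]
    exact mul_nonneg (norm_nonneg _) (primeNorm_rpow_pos K _).le

theorem wnorm_add_const (x : Fin n → ℝ) (r : ℝ) (v : Fin n → K) :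
    wnorm (fun i => x i + r) v = primeNorm K ^ r * wnorm x v := by
  have : (fun i => ‖v i‖ * primeNorm K ^ (x i + r)) =
      primeNorm K ^ r • fun i => ‖v i‖ * primeNorm K ^ x i := by
    ext i
    simp only [primeNorm_rpow_add, Pi.smul_apply, smul_eq_mul]
    ring
  rw [wnorm, this, norm_smul, Real.norm_of_nonneg (primeNorm_rpow_pos K _).le, wnorm]

theorem nrm_add_const (A : GL (Fin n) K) (x : Fin n → ℝ) (r : ℝ) (v : Fin n → K) :
    nrm A (fun i => x i + r) v = primeNorm K ^ r * nrm A x v :=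
  wnorm_add_const _ _ _

/-- Two points on one apartment: stretching on vectors whose support satisfies bounds. -/
theorem wnorm_le_of_support {x y : Fin n → ℝ} {v : Fin n → K} {r : ℝ}
    (h : ∀ i, v i ≠ 0 → x i + r ≤ y i) : wnorm y v ≤ primeNorm K ^ r * wnorm x v := by
  rw [wnorm_le_iff (mul_nonneg (primeNorm_rpow_pos K _).le (wnorm_nonneg _ _))]
  intro i
  by_cases hv : v i = 0
  · simp only [hv, norm_zero, zero_mul]
    exact mul_nonneg (primeNorm_rpow_pos K _).le (wnorm_nonneg _ _)
  · calc ‖v i‖ * primeNorm K ^ y i ≤ ‖v i‖ * primeNorm K ^ (x i + r) := by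
          exact mul_le_mul_of_nonneg_left ((primeNorm_rpow_le_iff K _ _).2 (h i hv)) (norm_nonneg _)
      _ = primeNorm K ^ r * (‖v i‖ * primeNorm K ^ x i) := by
          rw [primeNorm_rpow_add]; ring
      _ ≤ _ := by
          gcongr
          · exact (primeNorm_rpow_pos K _).le
          · exact le_wnorm _ _ _

theorem le_wnorm_of_support {x y : Fin n → ℝ} {v : Fin n → K} {r : ℝ}
    (h : ∀ i, v i ≠ 0 → y i ≤ x i + r) : primeNorm K ^ r * wnorm x v ≤ wnorm y v := by
  have := wnorm_le_of_support (x := y) (y := x) (v := v) (r := -r)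
    (fun i hi => by linarith [h i hi])
  rw [primeNorm_rpow_neg, ← div_eq_inv_mul, le_div_iff₀ (primeNorm_rpow_pos K _)] at this
  linarith

/-! ### Consequences of the ultrametric inequality -/

section Ultrametric

variable [IsUltrametricDist K]

theorem wnorm_add_le (x : Fin n → ℝ) (v w : Fin n → K) :
    wnorm x (v + w) ≤ max (wnorm x v) (wnorm x w) := by
  rw [wnorm_le_iff (le_max_of_le_left (wnorm_nonneg _ _))]
  intro i
  have h1 : ‖v i + w i‖ ≤ max ‖v i‖ ‖w i‖ := IsUltrametricDist.norm_add_le_max _ _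
  have h2 := primeNorm_rpow_pos K (x i)
  rcases le_max_iff.1 h1 with h | h
  · exact le_max_of_le_left ((mul_le_mul_of_nonneg_right h h2.le).trans (le_wnorm x v i))
  · exact le_max_of_le_right ((mul_le_mul_of_nonneg_right h h2.le).trans (le_wnorm x w i))

theorem nrm_add_le (A : GL (Fin n) K) (x : Fin n → ℝ) (v w : Fin n → K) :
    nrm A x (v + w) ≤ max (nrm A x v) (nrm A x w) := by
  rw [nrm, Matrix.mulVec_add]
  exact wnorm_add_le _ _ _

theorem nrm_neg (A : GL (Fin n) K) (x : Fin n → ℝ) (v : Fin n → K) :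
    nrm A x (-v) = nrm A x v := by
  simpa using nrm_smul A x (-1) v

theorem nrm_sub_le (A : GL (Fin n) K) (x : Fin n → ℝ) (v w : Fin n → K) :
    nrm A x (v - w) ≤ max (nrm A x v) (nrm A x w) := by
  rw [sub_eq_add_neg, ← nrm_neg A x w]
  exact nrm_add_le A x v (-w)

/-- If `w` is shorter than `v`, then `v + w` has the length of `v`. -/
theorem nrm_add_eq_of_lt {A : GL (Fin n) K} {x : Fin n → ℝ} {v w : Fin n → K}
    (h : nrm A x w < nrm A x v) : nrm A x (v + w) = nrm A x v := by
  refine le_antisymm ((nrm_add_le A x v w).trans (max_le le_rfl h.le)) ?_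
  by_contra! h'
  have := nrm_sub_le A x (v + w) w
  rw [add_sub_cancel_right] at this
  exact absurd this (not_le.2 (max_lt h' h))

theorem norm_mulVec_le {M : Matrix (Fin n) (Fin n) K} {C : ℝ} (hC : 0 ≤ C)
    (hM : ∀ i j, ‖M i j‖ ≤ C) (v : Fin n → K) : ‖M *ᵥ v‖ ≤ C * ‖v‖ := by
  rw [pi_norm_le_iff_of_nonneg (by positivity)]
  intro i
  change ‖∑ j, M i j * v j‖ ≤ C * ‖v‖
  refine IsUltrametricDist.norm_sum_le_of_forall_le_of_nonneg (M := K) (by positivity)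
    fun j _ => ?_
  rw [norm_mul]
  exact mul_le_mul (hM i j) (norm_le_pi_norm v j) (norm_nonneg _) hC

theorem exists_forall_norm_entry_le (M : Matrix (Fin n) (Fin n) K) :
    ∃ C : ℝ, 0 < C ∧ ∀ i j, ‖M i j‖ ≤ C := by
  obtain ⟨C, hC⟩ := (Set.finite_range fun p : Fin n × Fin n => ‖M p.1 p.2‖).bddAbove
  exact ⟨max C 1, by positivity, fun i j => le_max_of_le_left (hC ⟨(i, j), rfl⟩)⟩

theorem exists_norm_mulVec_le (A : GL (Fin n) K) : ∃ C : ℝ, 1 ≤ C ∧ ∀ v : Fin n → K,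
    ‖(A : Matrix (Fin n) (Fin n) K) *ᵥ v‖ ≤ C * ‖v‖ ∧
      ‖v‖ ≤ C * ‖(A : Matrix (Fin n) (Fin n) K) *ᵥ v‖ := by
  obtain ⟨C₁, h₁, hC₁⟩ := exists_forall_norm_entry_le (A : Matrix (Fin n) (Fin n) K)
  obtain ⟨C₂, h₂, hC₂⟩ := exists_forall_norm_entry_le (↑A⁻¹ : Matrix (Fin n) (Fin n) K)
  refine ⟨max (max C₁ C₂) 1, le_max_right _ _, fun v => ⟨?_, ?_⟩⟩
  · exact norm_mulVec_le (by positivity) (fun i j => (hC₁ i j).trans (by simp)) v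
  · have := norm_mulVec_le (C := max (max C₁ C₂) 1) (by positivity)
      (fun i j => (hC₂ i j).trans (by simp)) ((A : Matrix (Fin n) (Fin n) K) *ᵥ v)
    rwa [inv_mulVec_mulVec] at this

/-- The norm attached to a point is equivalent to the sup norm. -/
theorem exists_nrm_bounds (A : GL (Fin n) K) (x : Fin n → ℝ) : ∃ C : ℝ, 1 ≤ C ∧ ∀ v : Fin n → K,
    nrm A x v ≤ C * ‖v‖ ∧ ‖v‖ ≤ C * nrm A x v := by
  obtain ⟨C, hC1, hC⟩ := exists_norm_mulVec_le A⁻¹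
  obtain ⟨r, hr⟩ := (Set.finite_range x).bddAbove
  obtain ⟨s, hs⟩ := (Set.finite_range x).bddBelow
  have h1 : ∀ v : Fin n → K, wnorm x v ≤ primeNorm K ^ s * ‖v‖ := by
    intro v
    rw [wnorm_le_iff (mul_nonneg (primeNorm_rpow_pos K _).le (norm_nonneg _))]
    intro i
    rw [mul_comm]
    exact mul_le_mul ((primeNorm_rpow_le_iff K _ _).2 (hs ⟨i, rfl⟩)) (norm_le_pi_norm v i)
      (norm_nonneg _) (primeNorm_rpow_pos K _).le
  have h2 : ∀ v : Fin n → K, ‖v‖ ≤ (primeNorm K ^ r)⁻¹ * wnorm x v := by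
    intro v
    have hp := primeNorm_rpow_pos K r
    rw [pi_norm_le_iff_of_nonneg (mul_nonneg (inv_pos.2 hp).le (wnorm_nonneg _ _))]
    intro i
    rw [← div_eq_inv_mul, le_div_iff₀ hp]
    refine le_trans ?_ (le_wnorm x v i)
    exact mul_le_mul_of_nonneg_left ((primeNorm_rpow_le_iff K _ _).2 (hr ⟨i, rfl⟩)) (norm_nonneg _)
  refine ⟨C * max (max (primeNorm K ^ s) (primeNorm K ^ r)⁻¹) 1, ?_, fun v => ⟨?_, ?_⟩⟩
  · exact one_le_mul_of_one_le_of_one_le hC1 (le_max_right _ _)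
  · have hw : (0 : ℝ) ≤ C := by linarith
    calc nrm A x v ≤ primeNorm K ^ s * ‖(↑A⁻¹ : Matrix (Fin n) (Fin n) K) *ᵥ v‖ := h1 _
      _ ≤ max (max (primeNorm K ^ s) (primeNorm K ^ r)⁻¹) 1 * (C * ‖v‖) := by
          refine mul_le_mul (by simp) (hC v).1 (norm_nonneg _) (by positivity)
      _ = _ := by ring
  · have hw : (0 : ℝ) ≤ C := by linarith
    calc ‖v‖ ≤ C * ‖(↑A⁻¹ : Matrix (Fin n) (Fin n) K) *ᵥ v‖ := (hC v).2
      _ ≤ C * ((primeNorm K ^ r)⁻¹ * nrm A x v) := by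
          gcongr
          exact h2 _
      _ ≤ C * (max (max (primeNorm K ^ s) (primeNorm K ^ r)⁻¹) 1 * nrm A x v) := by
          gcongr
          · exact nrm_nonneg _ _ _
          · simp
      _ = _ := by ring

end Ultrametric

end PrimeNorm

end

end BTBuilding

namespace BTBuilding

noncomputable section

set_option linter.unusedSectionVars false

/-! ### Representatives of points of the apartment -/

variable {n : ℕ} {K : Type*} [NormedField K]

theorem Apt.mk_surjective : Function.Surjective (Apt.mk (n := n)) :=
  Submodule.Quotient.mk_surjective _

theorem Apt.mk_eq_mk_iff {x y : Fin n → ℝ} :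
    Apt.mk x = Apt.mk y ↔ ∃ r : ℝ, ∀ i, y i = x i + r := by
  rw [Apt.mk, Apt.mk, eq_comm, Submodule.Quotient.eq, Submodule.mem_span_singleton]
  refine exists_congr fun r => ?_
  rw [funext_iff]
  refine forall_congr' fun i => ?_
  simp only [Pi.smul_apply, smul_eq_mul, mul_one, Pi.sub_apply]
  constructor <;> intro h <;> linarith

theorem Apt.mk_smul (r : ℝ) (x : Fin n → ℝ) : Apt.mk (r • x) = r • Apt.mk x := rfl

theorem Apt.mk_add (x y : Fin n → ℝ) : Apt.mk (x + y) = Apt.mk x + Apt.mk y := rfl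

theorem Apt.mk_sub (x y : Fin n → ℝ) : Apt.mk (x - y) = Apt.mk x - Apt.mk y := rfl

theorem Apt.mk_neg (x : Fin n → ℝ) : Apt.mk (-x) = -Apt.mk x := rfl

theorem Apt.mk_eq_zero_iff {x : Fin n → ℝ} : Apt.mk x = 0 ↔ ∃ r : ℝ, ∀ i, x i = r := by
  have : (0 : Apt n) = Apt.mk 0 := rfl
  rw [this, eq_comm, Apt.mk_eq_mk_iff]
  simp

@[simp] theorem root_mk (i j : Fin n) (x : Fin n → ℝ) : root i j (Apt.mk x) = x i - x j := rfl

@[simp] theorem weyl_mk (σ : Equiv.Perm (Fin n)) (x : Fin n → ℝ) :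
    weyl σ (Apt.mk x) = Apt.mk fun i => x (σ.symm i) := rfl

/-- The vector `x` of `ℝ ^ n` represents the direction `c`. -/
def IsDir (x : Fin n → ℝ) (c : Module.Ray ℝ (Apt n)) : Prop :=
  ∃ h : Apt.mk x ≠ 0, rayOfNeZero ℝ (Apt.mk x) h = c

theorem exists_isDir (c : Module.Ray ℝ (Apt n)) : ∃ x, IsDir x c := by
  obtain ⟨x, hx⟩ := Apt.mk_surjective c.someVector
  refine ⟨x, ?_, ?_⟩
  · rw [hx]; exact c.someVector_ne_zero
  · simp only [hx]
    exact c.someVector_ray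

theorem isDir_iff_affine {x y : Fin n → ℝ} {c : Module.Ray ℝ (Apt n)} (hx : IsDir x c) :
    IsDir y c ↔ ∃ a b : ℝ, 0 < a ∧ ∀ i, y i = a * x i + b := by
  obtain ⟨hx0, rfl⟩ := hx
  constructor
  · rintro ⟨hy0, hy⟩
    rw [eq_comm, ray_eq_iff] at hy
    obtain ⟨a, ha, h⟩ := hy.exists_pos_left hx0 hy0
    rw [← Apt.mk_smul, Apt.mk_eq_mk_iff] at h
    obtain ⟨b, hb⟩ := h
    exact ⟨a, b, ha, hb⟩
  · rintro ⟨a, b, ha, hb⟩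
    have h : a • Apt.mk x = Apt.mk y := by
      rw [← Apt.mk_smul, Apt.mk_eq_mk_iff]
      exact ⟨b, hb⟩
    refine ⟨?_, ?_⟩
    · rw [← h]
      exact smul_ne_zero ha.ne' hx0
    · rw [ray_eq_iff, ← h]
      exact SameRay.sameRay_pos_smul_left _ ha

theorem IsDir.exists_someVector {x : Fin n → ℝ} {c : Module.Ray ℝ (Apt n)} (hx : IsDir x c) :
    ∃ a : ℝ, 0 < a ∧ c.someVector = a • Apt.mk x := by
  obtain ⟨y, hy⟩ := Apt.mk_surjective c.someVector
  have hyd : IsDir y c := by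
    refine ⟨?_, ?_⟩
    · rw [hy]; exact c.someVector_ne_zero
    · simp only [hy]
      exact c.someVector_ray
  obtain ⟨a, b, ha, hb⟩ := (isDir_iff_affine hx).1 hyd
  refine ⟨a, ha, ?_⟩
  rw [← hy, eq_comm, ← Apt.mk_smul, Apt.mk_eq_mk_iff]
  exact ⟨b, hb⟩

theorem IsDir.map_weyl {x : Fin n → ℝ} {c : Module.Ray ℝ (Apt n)} (hx : IsDir x c)
    (σ : Equiv.Perm (Fin n)) : IsDir (fun i => x (σ.symm i)) (Module.Ray.map (weyl σ) c) := by
  obtain ⟨hx0, rfl⟩ := hx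
  refine ⟨?_, ?_⟩
  · rw [← weyl_mk]
    exact (weyl σ).map_ne_zero_iff.2 hx0
  · rw [Module.Ray.map_apply]
    rfl

/-! ### Lifting subgroups of `PGL` -/

theorem mk_eq_iff_smul {A A' : GL (Fin n) K} (h : ProjGenLinGroup.mk A = ProjGenLinGroup.mk A') :
    ∃ u : Kˣ, (∀ v, (A' : Matrix (Fin n) (Fin n) K) *ᵥ v =
        (u : K) • ((A : Matrix (Fin n) (Fin n) K) *ᵥ v)) ∧
      ∀ v, (↑A'⁻¹ : Matrix (Fin n) (Fin n) K) *ᵥ v =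
        (↑u⁻¹ : K) • ((↑A⁻¹ : Matrix (Fin n) (Fin n) K) *ᵥ v) := by
  obtain ⟨u, hu⟩ := ProjGenLinGroup.mk_eq_mk_iff.1 h
  have h1 : ∀ v, (A' : Matrix (Fin n) (Fin n) K) *ᵥ v =
        (u : K) • ((A : Matrix (Fin n) (Fin n) K) *ᵥ v) := by
    intro v
    rw [← hu, Units.val_mul, ← Matrix.mulVec_mulVec]
    simp [Matrix.mulVec_smul]
  refine ⟨u, h1, fun v => ?_⟩
  apply_fun fun w => (A' : Matrix (Fin n) (Fin n) K) *ᵥ w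
  · simp only [mulVec_inv_mulVec]
    rw [Matrix.mulVec_smul, h1, smul_smul, mulVec_inv_mulVec]
    simp
  · intro v w hvw
    have := congrArg (fun z => (↑A'⁻¹ : Matrix (Fin n) (Fin n) K) *ᵥ z) hvw
    simpa using this

/-- The `GL`-elements preserving `wnorm x` up to a constant. -/
def normStabilizer [PrimeNormBounds K] (x : Fin n → ℝ) : Subgroup (GL (Fin n) K) where
  carrier := {Q | ∃ r : ℝ, ∀ v, wnorm x ((Q : Matrix (Fin n) (Fin n) K) *ᵥ v) =
    primeNorm K ^ r * wnorm x v}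
  one_mem' := ⟨0, by simp⟩
  mul_mem' := by
    rintro Q Q' ⟨r, hr⟩ ⟨r', hr'⟩
    refine ⟨r + r', fun v => ?_⟩
    rw [Units.val_mul, ← Matrix.mulVec_mulVec, hr, hr', primeNorm_rpow_add, mul_assoc]
  inv_mem' := by
    rintro Q ⟨r, hr⟩
    refine ⟨-r, fun v => ?_⟩
    have := hr ((↑Q⁻¹ : Matrix (Fin n) (Fin n) K) *ᵥ v)
    rw [mulVec_inv_mulVec] at this
    rw [this, primeNorm_rpow_neg, inv_mul_cancel_left₀ (primeNorm_rpow_pos K r).ne']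

/-- The `GL`-elements preserving the flag of coordinate subspaces defined by `x`. -/
def flagStabilizer (x : Fin n → ℝ) : Subgroup (GL (Fin n) K) where
  carrier := {Q | ∀ (s : ℝ) (v : Fin n → K),
    (∀ i, ((Q : Matrix (Fin n) (Fin n) K) *ᵥ v) i ≠ 0 → s ≤ x i) ↔ ∀ i, v i ≠ 0 → s ≤ x i}
  one_mem' := by simp
  mul_mem' := by
    intro Q Q' h h' s v
    rw [Units.val_mul, ← Matrix.mulVec_mulVec, h, h']
  inv_mem' := by
    intro Q h s v
    rw [← h, mulVec_inv_mulVec]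

/-- A subgroup containing the scalars is the full preimage of its image. All invariants used below
are insensitive to scalars, so they can be tested on any matrix representing a class. -/
theorem mem_of_mk_mem_map {H : Subgroup (GL (Fin n) K)}
    (hs : ∀ u : Kˣ, GeneralLinearGroup.scalar (Fin n) u ∈ H) {Q : GL (Fin n) K}
    (h : ProjGenLinGroup.mk Q ∈ H.map ProjGenLinGroup.mk) : Q ∈ H := by
  obtain ⟨Q', hQ', e⟩ := h
  obtain ⟨u, rfl⟩ := ProjGenLinGroup.mk_eq_mk_iff.1 e
  exact H.mul_mem hQ' (hs u)

theorem monomial_mulVec (t : Fin n → Kˣ) (σ : Equiv.Perm (Fin n)) (v : Fin n → K) (i : Fin n) :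
    (monomial t σ *ᵥ v) i = t i * v (σ.symm i) := by
  change ∑ j, monomial t σ i j * v j = _
  rw [Finset.sum_eq_single (σ.symm i)]
  · simp [monomial]
  · intro j _ hj
    have : i ≠ σ j := fun h => hj (by rw [h, Equiv.symm_apply_apply])
    simp [monomial, this]
  · simp

theorem one_add_single_mulVec (i j : Fin n) (u : K) (v : Fin n → K) :
    (1 + Matrix.single i j u) *ᵥ v = v + Pi.single i (u * v j) := by
  rw [Matrix.add_mulVec, Matrix.one_mulVec, Matrix.single_mulVec]
  congr 1

section PrimeNorm

variable [PrimeNormBounds K]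

theorem scalar_mem_normStabilizer (x : Fin n → ℝ) (u : Kˣ) :
    GeneralLinearGroup.scalar (Fin n) u ∈ normStabilizer (K := K) x := by
  obtain ⟨r, hr⟩ := exists_primeNorm_rpow_eq K (norm_pos_iff.2 u.ne_zero)
  refine ⟨r, fun v => ?_⟩
  have : (GeneralLinearGroup.scalar (Fin n) u : Matrix (Fin n) (Fin n) K) *ᵥ v = (u : K) • v := by
    ext i; simp
  rw [this, wnorm_smul, hr]

theorem wnorm_monomial (t : Fin n → Kˣ) (σ : Equiv.Perm (Fin n)) (x : Fin n → ℝ)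
    (v : Fin n → K) :
    wnorm (fun i => -val (t i : K) + x (σ.symm i)) (monomial t σ *ᵥ v) = wnorm x v := by
  have h : ∀ i, ‖(monomial t σ *ᵥ v) i‖ * primeNorm K ^ (-val (t i : K) + x (σ.symm i)) =
      ‖v (σ.symm i)‖ * primeNorm K ^ x (σ.symm i) := by
    intro i
    rw [monomial_mulVec, norm_mul, primeNorm_rpow_add, primeNorm_rpow_neg,
      primeNorm_rpow_val (t i).ne_zero]
    have : ‖(t i : K)‖ ≠ 0 := norm_ne_zero_iff.2 (t i).ne_zero
    field_simp
  apply le_antisymm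
  · rw [wnorm_le_iff (wnorm_nonneg _ _)]
    intro i
    rw [h]
    exact le_wnorm x v _
  · rw [wnorm_le_iff (wnorm_nonneg _ _)]
    intro i
    have := h (σ i)
    rw [Equiv.symm_apply_apply] at this
    rw [← this]
    refine le_trans (le_of_eq ?_) (le_wnorm _ _ (σ i))
    simp

variable [IsUltrametricDist K]

theorem wnorm_one_add_single {i j : Fin n} (hij : i ≠ j) {u : K} {x : Fin n → ℝ}
    (hu : u = 0 ∨ -(x i - x j) ≤ val u) (v : Fin n → K) :
    wnorm x ((1 + Matrix.single i j u) *ᵥ v) = wnorm x v := by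
  have key : ∀ (u' : K) (w : Fin n → K), ‖u'‖ = ‖u‖ →
      wnorm x (w + Pi.single i (u' * w j)) ≤ wnorm x w := by
    intro u' w h
    refine (wnorm_add_le _ _ _).trans (max_le le_rfl ?_)
    rw [wnorm_single, norm_mul, h]
    refine le_trans ?_ (le_wnorm x w j)
    rcases eq_or_ne u 0 with rfl | hu0
    · simp only [norm_zero, zero_mul]
      exact mul_nonneg (norm_nonneg _) (primeNorm_rpow_pos K _).le
    · have h1 := (primeNorm_rpow_le_iff K _ _).2 (hu.resolve_left hu0)
      rw [primeNorm_rpow_val hu0] at h1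
      calc ‖u‖ * ‖w j‖ * primeNorm K ^ x i
          ≤ primeNorm K ^ (-(x i - x j)) * ‖w j‖ * primeNorm K ^ x i := by
            have := primeNorm_rpow_pos K (x i)
            gcongr
        _ = ‖w j‖ * (primeNorm K ^ (-(x i - x j)) * primeNorm K ^ x i) := by ring
        _ = ‖w j‖ * primeNorm K ^ x j := by rw [← primeNorm_rpow_add]; congr 2; ring
  rw [one_add_single_mulVec]
  refine le_antisymm (key u v rfl) ?_
  have := key (-u) (v + Pi.single i (u * v j)) (norm_neg u)
  have e : (v + Pi.single i (u * v j) : Fin n → K) j = v j := by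
    simp [Pi.single_eq_of_ne hij.symm]
  rw [e, add_assoc, ← Pi.single_add] at this
  simpa using this

/-- It suffices to test generators. A monomial matrix carries the norm of `x` to that of its
translate, which is homothetic to it when the class of `x` is fixed. The bound on `val u` says
exactly that `1 + u E_{ij}` does not lengthen any vector, and neither does its inverse. -/
theorem stab_inl_le (x : Fin n → ℝ) :
    stab (K := K) (Sum.inl (Apt.mk x)) ≤ (normStabilizer x).map ProjGenLinGroup.mk := by
  rw [stab, Subgroup.closure_le]
  rintro g (⟨t, σ, hfix, Q, hQ, rfl⟩ | ⟨i, j, u, hij, hu, Q, hQ, rfl⟩)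
  · refine ⟨Q, ?_, rfl⟩
    have h1 : Apt.mk (fun i => -val (t i : K) + x (σ.symm i)) = Apt.mk x := Sum.inl.inj hfix
    obtain ⟨r, hr⟩ := Apt.mk_eq_mk_iff.1 h1
    refine ⟨r, fun v => ?_⟩
    rw [hQ, funext hr, wnorm_add_const, wnorm_monomial, ← funext hr]
  · exact ⟨Q, ⟨0, fun v => by
      rw [hQ, wnorm_one_add_single hij hu, Real.rpow_zero, one_mul]⟩, rfl⟩

end PrimeNorm

theorem scalar_mem_flagStabilizer (x : Fin n → ℝ) (u : Kˣ) :
    GeneralLinearGroup.scalar (Fin n) u ∈ flagStabilizer (K := K) x := by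
  intro s v
  have : (GeneralLinearGroup.scalar (Fin n) u : Matrix (Fin n) (Fin n) K) *ᵥ v = (u : K) • v := by
    ext i; simp
  rw [this]
  simp

theorem flagStabilizer_one_add_single {i j : Fin n} (hij : i ≠ j) {u : K} {x : Fin n → ℝ}
    (hx : x j ≤ x i) (s : ℝ) (v : Fin n → K) :
    (∀ k, ((1 + Matrix.single i j u) *ᵥ v) k ≠ 0 → s ≤ x k) ↔ ∀ k, v k ≠ 0 → s ≤ x k := by
  have key : ∀ (u' : K) (w : Fin n → K), (∀ k, w k ≠ 0 → s ≤ x k) →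
      ∀ k, (w + Pi.single i (u' * w j) : Fin n → K) k ≠ 0 → s ≤ x k := by
    intro u' w hw k hk
    by_cases hki : k = i
    · subst hki
      by_cases h : w j = 0
      · exact hw k (by simpa [h] using hk)
      · exact (hw j h).trans hx
    · exact hw k (by simpa [Pi.single_eq_of_ne hki] using hk)
  rw [one_add_single_mulVec]
  refine ⟨fun h => ?_, key u v⟩
  have := key (-u) _ h
  have e : (v + Pi.single i (u * v j) : Fin n → K) j = v j := by
    simp [Pi.single_eq_of_ne hij.symm]
  rw [e, add_assoc, ← Pi.single_add] at this
  simpa using this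

/-- Diagonal matrices do not change supports, and `1 + u E_{ij}` adds to a support only an index
whose weight is at least that of an index already in it. -/
theorem stab_inr_le {x : Fin n → ℝ} {c : Module.Ray ℝ (Apt n)} (hx : IsDir x c) :
    stab (K := K) (Sum.inr c) ≤ (flagStabilizer x).map ProjGenLinGroup.mk := by
  obtain ⟨a, ha, hc⟩ := hx.exists_someVector
  rw [stab, Subgroup.closure_le]
  rintro g (⟨t, Q, hQ, rfl⟩ | ⟨i, j, u, hij, hu, Q, hQ, rfl⟩)
  · refine ⟨Q, fun s v => ?_, rfl⟩
    rw [hQ]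
    refine forall_congr' fun i => ?_
    rw [monomial_mulVec]
    simp [Equiv.Perm.one_def]
  · refine ⟨Q, fun s v => ?_, rfl⟩
    rw [hc, map_smul, root_mk, smul_eq_mul] at hu
    have : x j ≤ x i := by
      have := nonneg_of_mul_nonneg_right hu ha
      linarith
    rw [hQ, flagStabilizer_one_add_single hij this]

/-! ### Invariants of points of the compactified building -/

/-- The pairs that have to be identified have homothetic norms, respectively the same flags. -/
def SameInvariants : ProjGenLinGroup (Fin n) K × AptBar n → ProjGenLinGroup (Fin n) K × AptBar n →
    Prop
  | (g, Sum.inl a), (h, Sum.inl b) => ∀ (A A' : GL (Fin n) K) (x x' : Fin n → ℝ),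
      ProjGenLinGroup.mk A = g → ProjGenLinGroup.mk A' = h → Apt.mk x = a → Apt.mk x' = b →
      ∃ r : ℝ, ∀ u, nrm A' x' u = primeNorm K ^ r * nrm A x u
  | (g, Sum.inr a), (h, Sum.inr b) => ∀ (A A' : GL (Fin n) K) (x x' : Fin n → ℝ),
      ProjGenLinGroup.mk A = g → ProjGenLinGroup.mk A' = h → IsDir x a → IsDir x' b →
      -- Here `σ` matches the weights of the two bases, while `l` and `m` absorb the choice of
      -- vectors representing the directions. The equivalence compares the two filtrations at
      -- corresponding thresholds.
      ∃ (σ : Equiv.Perm (Fin n)) (l m : ℝ), 0 < l ∧ (∀ i, x' (σ i) = l * x i + m) ∧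
        ∀ (s : ℝ) (u : Fin n → K),
          (∀ i, ((↑A'⁻¹ : Matrix (Fin n) (Fin n) K) *ᵥ u) i ≠ 0 → l * s + m ≤ x' i) ↔
          ∀ i, ((↑A⁻¹ : Matrix (Fin n) (Fin n) K) *ᵥ u) i ≠ 0 → s ≤ x i
  | (_, Sum.inl _), (_, Sum.inr _) => False
  | (_, Sum.inr _), (_, Sum.inl _) => False

section PrimeNorm

variable [PrimeNormBounds K]

theorem SameInvariants.symm {p q : ProjGenLinGroup (Fin n) K × AptBar n}
    (h : SameInvariants p q) : SameInvariants q p := by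
  obtain ⟨g, a | a⟩ := p <;> obtain ⟨g', b | b⟩ := q
  · intro A A' x x' hA hA' hx hx'
    obtain ⟨r, hr⟩ := h A' A x' x hA' hA hx' hx
    refine ⟨-r, fun u => ?_⟩
    rw [hr, primeNorm_rpow_neg, inv_mul_cancel_left₀ (primeNorm_rpow_pos K r).ne']
  · exact h
  · exact h
  · intro A A' x x' hA hA' hx hx'
    obtain ⟨σ, l, m, hl, h1, h2⟩ := h A' A x' x hA' hA hx' hx
    refine ⟨σ.symm, l⁻¹, -(l⁻¹ * m), inv_pos.2 hl, fun i => ?_, fun s u => ?_⟩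
    · have := h1 (σ.symm i)
      rw [Equiv.apply_symm_apply] at this
      rw [this]
      field_simp
      ring
    · rw [← h2]
      have : l * (l⁻¹ * s + -(l⁻¹ * m)) + m = s := by field_simp; ring
      rw [this]

theorem SameInvariants.trans {p q r : ProjGenLinGroup (Fin n) K × AptBar n}
    (h : SameInvariants p q) (h' : SameInvariants q r) : SameInvariants p r := by
  obtain ⟨g, a | a⟩ := p <;> obtain ⟨g', b | b⟩ := q <;> obtain ⟨g'', c | c⟩ := r <;>
    first | exact h.elim | exact h'.elim | skip
  · intro A A'' x x'' hA hA'' hx hx''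
    obtain ⟨A', hA'⟩ := ProjGenLinGroup.mk_surjective g'
    obtain ⟨x', hx'⟩ := Apt.mk_surjective b
    obtain ⟨s, hs⟩ := h A A' x x' hA hA' hx hx'
    obtain ⟨t, ht⟩ := h' A' A'' x' x'' hA' hA'' hx' hx''
    refine ⟨t + s, fun u => ?_⟩
    rw [ht, hs, primeNorm_rpow_add, mul_assoc]
  · intro A A'' x x'' hA hA'' hx hx''
    obtain ⟨A', hA'⟩ := ProjGenLinGroup.mk_surjective g'
    obtain ⟨x', hx'⟩ := exists_isDir b
    obtain ⟨σ, l, m, hl, h1, h2⟩ := h A A' x x' hA hA' hx hx'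
    obtain ⟨σ', l', m', hl', h1', h2'⟩ := h' A' A'' x' x'' hA' hA'' hx' hx''
    refine ⟨σ' * σ, l' * l, l' * m + m', mul_pos hl' hl, fun i => ?_, fun s u => ?_⟩
    · rw [Equiv.Perm.mul_apply, h1', h1]
      ring
    · rw [← h2, ← h2']
      have : l' * l * s + (l' * m + m') = l' * (l * s + m) + m' := by ring
      rw [this]

theorem nrm_eq_of_mk_eq {A A' : GL (Fin n) K} (h : ProjGenLinGroup.mk A = ProjGenLinGroup.mk A')
    {x x' : Fin n → ℝ} (hx : Apt.mk x = Apt.mk x') :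
    ∃ r : ℝ, ∀ u, nrm A' x' u = primeNorm K ^ r * nrm A x u := by
  obtain ⟨a, -, ha⟩ := mk_eq_iff_smul h
  obtain ⟨r, hr⟩ := Apt.mk_eq_mk_iff.1 hx
  obtain ⟨s, hs⟩ := exists_primeNorm_rpow_eq K (norm_pos_iff.2 (a⁻¹).ne_zero)
  refine ⟨s + r, fun u => ?_⟩
  rw [funext hr, nrm_add_const, nrm, ha, wnorm_smul, ← hs, primeNorm_rpow_add, nrm]
  ring

theorem SameInvariants.refl (p : ProjGenLinGroup (Fin n) K × AptBar n) : SameInvariants p p := by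
  obtain ⟨g, a | a⟩ := p
  · intro A A' x x' hA hA' hx hx'
    exact nrm_eq_of_mk_eq (hA.trans hA'.symm) (hx.trans hx'.symm)
  · intro A A' x x' hA hA' hx hx'
    obtain ⟨a, -, ha⟩ := mk_eq_iff_smul (hA.trans hA'.symm)
    obtain ⟨l, m, hl, hlm⟩ := (isDir_iff_affine hx).1 hx'
    refine ⟨1, l, m, hl, hlm, fun s u => forall_congr' fun i => ?_⟩
    rw [ha, hlm]
    simp [hl]

variable [IsUltrametricDist K]

/-- With representatives `A`, `A'` and a monomial `M`, the relation says `A' M = A Q` with `Q` in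
the group attached to the first point. The factor `Q` preserves the invariants in the coordinates of
`A`, and `M` transports them to the second point. -/
theorem sameInvariants_of_bdRel {p q : ProjGenLinGroup (Fin n) K × AptBar n}
    (h : bdRel p q) : SameInvariants p q := by
  obtain ⟨g, a⟩ := p
  obtain ⟨g', b⟩ := q
  obtain ⟨m, t, σ, ⟨M, hM, rfl⟩, rfl, hP⟩ := h
  obtain a | a := a
  · intro A A' x x' hA hA' hx hx'
    subst hA hA' hx
    simp only at hP
    rw [← map_inv, ← map_mul, ← map_mul] at hP
    obtain ⟨r, hr⟩ := mem_of_mk_mem_map (scalar_mem_normStabilizer x) (stab_inl_le x hP)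
    obtain ⟨r', hr'⟩ := nrm_eq_of_mk_eq (rfl : ProjGenLinGroup.mk A' = ProjGenLinGroup.mk A')
      (x := fun i => -val (t i : K) + x (σ.symm i)) (x' := x') hx'.symm
    refine ⟨r' + -r, fun u => ?_⟩
    rw [hr', primeNorm_rpow_add, mul_assoc]
    congr 1
    have h1 : ∀ v, nrm A' (fun i => -val (t i : K) + x (σ.symm i))
        ((A' * M : GL (Fin n) K) *ᵥ v : Fin n → K) = wnorm x v := by
      intro v
      rw [Units.val_mul, ← Matrix.mulVec_mulVec, nrm_mulVec, hM, wnorm_monomial]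
    have h2 := h1 ((↑(A' * M)⁻¹ : Matrix (Fin n) (Fin n) K) *ᵥ u)
    rw [mulVec_inv_mulVec] at h2
    have h3 := hr ((↑(A' * M)⁻¹ : Matrix (Fin n) (Fin n) K) *ᵥ u)
    rw [mul_assoc, Units.val_mul, ← Matrix.mulVec_mulVec, mulVec_inv_mulVec] at h3
    rw [h2, nrm, h3, primeNorm_rpow_neg, inv_mul_cancel_left₀ (primeNorm_rpow_pos K r).ne']
  · intro A A' x x' hA hA' hx hx'
    subst hA hA'
    simp only at hP
    rw [← map_inv, ← map_mul, ← map_mul] at hP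
    have hr := mem_of_mk_mem_map (scalar_mem_flagStabilizer x) (stab_inr_le hx hP)
    obtain ⟨l, m, hl, hlm⟩ := (isDir_iff_affine (hx.map_weyl σ)).1 hx'
    refine ⟨σ, l, m, hl, fun i => by rw [hlm, Equiv.symm_apply_apply], fun s u => ?_⟩
    have h3 := hr s ((↑(A' * M)⁻¹ : Matrix (Fin n) (Fin n) K) *ᵥ u)
    rw [mul_assoc, Units.val_mul, ← Matrix.mulVec_mulVec, mulVec_inv_mulVec] at h3
    rw [h3]
    have h4 : ∀ i, ((↑A'⁻¹ : Matrix (Fin n) (Fin n) K) *ᵥ u) (σ i) =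
        t (σ i) * ((↑(A' * M)⁻¹ : Matrix (Fin n) (Fin n) K) *ᵥ u) i := by
      intro i
      have : (↑A'⁻¹ : Matrix (Fin n) (Fin n) K) *ᵥ u =
          (M : Matrix (Fin n) (Fin n) K) *ᵥ ((↑(A' * M)⁻¹ : Matrix (Fin n) (Fin n) K) *ᵥ u) := by
        rw [_root_.mul_inv_rev, Units.val_mul, ← Matrix.mulVec_mulVec, mulVec_inv_mulVec]
      rw [this, hM, monomial_mulVec, Equiv.symm_apply_apply]
    rw [← σ.forall_congr_right]
    refine forall_congr' fun i => ?_
    rw [h4, hlm, Equiv.symm_apply_apply]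
    simp [hl]

/-- Equality in the quotient means equality under the generated equivalence relation. As the
invariants are compared by an equivalence relation, induction applies and `bdRel` itself need not be
shown to be one. -/
theorem sameInvariants_of_mk_eq {g h : ProjGenLinGroup (Fin n) K} {a b : AptBar n}
    (e : XBar.mk g a = XBar.mk h b) : SameInvariants (g, a) (h, b) := by
  have := Quot.eqvGen_exact e
  generalize (g, a) = p at this
  generalize (h, b) = q at this
  induction this with
  | rel _ _ h => exact sameInvariants_of_bdRel h
  | refl => exact SameInvariants.refl _
  | symm _ _ _ ih => exact ih.symm
  | trans _ _ _ _ _ ih ih' => exact ih.trans ih'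

/-- The norm attached to a point of the building is well defined up to homothety. -/
theorem nrm_eq_of_xbar_eq {A A' : GL (Fin n) K} {x x' : Fin n → ℝ}
    (e : XBar.mk (ProjGenLinGroup.mk A) (Sum.inl (Apt.mk x)) =
      XBar.mk (ProjGenLinGroup.mk A') (Sum.inl (Apt.mk x'))) :
    ∃ r : ℝ, ∀ u, nrm A' x' u = primeNorm K ^ r * nrm A x u :=
  sameInvariants_of_mk_eq e A A' x x' rfl rfl rfl rfl

theorem mk_inr_mem_boundary (g : ProjGenLinGroup (Fin n) K) (c : Module.Ray ℝ (Apt n)) :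
    XBar.mk g (Sum.inr c) ∈ boundary n K := by
  rintro ⟨h, x, e⟩
  exact sameInvariants_of_mk_eq e

theorem exists_mk_inr_of_mem_boundary {y : XBar n K} (hy : y ∈ boundary n K) :
    ∃ g c, y = XBar.mk g (Sum.inr c) := by
  induction y using Quot.ind with
  | mk p =>
    obtain ⟨g, x | c⟩ := p
    · exact (hy ⟨g, x, rfl⟩).elim
    · exact ⟨g, c, rfl⟩

end PrimeNorm

end

end BTBuilding

namespace BTBuilding

noncomputable section

set_option linter.unusedSectionVars false

/-! ### Invariant scalar products -/

namespace InvScalarProduct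

variable {n : ℕ} (B : InvScalarProduct n)

theorem weyl_single (σ : Equiv.Perm (Fin n)) (i : Fin n) :
    weyl σ (Apt.mk (Pi.single i 1)) = Apt.mk (Pi.single (σ i) 1) := by
  rw [weyl_mk]
  congr 1
  ext j
  simp [Pi.single_apply, Equiv.symm_apply_eq]

theorem mk_eq_sum (x : Fin n → ℝ) : Apt.mk x = ∑ i, x i • Apt.mk (Pi.single i 1) := by
  have h : x = ∑ i, x i • (Pi.single i 1 : Fin n → ℝ) := by
    ext j
    simp [Finset.sum_apply, Pi.single_apply]
  conv_lhs => rw [h]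
  simp only [Apt.mk]
  rw [← Submodule.mkQ_apply, map_sum]
  rfl

/-- All invariant scalar products are given by the same formula up to two constants. -/
theorem exists_form_eq (hn : 2 ≤ n) : ∃ l m : ℝ, 0 < l ∧ ∀ x y : Fin n → ℝ,
    B.form (Apt.mk x) (Apt.mk y) = l * ∑ i, x i * y i + m * ((∑ i, x i) * ∑ i, y i) := by
  let e : Fin n → Apt n := fun i => Apt.mk (Pi.single i 1)
  let i₀ : Fin n := ⟨0, by omega⟩
  let i₁ : Fin n := ⟨1, by omega⟩
  have h01 : i₀ ≠ i₁ := by simp [i₀, i₁]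
  have h1 : ∀ i, B.form (e i) (e i) = B.form (e i₀) (e i₀) := by
    intro i
    have := B.inv (Equiv.swap i₀ i) (e i₀) (e i₀)
    rwa [weyl_single, Equiv.swap_apply_left] at this
  have h2 : ∀ i j, i ≠ j → B.form (e i) (e j) = B.form (e i₀) (e i₁) := by
    intro i j hij
    -- This permutation sends `i₀` to `i` and `i₁` to `j`: double transitivity leaves only two
    -- values for the Gram matrix of the `e i`.
    have := B.inv (Equiv.swap (Equiv.swap i₀ i i₁) j * Equiv.swap i₀ i) (e i₀) (e i₁)
    rw [weyl_single, weyl_single, Equiv.Perm.mul_apply, Equiv.Perm.mul_apply,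
      Equiv.swap_apply_left, Equiv.swap_apply_left, Equiv.swap_apply_of_ne_of_ne _ hij] at this
    · exact this
    · intro h
      rw [eq_comm, Equiv.swap_apply_eq_iff, Equiv.swap_apply_right] at h
      exact h01 h.symm
  refine ⟨B.form (e i₀) (e i₀) - B.form (e i₀) (e i₁), B.form (e i₀) (e i₁), ?_, ?_⟩
  · have hne : e i₀ - e i₁ ≠ 0 := by
      intro h
      obtain ⟨r, hr⟩ := Apt.mk_eq_zero_iff.1 (show Apt.mk (Pi.single i₀ 1 - Pi.single i₁ 1) = 0 from h)
      have a0 := hr i₀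
      have a1 := hr i₁
      simp [h01, h01.symm] at a0 a1
      linarith
    have := B.pos _ hne
    simp only [map_sub, LinearMap.sub_apply] at this
    rw [h1 i₁, h2 i₁ i₀ h01.symm] at this
    linarith
  · intro x y
    rw [mk_eq_sum x, mk_eq_sum y]
    have h3 : ∀ i j, B.form (e i) (e j) =
        (if i = j then B.form (e i₀) (e i₀) - B.form (e i₀) (e i₁) else 0) +
          B.form (e i₀) (e i₁) := by
      intro i j
      split_ifs with h
      · subst h; rw [h1]; ring
      · rw [h2 i j h]; ring
    generalize B.form (e i₀) (e i₀) - B.form (e i₀) (e i₁) = l at h3 ⊢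
    generalize B.form (e i₀) (e i₁) = m at h3 ⊢
    simp only [map_sum, LinearMap.sum_apply, map_smul, LinearMap.smul_apply, smul_eq_mul]
    change ∑ i, y i * ∑ j, x j * B.form (e j) (e i) = _
    simp only [h3, mul_add, Finset.sum_add_distrib, mul_ite, mul_zero, Finset.sum_ite_eq',
      Finset.mem_univ, if_true]
    congr 1
    · rw [Finset.mul_sum]
      refine Finset.sum_congr rfl fun i _ => by ring
    · rw [← Finset.sum_mul, ← Finset.sum_mul]
      ring

theorem form_self_nonneg (x : Apt n) : 0 ≤ B.form x x := by
  rcases eq_or_ne x 0 with rfl | h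
  · simp
  · exact (B.pos x h).le

theorem len_nonneg (x : Apt n) : 0 ≤ B.len x := Real.sqrt_nonneg _

theorem len_sq (x : Apt n) : B.len x ^ 2 = B.form x x := Real.sq_sqrt (B.form_self_nonneg x)

theorem len_pos {x : Apt n} (h : x ≠ 0) : 0 < B.len x := Real.sqrt_pos.2 (B.pos x h)

theorem len_eq_zero {x : Apt n} : B.len x = 0 ↔ x = 0 := by
  constructor
  · intro h
    by_contra h'
    exact (B.len_pos h').ne' h
  · rintro rfl
    simp [len]

theorem len_weyl (σ : Equiv.Perm (Fin n)) (x : Apt n) : B.len (weyl σ x) = B.len x := by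
  rw [len, B.inv, len]

theorem len_smul (r : ℝ) (x : Apt n) : B.len (r • x) = |r| * B.len x := by
  rw [len, map_smul, map_smul, LinearMap.smul_apply, smul_eq_mul, smul_eq_mul, ← mul_assoc,
    Real.sqrt_mul (mul_self_nonneg r), Real.sqrt_mul_self_eq_abs, len]

theorem len_neg (x : Apt n) : B.len (-x) = B.len x := by
  simp [len]

/-- The expansion of the square length that underlies the Cauchy-Schwarz inequality. -/
theorem form_len_smul_sub (x y : Apt n) :
    B.form (B.len y • x - B.len x • y) (B.len y • x - B.len x • y) =
      2 * (B.len x * B.len y) * (B.len x * B.len y - B.form x y) := by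
  simp only [map_sub, map_smul, LinearMap.sub_apply, LinearMap.smul_apply, smul_eq_mul,
    B.symm y x, ← B.len_sq]
  ring

theorem form_le (x y : Apt n) : B.form x y ≤ B.len x * B.len y := by
  rcases eq_or_ne x 0 with rfl | hx
  · simp [len]
  rcases eq_or_ne y 0 with rfl | hy
  · simp [len]
  have h := B.form_self_nonneg (B.len y • x - B.len x • y)
  rw [form_len_smul_sub] at h
  have hp := mul_pos (B.len_pos hx) (B.len_pos hy)
  have := nonneg_of_mul_nonneg_right h (by positivity)
  linarith

theorem smul_eq_of_form_eq {x y : Apt n} (h : B.form x y = B.len x * B.len y) :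
    B.len y • x = B.len x • y := by
  by_contra h'
  have := B.pos _ (sub_ne_zero.2 h')
  rw [form_len_smul_sub, h] at this
  simp at this

end InvScalarProduct

/-! ### Sums over sorted vectors -/

/-- Abel summation: an antitone weight against a vector with nonnegative partial sums. -/
theorem sum_mul_nonneg_of_partial_sums {n : ℕ} {f e : Fin n → ℝ} (hf : Antitone f)
    (h : ∀ (i : ℕ) (hi : i ≤ n), 0 ≤ ∑ j : Fin i, e (Fin.castLE hi j)) (h0 : ∑ j, e j = 0) :
    0 ≤ ∑ j, f j * e j := by
  let f' : ℕ → ℝ := fun j => if hj : j < n then f ⟨j, hj⟩ else 0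
  let e' : ℕ → ℝ := fun j => if hj : j < n then e ⟨j, hj⟩ else 0
  have key : ∀ i (hi : i ≤ n), ∑ j ∈ Finset.range i, e' j = ∑ j : Fin i, e (Fin.castLE hi j) := by
    intro i hi
    rw [← Fin.sum_univ_eq_sum_range]
    refine Finset.sum_congr rfl fun j _ => ?_
    have : (j : ℕ) < n := j.2.trans_le hi
    simp only [e', this, dif_pos]
    rfl
  have h1 : ∑ j, f j * e j = ∑ j ∈ Finset.range n, f' j • e' j := by
    rw [← Fin.sum_univ_eq_sum_range (fun j => f' j • e' j)]
    refine Finset.sum_congr rfl fun j _ => ?_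
    simp [f', e']
  have h2 : ∑ j ∈ Finset.range n, e' j = 0 := by
    rw [key n le_rfl]
    exact h0
  rw [h1, Finset.sum_range_by_parts, h2, smul_zero, zero_sub, ← Finset.sum_neg_distrib]
  refine Finset.sum_nonneg fun i hi => ?_
  have hi' : i + 1 < n := by
    have := Finset.mem_range.1 hi
    omega
  rw [smul_eq_mul, ← neg_mul]
  refine mul_nonneg ?_ ?_
  · have h3 : i < n := by omega
    simp only [f', hi', h3, dif_pos]
    have := hf (show (⟨i, h3⟩ : Fin n) ≤ ⟨i + 1, hi'⟩ from Fin.mk_le_mk.2 (by omega))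
    linarith
  · rw [key _ hi'.le]
    exact h _ hi'.le

/-- For an antitone vector the initial sums are the largest ones. -/
theorem sum_le_sum_initial {n : ℕ} {f : Fin n → ℝ} (hf : Antitone f) {i : ℕ} (hi : i ≤ n)
    {J : Fin i → Fin n} (hJ : Function.Injective J) :
    ∑ j, f (J j) ≤ ∑ j : Fin i, f (Fin.castLE hi j) := by
  have hc : (Finset.univ.image J).card = i := by
    rw [Finset.card_image_of_injective _ hJ, Finset.card_fin]
  have h1 : ∑ j, f (J j) = ∑ j : Fin i, f ((Finset.univ.image J).orderEmbOfFin hc j) := by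
    rw [← Finset.sum_image (s := Finset.univ) (g := J) (f := f) (fun a _ b _ h => hJ h),
      ← Finset.sum_image (s := Finset.univ)
        (g := (Finset.univ.image J).orderEmbOfFin hc) (f := f)
        (fun a _ b _ h => ((Finset.univ.image J).orderEmbOfFin hc).injective h),
      Finset.image_orderEmbOfFin_univ]
  rw [h1]
  refine Finset.sum_le_sum fun j _ => hf ?_
  have hm := ((Finset.univ.image J).orderEmbOfFin hc).strictMono
  rw [Fin.le_def, Fin.val_castLE]
  have : ∀ (k : ℕ) (hk : k < i),
      k ≤ ((Finset.univ.image J).orderEmbOfFin hc ⟨k, hk⟩ : Fin n).val := by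
    intro k
    induction k with
    | zero => simp
    | succ k ih =>
      intro hk
      have h2 := ih (by omega)
      have h3 := Fin.lt_def.1 (hm (show (⟨k, by omega⟩ : Fin i) < ⟨k + 1, hk⟩ from
        Fin.mk_lt_mk.2 (by omega)))
      omega
  exact this j.1 j.2

theorem exists_antitone_perm {n : ℕ} (f : Fin n → ℝ) :
    ∃ σ : Equiv.Perm (Fin n), Antitone fun j => f (σ j) := by
  refine ⟨Tuple.sort fun i => -f i, fun i j hij => ?_⟩
  have := Tuple.monotone_sort (fun i => -f i) hij
  simp only [Function.comp_apply] at this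
  linarith

/-! ### Volumes -/

section Vol

variable {n : ℕ} {K : Type*} [NormedField K]

/-- The volume of the columns of `U` with respect to `nrm A x`: the largest minor of `A⁻¹ U`, where
the rows are weighted by `x`. -/
def vol {i : ℕ} (A : GL (Fin n) K) (x : Fin n → ℝ) (U : Matrix (Fin n) (Fin i) K) : ℝ :=
  ‖fun J : Fin i → Fin n =>
    ‖(((↑A⁻¹ : Matrix (Fin n) (Fin n) K) * U).submatrix J id).det‖ * primeNorm K ^ ∑ a, x (J a)‖

/-- A left inverse forces rank `i`, so `i` of the rows are linearly independent. This makes the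
volume of a tuple with a left inverse positive. -/
theorem exists_minor_ne_zero {i : ℕ} {M : Matrix (Fin n) (Fin i) K}
    {L : Matrix (Fin i) (Fin n) K} (h : L * M = 1) :
    ∃ J : Fin i → Fin n, (M.submatrix J id).det ≠ 0 := by
  have hr : Module.finrank K (Submodule.span K (Set.range M.row)) = i := by
    rw [← Matrix.rank_eq_finrank_span_row]
    apply le_antisymm
    · simpa using M.rank_le_width
    · have := Matrix.rank_mul_le_right L M
      rwa [h, Matrix.rank_one, Fintype.card_fin] at this
  obtain ⟨f, hf, -, hli⟩ := Submodule.exists_fun_fin_finrank_span_eq K (Set.range M.row)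
  choose J hJ using hf
  refine ⟨fun a => J (Fin.cast hr.symm a), ?_⟩
  rw [← isUnit_iff_ne_zero, ← Matrix.isUnit_iff_isUnit_det,
    ← Matrix.linearIndependent_rows_iff_isUnit]
  have : (M.submatrix (fun a => J (Fin.cast hr.symm a)) id).row = f ∘ Fin.cast hr.symm := by
    ext a b
    exact congrFun (hJ (Fin.cast hr.symm a)) b
  rw [this]
  exact hli.comp _ (Fin.cast_injective _)

variable [PrimeNormBounds K] {i : ℕ}

theorem le_vol (A : GL (Fin n) K) (x : Fin n → ℝ) (U : Matrix (Fin n) (Fin i) K)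
    (J : Fin i → Fin n) :
    ‖(((↑A⁻¹ : Matrix (Fin n) (Fin n) K) * U).submatrix J id).det‖ * primeNorm K ^ ∑ a, x (J a) ≤
      vol A x U := by
  have := norm_le_pi_norm (fun J : Fin i → Fin n =>
    ‖(((↑A⁻¹ : Matrix (Fin n) (Fin n) K) * U).submatrix J id).det‖ *
      primeNorm K ^ ∑ a, x (J a)) J
  rwa [Real.norm_of_nonneg (mul_nonneg (norm_nonneg _) (primeNorm_rpow_pos K _).le)] at this

theorem vol_le_iff {A : GL (Fin n) K} {x : Fin n → ℝ} {U : Matrix (Fin n) (Fin i) K} {C : ℝ}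
    (hC : 0 ≤ C) : vol A x U ≤ C ↔ ∀ J : Fin i → Fin n,
      ‖(((↑A⁻¹ : Matrix (Fin n) (Fin n) K) * U).submatrix J id).det‖ *
        primeNorm K ^ ∑ a, x (J a) ≤ C := by
  rw [vol, pi_norm_le_iff_of_nonneg hC]
  refine forall_congr' fun J => ?_
  rw [Real.norm_of_nonneg (mul_nonneg (norm_nonneg _) (primeNorm_rpow_pos K _).le)]

theorem exists_eq_vol [NeZero n] (A : GL (Fin n) K) (x : Fin n → ℝ)
    (U : Matrix (Fin n) (Fin i) K) : ∃ J : Fin i → Fin n, vol A x U =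
      ‖(((↑A⁻¹ : Matrix (Fin n) (Fin n) K) * U).submatrix J id).det‖ *
        primeNorm K ^ ∑ a, x (J a) := by
  obtain ⟨J, -, hJ⟩ := Finset.exists_max_image (Finset.univ : Finset (Fin i → Fin n))
    (fun J => ‖(((↑A⁻¹ : Matrix (Fin n) (Fin n) K) * U).submatrix J id).det‖ *
        primeNorm K ^ ∑ a, x (J a)) ⟨fun _ => 0, Finset.mem_univ _⟩
  refine ⟨J, le_antisymm ?_ (le_vol A x U J)⟩
  rw [vol_le_iff (mul_nonneg (norm_nonneg _) (primeNorm_rpow_pos K _).le)]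
  exact fun J' => hJ J' (Finset.mem_univ _)

theorem vol_pos (A : GL (Fin n) K) (x : Fin n → ℝ) {U : Matrix (Fin n) (Fin i) K}
    {L : Matrix (Fin i) (Fin n) K} (h : L * U = 1) : 0 < vol A x U := by
  obtain ⟨J, hJ⟩ := exists_minor_ne_zero (M := (↑A⁻¹ : Matrix (Fin n) (Fin n) K) * U)
    (L := L * (A : Matrix (Fin n) (Fin n) K)) (by
      rw [Matrix.mul_assoc, ← Matrix.mul_assoc (A : Matrix (Fin n) (Fin n) K), ← Units.val_mul,
        mul_inv_cancel, Units.val_one, Matrix.one_mul, h])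
  exact lt_of_lt_of_le (mul_pos (norm_pos_iff.2 hJ) (primeNorm_rpow_pos K _)) (le_vol A x U J)

theorem vol_mul (A : GL (Fin n) K) (x : Fin n → ℝ) (U : Matrix (Fin n) (Fin i) K)
    (h : Matrix (Fin i) (Fin i) K) : vol A x (U * h) = ‖h.det‖ * vol A x U := by
  have : (fun J : Fin i → Fin n =>
      ‖(((↑A⁻¹ : Matrix (Fin n) (Fin n) K) * (U * h)).submatrix J id).det‖ *
        primeNorm K ^ ∑ a, x (J a)) = ‖h.det‖ • fun J : Fin i → Fin n =>
      ‖(((↑A⁻¹ : Matrix (Fin n) (Fin n) K) * U).submatrix J id).det‖ *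
        primeNorm K ^ ∑ a, x (J a) := by
    ext J
    have e : ((↑A⁻¹ : Matrix (Fin n) (Fin n) K) * (U * h)).submatrix J id =
        ((↑A⁻¹ : Matrix (Fin n) (Fin n) K) * U).submatrix J id * h := by
      rw [← Matrix.mul_assoc]
      rfl
    rw [e, Matrix.det_mul, norm_mul]
    simp only [Pi.smul_apply, smul_eq_mul]
    ring
  rw [vol, this, norm_smul, norm_norm, vol]

variable [IsUltrametricDist K]

/-- Hadamard's inequality. -/
theorem vol_le_prod (A : GL (Fin n) K) (x : Fin n → ℝ) (U : Matrix (Fin n) (Fin i) K) :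
    vol A x U ≤ ∏ b, nrm A x (fun r => U r b) := by
  have hnn : 0 ≤ ∏ b, nrm A x (fun r => U r b) := Finset.prod_nonneg fun b _ => nrm_nonneg _ _ _
  rw [vol_le_iff hnn]
  intro J
  have hp := primeNorm_rpow_pos K (∑ a, x (J a))
  -- In the Leibniz formula the ultrametric inequality bounds the sum by its largest term, and the
  -- weights can be distributed over the factors of each term.
  rw [← le_div_iff₀ hp, Matrix.det_apply]
  refine IsUltrametricDist.norm_sum_le_of_forall_le_of_nonneg (M := K) (by positivity)
    fun σ _ => ?_
  rw [le_div_iff₀ hp]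
  have h1 : ∀ y : K, ‖Equiv.Perm.sign σ • y‖ = ‖y‖ := by
    intro y
    rcases Int.units_eq_one_or (Equiv.Perm.sign σ) with h | h <;> simp [h]
  rw [h1, norm_prod, ← Equiv.sum_comp σ, Real.rpow_sum_of_pos (primeNorm_pos K),
    ← Finset.prod_mul_distrib]
  refine Finset.prod_le_prod
    (fun b _ => mul_nonneg (norm_nonneg _) (primeNorm_rpow_pos K _).le) fun b _ => ?_
  exact le_wnorm x ((↑A⁻¹ : Matrix (Fin n) (Fin n) K) *ᵥ fun r => U r b) (J (σ b))

theorem det_updateRow_one (b : Fin i) (w : Fin i → K) :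
    ((1 : Matrix (Fin i) (Fin i) K).updateRow b w).det = w b := by
  rw [← Matrix.det_transpose, ← Matrix.updateCol_transpose, Matrix.transpose_one,
    ← Matrix.cramer_apply, Matrix.cramer_one]
  rfl

/-- The volume only depends on the norm. -/
theorem vol_le_vol [NeZero n] {A A' : GL (Fin n) K} {x x' : Fin n → ℝ}
    (hN : ∀ u, nrm A' x' u = nrm A x u) {U : Matrix (Fin n) (Fin i) K}
    (hU : 0 < vol A x U) : vol A' x' U ≤ vol A x U := by
  -- Choose a largest weighted minor and normalize the columns so that this minor becomes the
  -- identity. Replacing its row `b` by another row `r` gives the entry `(r, b)` as determinant.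
  -- Maximality therefore bounds the columns so well that Hadamard's inequality for `(A, x)` is an
  -- equality, and Hadamard's inequality for `(A', x')` gives the claim.
  obtain ⟨J, hJ⟩ := exists_eq_vol A x U
  set P := ((↑A⁻¹ : Matrix (Fin n) (Fin n) K) * U).submatrix J id with hP
  have hdet : P.det ≠ 0 := by
    intro h
    rw [hJ, h, norm_zero, zero_mul] at hU
    exact lt_irrefl _ hU
  have hPu : IsUnit P.det := isUnit_iff_ne_zero.2 hdet
  set U' := U * P⁻¹ with hU'
  have hUU : U = U' * P := by
    rw [hU', Matrix.mul_assoc, Matrix.nonsing_inv_mul _ hPu, Matrix.mul_one]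
  have hv : vol A x U' = primeNorm K ^ ∑ a, x (J a) := by
    have := vol_mul A x U' P
    rw [← hUU, hJ] at this
    exact (mul_left_cancel₀ (norm_ne_zero_iff.2 hdet) this).symm
  have hQ : ((↑A⁻¹ : Matrix (Fin n) (Fin n) K) * U').submatrix J id = 1 := by
    have : ((↑A⁻¹ : Matrix (Fin n) (Fin n) K) * U').submatrix J id = P * P⁻¹ := by
      rw [hU', ← Matrix.mul_assoc]
      rfl
    rw [this, Matrix.mul_nonsing_inv _ hPu]
  have hcol : ∀ b, nrm A x (fun r => U' r b) ≤ primeNorm K ^ x (J b) := by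
    intro b
    rw [nrm, wnorm_le_iff (primeNorm_rpow_pos K _).le]
    intro r
    have h1 := le_vol A x U' (Function.update J b r)
    have h2 : ((↑A⁻¹ : Matrix (Fin n) (Fin n) K) * U').submatrix (Function.update J b r) id =
        (1 : Matrix (Fin i) (Fin i) K).updateRow b
          (((↑A⁻¹ : Matrix (Fin n) (Fin n) K) * U') r) := by
      rw [← hQ]
      ext a c
      by_cases hab : a = b
      · subst hab; simp
      · simp [Function.update_of_ne hab, Matrix.updateRow_ne hab]
    have h3 : ∑ a, x (Function.update J b r a) = x r + (∑ a, x (J a) - x (J b)) := by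
      rw [← Finset.add_sum_erase _ _ (Finset.mem_univ b),
        ← Finset.add_sum_erase (a := b) _ (fun a => x (J a)) (Finset.mem_univ b),
        Function.update_self]
      have : ∑ a ∈ Finset.univ.erase b, x (Function.update J b r a) =
          ∑ a ∈ Finset.univ.erase b, x (J a) :=
        Finset.sum_congr rfl fun a ha => by rw [Function.update_of_ne (Finset.ne_of_mem_erase ha)]
      rw [this]
      ring
    have h4 : ∑ a, x (J a) = x (J b) + (∑ a, x (J a) - x (J b)) := by ring
    rw [h2, det_updateRow_one, hv, h3, primeNorm_rpow_add, ← mul_assoc] at h1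
    conv_rhs at h1 => rw [h4, primeNorm_rpow_add]
    exact le_of_mul_le_mul_right h1 (primeNorm_rpow_pos K _)
  calc vol A' x' U = ‖P.det‖ * vol A' x' U' := by
        conv_lhs => rw [hUU]
        rw [vol_mul, mul_comm]
    _ ≤ ‖P.det‖ * ∏ b, nrm A' x' (fun r => U' r b) := by
        gcongr
        exact vol_le_prod _ _ _
    _ ≤ ‖P.det‖ * ∏ b, primeNorm K ^ x (J b) := by
        gcongr with b
        · exact fun b _ => nrm_nonneg _ _ _
        · rw [hN]; exact hcol b
    _ = vol A x U := by
        rw [hJ, Real.rpow_sum_of_pos (primeNorm_pos K)]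

end Vol

end

end BTBuilding

namespace BTBuilding

noncomputable section

set_option linter.unusedSectionVars false

/-! ### The triangle inequality -/

variable {n : ℕ} {K : Type*} [NormedField K] [PrimeNormBounds K]

/-- A nonzero minor has distinct row indices, and passing from `x` to `y` changes only its weight.
Since `|π| < 1`, an upper bound for the exponent is a lower bound for the factor. -/
theorem rpow_mul_vol_le_vol [NeZero n] {i : ℕ} (A : GL (Fin n) K) {x y : Fin n → ℝ} {T : ℝ}
    (hT : ∀ J : Fin i → Fin n, Function.Injective J → ∑ j, (y (J j) - x (J j)) ≤ T)
    {U : Matrix (Fin n) (Fin i) K} (hU : 0 < vol A x U) :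
    primeNorm K ^ T * vol A x U ≤ vol A y U := by
  obtain ⟨J, hJ⟩ := exists_eq_vol A x U
  have hinj : Function.Injective J := by
    intro a b hab
    by_contra hne
    rw [hJ, Matrix.det_zero_of_row_eq hne (by ext c; simp [hab]), norm_zero, zero_mul] at hU
    exact lt_irrefl _ hU
  have h1 := hT J hinj
  rw [Finset.sum_sub_distrib] at h1
  calc primeNorm K ^ T * vol A x U
      = ‖(((↑A⁻¹ : Matrix (Fin n) (Fin n) K) * U).submatrix J id).det‖ *
          primeNorm K ^ (T + ∑ a, x (J a)) := by
        rw [hJ, primeNorm_rpow_add]; ring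
    _ ≤ ‖(((↑A⁻¹ : Matrix (Fin n) (Fin n) K) * U).submatrix J id).det‖ *
          primeNorm K ^ ∑ a, y (J a) := by
        refine mul_le_mul_of_nonneg_left ?_ (norm_nonneg _)
        exact (primeNorm_rpow_le_iff K _ _).2 (by linarith)
    _ ≤ _ := le_vol A y U J

variable [IsUltrametricDist K]

/-- The test tuple consists of `i` columns of `A''`. One minor bounds its volume at `x''` from
below, Hadamard's inequality bounds its volume at `z''` from above. In between, the volume is
followed through the apartments of `A` and `A'`, where it loses at most the factors `|π| ^ T` and
`|π| ^ T'`. -/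
theorem partial_sum_le [NeZero n] {A A' A'' : GL (Fin n) K} {x y y' z' x'' z'' : Fin n → ℝ}
    (hx : ∀ u, nrm A'' x'' u = nrm A x u) (hy : ∀ u, nrm A' y' u = nrm A y u)
    (hz : ∀ u, nrm A' z' u = nrm A'' z'' u) {i : ℕ} (hi : i ≤ n) (σ : Equiv.Perm (Fin n))
    {T T' : ℝ}
    (hT : ∀ J : Fin i → Fin n, Function.Injective J → ∑ j, (y (J j) - x (J j)) ≤ T)
    (hT' : ∀ J : Fin i → Fin n, Function.Injective J → ∑ j, (z' (J j) - y' (J j)) ≤ T') :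
    ∑ j : Fin i, (z'' (σ (Fin.castLE hi j)) - x'' (σ (Fin.castLE hi j))) ≤ T + T' := by
  set f : Fin i → Fin n := fun j => σ (Fin.castLE hi j) with hf
  have hfi : Function.Injective f := σ.injective.comp (Fin.castLE_injective hi)
  set U : Matrix (Fin n) (Fin i) K := (A'' : Matrix (Fin n) (Fin n) K).submatrix id f with hU
  have hinv : (↑A''⁻¹ : Matrix (Fin n) (Fin n) K) * (A'' : Matrix (Fin n) (Fin n) K) = 1 := by
    rw [← Units.val_mul, inv_mul_cancel, Units.val_one]
  have h1 : ((↑A''⁻¹ : Matrix (Fin n) (Fin n) K) * U).submatrix f id = 1 := by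
    have : ((↑A''⁻¹ : Matrix (Fin n) (Fin n) K) * U).submatrix f id =
        ((↑A''⁻¹ : Matrix (Fin n) (Fin n) K) *
          (A'' : Matrix (Fin n) (Fin n) K)).submatrix f f := rfl
    rw [this, hinv, Matrix.submatrix_one f hfi]
  have hL : (↑A''⁻¹ : Matrix (Fin n) (Fin n) K).submatrix f id * U = 1 := h1
  have low : primeNorm K ^ ∑ j, x'' (f j) ≤ vol A'' x'' U := by
    have := le_vol A'' x'' U f
    rwa [h1, Matrix.det_one, norm_one, one_mul] at this
  have high : vol A'' z'' U ≤ primeNorm K ^ ∑ j, z'' (f j) := by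
    refine (vol_le_prod A'' z'' U).trans (le_of_eq ?_)
    rw [Real.rpow_sum_of_pos (primeNorm_pos K)]
    refine Finset.prod_congr rfl fun b _ => ?_
    have : (fun r => U r b) = (A'' : Matrix (Fin n) (Fin n) K) *ᵥ Pi.single (f b) 1 := by
      rw [Matrix.mulVec_single_one]
      rfl
    rw [this, nrm_mulVec, wnorm_single, norm_one, one_mul]
  have c1 := vol_le_vol (fun u => (hx u)) (vol_pos A x hL)
  have c2 := rpow_mul_vol_le_vol A hT (vol_pos A x hL)
  have c3 := vol_le_vol (fun u => (hy u).symm) (vol_pos A' y' hL)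
  have c4 := rpow_mul_vol_le_vol A' hT' (vol_pos A' y' hL)
  have c5 := vol_le_vol hz (vol_pos A'' z'' hL)
  have hp := primeNorm_rpow_pos K T
  have hp' := primeNorm_rpow_pos K T'
  have : primeNorm K ^ (T + T' + ∑ j, x'' (f j)) ≤ primeNorm K ^ ∑ j, z'' (f j) := by
    rw [primeNorm_rpow_add, primeNorm_rpow_add]
    calc primeNorm K ^ T * primeNorm K ^ T' * primeNorm K ^ ∑ j, x'' (f j)
        ≤ primeNorm K ^ T' * (primeNorm K ^ T * vol A x U) := by
          rw [mul_comm (primeNorm K ^ T), mul_assoc]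
          exact mul_le_mul_of_nonneg_left
            (mul_le_mul_of_nonneg_left (low.trans c1) hp.le) hp'.le
      _ ≤ primeNorm K ^ T' * vol A' y' U :=
          mul_le_mul_of_nonneg_left (c2.trans c3) hp'.le
      _ ≤ _ := c4.trans (c5.trans high)
  rw [primeNorm_rpow_le_iff] at this
  rw [Finset.sum_sub_distrib]
  linarith

theorem neZero_of_two_le (hn : 2 ≤ n) : NeZero n := ⟨by omega⟩

/-- Let `d`, `a`, `b` be the sorted differences. The partial sums of `a + b - d` are nonnegative and
its total sum is zero. Pairing it with the antitone `d` gives `|d|² ≤ ⟨d, a⟩ + ⟨d, b⟩`, and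
Cauchy-Schwarz finishes. Equality of lengths forces equality in Cauchy-Schwarz for `d` and `a`. -/
theorem len_triangle_aux (hn : 2 ≤ n) (B : InvScalarProduct n) {A A' A'' : GL (Fin n) K}
    {x y y' z' x'' z'' : Fin n → ℝ}
    (hx : ∀ u, nrm A'' x'' u = nrm A x u) (hy : ∀ u, nrm A' y' u = nrm A y u)
    (hz : ∀ u, nrm A' z' u = nrm A'' z'' u) :
    B.len (Apt.mk (z'' - x'')) ≤ B.len (Apt.mk (y - x)) + B.len (Apt.mk (z' - y')) ∧
      (B.len (Apt.mk (z'' - x'')) = B.len (Apt.mk (y - x)) + B.len (Apt.mk (z' - y')) →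
        ∃ τ : Equiv.Perm (Fin n), B.len (Apt.mk (y - x)) • Apt.mk ((z'' - x'') ∘ τ) =
          B.len (Apt.mk (z'' - x'')) • Apt.mk (y - x)) := by
  have := neZero_of_two_le hn
  obtain ⟨l, m, hl, hform⟩ := B.exists_form_eq hn
  obtain ⟨σ, hσ⟩ := exists_antitone_perm (z'' - x'')
  obtain ⟨α, hα⟩ := exists_antitone_perm (y - x)
  obtain ⟨β, hβ⟩ := exists_antitone_perm (z' - y')
  have hlen : ∀ (v : Fin n → ℝ) (τ : Equiv.Perm (Fin n)),
      B.len (Apt.mk fun j => v (τ j)) = B.len (Apt.mk v) := by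
    intro v τ
    rw [← B.len_weyl τ.symm (Apt.mk v), weyl_mk]
    rfl
  set d : Fin n → ℝ := fun j => (z'' - x'') (σ j) with hd
  set a : Fin n → ℝ := fun j => (y - x) (α j) with ha
  set b : Fin n → ℝ := fun j => (z' - y') (β j) with hb
  have part : ∀ (i : ℕ) (hi : i ≤ n),
      0 ≤ ∑ j : Fin i, ((a + b) - d : Fin n → ℝ) (Fin.castLE hi j) := by
    intro i hi
    have h := partial_sum_le hx hy hz hi σ (T := ∑ j : Fin i, a (Fin.castLE hi j))
      (T' := ∑ j : Fin i, b (Fin.castLE hi j))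
      (fun J hJ => by
        have := sum_le_sum_initial hα hi (J := fun j => α.symm (J j))
          (α.symm.injective.comp hJ)
        simpa only [ha, Equiv.apply_symm_apply, Pi.sub_apply] using this)
      (fun J hJ => by
        have := sum_le_sum_initial hβ hi (J := fun j => β.symm (J j))
          (β.symm.injective.comp hJ)
        simpa only [hb, Equiv.apply_symm_apply, Pi.sub_apply] using this)
    simp only [Pi.sub_apply, Pi.add_apply, Finset.sum_sub_distrib, Finset.sum_add_distrib]
    simp only [hd, Pi.sub_apply, Finset.sum_sub_distrib] at h ⊢
    linarith
  have total : ∑ j, ((a + b) - d : Fin n → ℝ) j = 0 := by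
    refine le_antisymm ?_ ((part n le_rfl).trans_eq rfl)
    have hsum : ∀ (v w : Fin n → ℝ) (J : Fin n → Fin n), Function.Injective J →
        ∑ j, (v (J j) - w (J j)) ≤ ∑ j, (v j - w j) := by
      intro v w J hJ
      exact (Equiv.sum_comp (Equiv.ofBijective J (Finite.injective_iff_bijective.1 hJ))
        (fun j => v j - w j)).le
    -- Running through the three points backwards, with all `n` indices, gives the opposite
    -- inequality for the total sums.
    have h := partial_sum_le (fun u => (hz u).symm) (fun u => (hy u).symm)
      (fun u => (hx u).symm) le_rfl (1 : Equiv.Perm (Fin n)) (hsum y' z') (hsum x y)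
    have e1 : ∑ j, d j = ∑ j, (z'' j - x'' j) := Equiv.sum_comp σ fun j => z'' j - x'' j
    have e2 : ∑ j, a j = ∑ j, (y j - x j) := Equiv.sum_comp α fun j => y j - x j
    have e3 : ∑ j, b j = ∑ j, (z' j - y' j) := Equiv.sum_comp β fun j => z' j - y' j
    simp only [Pi.sub_apply, Pi.add_apply, Finset.sum_sub_distrib, Finset.sum_add_distrib] at *
    simp only [Equiv.Perm.coe_one, id_eq, Fin.castLE_rfl] at h
    linarith
  have pos := sum_mul_nonneg_of_partial_sums hσ part total
  have key : B.form (Apt.mk d) (Apt.mk d) ≤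
      B.form (Apt.mk d) (Apt.mk a) + B.form (Apt.mk d) (Apt.mk b) := by
    have : B.form (Apt.mk d) (Apt.mk ((a + b) - d)) =
        B.form (Apt.mk d) (Apt.mk a) + B.form (Apt.mk d) (Apt.mk b) -
          B.form (Apt.mk d) (Apt.mk d) := by
      rw [Apt.mk_sub, Apt.mk_add, map_sub, map_add]
    have h2 : 0 ≤ B.form (Apt.mk d) (Apt.mk ((a + b) - d)) := by
      -- The total sum being zero, the second term of the formula for `B` drops out and only the
      -- standard scalar product remains.
      rw [hform, total, mul_zero, mul_zero, add_zero]
      exact mul_nonneg hl.le pos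
    linarith
  have ca := B.form_le (Apt.mk d) (Apt.mk a)
  have cb := B.form_le (Apt.mk d) (Apt.mk b)
  rw [← B.len_sq] at key
  have ld : B.len (Apt.mk d) = B.len (Apt.mk (z'' - x'')) := hlen _ σ
  have la : B.len (Apt.mk a) = B.len (Apt.mk (y - x)) := hlen _ α
  have lb : B.len (Apt.mk b) = B.len (Apt.mk (z' - y')) := hlen _ β
  have nd := B.len_nonneg (Apt.mk d)
  have na := B.len_nonneg (Apt.mk a)
  have nb := B.len_nonneg (Apt.mk b)
  rw [← ld, ← la, ← lb]
  refine ⟨?_, fun heq => ⟨α.symm.trans σ, ?_⟩⟩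
  · rcases nd.eq_or_lt with h | h
    · rw [← h]; positivity
    · refine le_of_mul_le_mul_left ?_ h
      nlinarith
  · have hfa : B.form (Apt.mk d) (Apt.mk a) = B.len (Apt.mk d) * B.len (Apt.mk a) := by
      apply le_antisymm ca
      nlinarith
    have := congrArg (weyl α) (B.smul_eq_of_form_eq hfa)
    rw [map_smul, map_smul, weyl_mk, weyl_mk] at this
    have e : (fun i => a (α.symm i)) = y - x := by
      ext i; simp [ha]
    rw [e] at this
    exact this

/-- The triangle inequality for three points, any two of which lie in a common apartment. In the
case of equality the differences are parallel up to a permutation of the coordinates. -/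
theorem len_triangle (hn : 2 ≤ n) (B : InvScalarProduct n) {A A' A'' : GL (Fin n) K}
    {x y y' z' x'' z'' : Fin n → ℝ}
    (hx : ∃ r : ℝ, ∀ u, nrm A'' x'' u = primeNorm K ^ r * nrm A x u)
    (hy : ∃ r : ℝ, ∀ u, nrm A' y' u = primeNorm K ^ r * nrm A y u)
    (hz : ∃ r : ℝ, ∀ u, nrm A' z' u = primeNorm K ^ r * nrm A'' z'' u) :
    B.len (Apt.mk (z'' - x'')) ≤ B.len (Apt.mk (y - x)) + B.len (Apt.mk (z' - y')) ∧
      (B.len (Apt.mk (z'' - x'')) = B.len (Apt.mk (y - x)) + B.len (Apt.mk (z' - y')) →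
        ∃ τ : Equiv.Perm (Fin n), B.len (Apt.mk (y - x)) • Apt.mk ((z'' - x'') ∘ τ) =
          B.len (Apt.mk (z'' - x'')) • Apt.mk (y - x)) := by
  obtain ⟨r, hr⟩ := hx
  obtain ⟨s, hs⟩ := hy
  obtain ⟨t, ht⟩ := hz
  -- Adding a constant to the exponents rescales the norm. These constants turn the homotheties into
  -- equalities and do not change the classes of the differences.
  have h := len_triangle_aux hn B (A := A) (A' := A') (A'' := A'') (x := x) (y := y)
    (y' := fun i => y' i + -s) (z' := fun i => z' i + -s) (x'' := fun i => x'' i + -r)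
    (z'' := fun i => z'' i + (t + -s))
    (fun u => by
      rw [nrm_add_const, hr, primeNorm_rpow_neg, inv_mul_cancel_left₀ (primeNorm_rpow_pos K _).ne'])
    (fun u => by
      rw [nrm_add_const, hs, primeNorm_rpow_neg, inv_mul_cancel_left₀ (primeNorm_rpow_pos K _).ne'])
    (fun u => by
      rw [nrm_add_const, nrm_add_const, ht, primeNorm_rpow_add]
      ring)
  have e1 : Apt.mk ((fun i => z'' i + (t + -s)) - fun i => x'' i + -r) = Apt.mk (z'' - x'') := by
    rw [eq_comm, Apt.mk_eq_mk_iff]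
    exact ⟨t - s + r, fun i => by simp only [Pi.sub_apply]; ring⟩
  have e2 : ((fun i => z' i + -s) - fun i => y' i + -s) = z' - y' := by
    ext i; simp
  have e3 : ∀ τ : Equiv.Perm (Fin n),
      Apt.mk (((fun i => z'' i + (t + -s)) - fun i => x'' i + -r) ∘ τ) =
        Apt.mk ((z'' - x'') ∘ τ) := by
    intro τ
    rw [eq_comm, Apt.mk_eq_mk_iff]
    exact ⟨t - s + r, fun i => by simp only [Pi.sub_apply, Function.comp_apply]; ring⟩
  simpa only [e1, e2, e3] using h

/-! ### The metric of the building -/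

/-- The distance does not depend on the apartment. -/
theorem len_sub_eq_of_mk_eq (hn : 2 ≤ n) (B : InvScalarProduct n)
    {g h : ProjGenLinGroup (Fin n) K} {a b a' b' : Apt n}
    (ha : XBar.mk g (Sum.inl a) = XBar.mk h (Sum.inl a'))
    (hb : XBar.mk g (Sum.inl b) = XBar.mk h (Sum.inl b')) :
    B.len (a - b) ≤ B.len (a' - b') := by
  obtain ⟨A, rfl⟩ := ProjGenLinGroup.mk_surjective g
  obtain ⟨A', rfl⟩ := ProjGenLinGroup.mk_surjective h
  obtain ⟨x, rfl⟩ := Apt.mk_surjective a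
  obtain ⟨y, rfl⟩ := Apt.mk_surjective b
  obtain ⟨x', rfl⟩ := Apt.mk_surjective a'
  obtain ⟨y', rfl⟩ := Apt.mk_surjective b'
  -- The triangle is degenerate: two of its three vertices are the point represented by `a` and
  -- `a'`, so one side has length zero.
  have h1 := (len_triangle hn B (y := x') (y' := x') (nrm_eq_of_xbar_eq hb.symm) (nrm_eq_of_xbar_eq rfl)
    (nrm_eq_of_xbar_eq (K := K) ha)).1
  rw [sub_self] at h1
  have : B.len (Apt.mk (0 : Fin n → ℝ)) = 0 := B.len_eq_zero.2 rfl
  rw [this, add_zero] at h1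
  rwa [Apt.mk_sub, Apt.mk_sub] at h1

theorem bdDist_eq (hn : 2 ≤ n) (B : InvScalarProduct n) {y y' : building n K}
    {g : ProjGenLinGroup (Fin n) K} {a b : Apt n} (hy : (y : XBar n K) = XBar.mk g (Sum.inl a))
    (hy' : (y' : XBar n K) = XBar.mk g (Sum.inl b)) : bdDist B y y' = B.len (a - b) := by
  have : {r | ∃ (g : ProjGenLinGroup (Fin n) K) (a b : Apt n),
      (y : XBar n K) = XBar.mk g (Sum.inl a) ∧ (y' : XBar n K) = XBar.mk g (Sum.inl b) ∧
        r = B.len (a - b)} = {B.len (a - b)} := by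
    ext r
    rw [Set.mem_singleton_iff]
    constructor
    · rintro ⟨h, a', b', ha, hb, rfl⟩
      exact le_antisymm (len_sub_eq_of_mk_eq hn B (ha.symm.trans hy) (hb.symm.trans hy'))
        (len_sub_eq_of_mk_eq hn B (hy.symm.trans ha) (hy'.symm.trans hb))
    · rintro rfl
      exact ⟨g, a, b, hy, hy', rfl⟩
  rw [bdDist, this, csInf_singleton]

/-- Two different points of a geodesic lie in a common apartment. -/
theorem IsGeodesic.exists_apartment (hn : 2 ≤ n) {B : InvScalarProduct n}
    {γ : ℝ → building n K} (hγ : IsGeodesic B γ) {s t : ℝ} (hst : s ≠ t) :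
    ∃ (A : GL (Fin n) K) (x y : Fin n → ℝ),
      (γ s : XBar n K) = XBar.mk (ProjGenLinGroup.mk A) (Sum.inl (Apt.mk x)) ∧
      (γ t : XBar n K) = XBar.mk (ProjGenLinGroup.mk A) (Sum.inl (Apt.mk y)) ∧
      B.len (Apt.mk (y - x)) = |s - t| := by
  have h := hγ s t
  have hne : {r | ∃ (g : ProjGenLinGroup (Fin n) K) (a b : Apt n),
      (γ s : XBar n K) = XBar.mk g (Sum.inl a) ∧ (γ t : XBar n K) = XBar.mk g (Sum.inl b) ∧
        r = B.len (a - b)}.Nonempty := by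
    -- If no apartment contained both points, the infimum over the empty set would make their
    -- distance zero, whereas it is `|s - t|`.
    by_contra hc
    rw [Set.not_nonempty_iff_eq_empty] at hc
    rw [bdDist, hc, Real.sInf_empty, eq_comm, abs_eq_zero, sub_eq_zero] at h
    exact hst h
  obtain ⟨r, g, a, b, ha, hb, -⟩ := hne
  obtain ⟨A, rfl⟩ := ProjGenLinGroup.mk_surjective g
  obtain ⟨x, rfl⟩ := Apt.mk_surjective a
  obtain ⟨y, rfl⟩ := Apt.mk_surjective b
  refine ⟨A, x, y, ha, hb, ?_⟩
  rw [← h, bdDist_eq hn B ha hb, ← B.len_neg, Apt.mk_sub, neg_sub]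

end

end BTBuilding

namespace BTBuilding

noncomputable section

set_option linter.unusedSectionVars false

/-! ### Coordinate subspaces -/

variable {n : ℕ} {K : Type*} [NormedField K]

/-- The span of the standard basis vectors with index in `I`. -/
def coordSpan (K : Type*) [NormedField K] (I : Finset (Fin n)) : Submodule K (Fin n → K) :=
  ⨅ i ∈ ((Iᶜ : Finset (Fin n)) : Set (Fin n)), LinearMap.ker (LinearMap.proj i)

theorem mem_coordSpan {I : Finset (Fin n)} {v : Fin n → K} :
    v ∈ coordSpan K I ↔ ∀ i, i ∉ I → v i = 0 := by
  simp [coordSpan]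

theorem finrank_coordSpan (I : Finset (Fin n)) : Module.finrank K (coordSpan K I) = I.card := by
  have e := LinearMap.iInfKerProjEquiv K (fun _ : Fin n => K) (I := (I : Set (Fin n)))
    (J := ((Iᶜ : Finset (Fin n)) : Set (Fin n)))
    (by rw [Finset.disjoint_coe]; exact disjoint_compl_right) (by simp)
  rw [coordSpan, e.finrank_eq, Module.finrank_fintype_fun_eq_card]
  simp

/-- The elements of `GL` that stabilize a subspace of `K ^ n`. -/
def subspaceStabilizer (W : Submodule K (Fin n → K)) : Subgroup (GL (Fin n) K) where
  carrier := {A | ∀ u, (A : Matrix (Fin n) (Fin n) K) *ᵥ u ∈ W ↔ u ∈ W}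
  one_mem' := by simp
  mul_mem' := by
    intro A A' h h' u
    rw [Units.val_mul, ← Matrix.mulVec_mulVec, h, h']
  inv_mem' := by
    intro A h u
    rw [← h, mulVec_inv_mulVec]

theorem scalar_mem_subspaceStabilizer (W : Submodule K (Fin n → K)) (u : Kˣ) :
    GeneralLinearGroup.scalar (Fin n) u ∈ subspaceStabilizer W := by
  intro v
  have : (GeneralLinearGroup.scalar (Fin n) u : Matrix (Fin n) (Fin n) K) *ᵥ v = (u : K) • v := by
    ext i; simp
  rw [this]
  exact Submodule.smul_mem_iff _ u.ne_zero

/-- `W = A ⟨e_i : i ∈ I⟩`. -/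
def IsImageCoordSpan (W : Submodule K (Fin n → K)) (A : GL (Fin n) K) (I : Finset (Fin n)) :
    Prop :=
  ∀ u, u ∈ W ↔ (↑A⁻¹ : Matrix (Fin n) (Fin n) K) *ᵥ u ∈ coordSpan K I

theorem exists_gl_of_linearEquiv (f : (Fin n → K) ≃ₗ[K] (Fin n → K)) :
    ∃ A : GL (Fin n) K, (∀ v, (A : Matrix (Fin n) (Fin n) K) *ᵥ v = f v) ∧
      ∀ v, (↑A⁻¹ : Matrix (Fin n) (Fin n) K) *ᵥ v = f.symm v := by
  refine ⟨⟨LinearMap.toMatrix' (f : (Fin n → K) →ₗ[K] (Fin n → K)),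
    LinearMap.toMatrix' (f.symm : (Fin n → K) →ₗ[K] (Fin n → K)), ?_, ?_⟩, fun v => ?_, fun v => ?_⟩
  · rw [← LinearMap.toMatrix'_comp]
    simp
  · rw [← LinearMap.toMatrix'_comp]
    simp
  · exact LinearMap.toMatrix'_mulVec _ _
  · exact LinearMap.toMatrix'_mulVec _ _

theorem linearEquiv_of_gl (A : GL (Fin n) K) : ∃ f : (Fin n → K) ≃ₗ[K] (Fin n → K),
    (∀ v, f v = (A : Matrix (Fin n) (Fin n) K) *ᵥ v) ∧
      ∀ v, f.symm v = (↑A⁻¹ : Matrix (Fin n) (Fin n) K) *ᵥ v :=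
  ⟨LinearEquiv.ofLinearMap (Matrix.mulVecLin (A : Matrix (Fin n) (Fin n) K))
    (Matrix.mulVecLin (↑A⁻¹ : Matrix (Fin n) (Fin n) K))
    (LinearMap.ext fun v => mulVec_inv_mulVec A v) (LinearMap.ext fun v => inv_mulVec_mulVec A v),
    fun _ => rfl, fun _ => rfl⟩

theorem IsImageCoordSpan.finrank_eq {W : Submodule K (Fin n → K)} {A : GL (Fin n) K}
    {I : Finset (Fin n)} (h : IsImageCoordSpan W A I) : Module.finrank K W = I.card := by
  obtain ⟨f, -, hf⟩ := linearEquiv_of_gl A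
  rw [← finrank_coordSpan (K := K) I]
  have : W = (coordSpan K I).map (f : (Fin n → K) →ₗ[K] (Fin n → K)) := by
    ext u
    rw [h, Submodule.mem_map_equiv, hf]
  rw [this]
  exact LinearEquiv.finrank_map_eq f _

/-- A decomposition is the image of a coordinate decomposition. -/
theorem exists_isImageCoordSpan_of_isCompl {W W' : Submodule K (Fin n → K)} (h : IsCompl W W') :
    ∃ A I, IsImageCoordSpan W A I ∧ IsImageCoordSpan W' A Iᶜ := by
  have hc : Module.finrank K W + Module.finrank K W' = n := by
    rw [Submodule.finrank_add_eq_of_isCompl h]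
    simp
  let e : Fin (Module.finrank K W) ⊕ Fin (Module.finrank K W') ≃ Fin n :=
    finSumFinEquiv.trans (finCongr hc)
  let f₁ : (Fin n → K) ≃ₗ[K] ((Fin (Module.finrank K W) → K) × (Fin (Module.finrank K W') → K)) :=
    (LinearEquiv.funCongrLeft K K e).trans (LinearEquiv.sumArrowLequivProdArrow _ _ K K)
  let f₂ : ((Fin (Module.finrank K W) → K) × (Fin (Module.finrank K W') → K)) ≃ₗ[K] W × W' :=
    LinearEquiv.prodCongr (Module.finBasis K W).equivFun.symm (Module.finBasis K W').equivFun.symm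
  let f := (f₁.trans f₂).trans (Submodule.prodEquivOfIsCompl W W' h)
  obtain ⟨A, -, hA⟩ := exists_gl_of_linearEquiv f
  have key : ∀ u, f₂ (f₁ (f.symm u)) = (Submodule.prodEquivOfIsCompl W W' h).symm u := by
    intro u
    simp [f]
  refine ⟨A, Finset.univ.filter fun i => (e.symm i).isLeft, fun u => ?_, fun u => ?_⟩
  · rw [hA, mem_coordSpan, ← Submodule.prodEquivOfIsCompl_symm_apply_snd_eq_zero W W' h, ← key]
    have h1 : (f₂ (f₁ (f.symm u))).2 = 0 ↔ (f₁ (f.symm u)).2 = 0 := by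
      change (Module.finBasis K W').equivFun.symm (f₁ (f.symm u)).2 = 0 ↔ _
      rw [LinearEquiv.map_eq_zero_iff]
    rw [h1, ← e.forall_congr_right]
    simp only [Finset.mem_filter, Finset.mem_univ, true_and, Equiv.symm_apply_apply, Sum.forall]
    simp only [Sum.isLeft_inl, not_true_eq_false, false_imp_iff, implies_true, true_and,
      Sum.isLeft_inr, Bool.false_eq_true, not_false_eq_true, true_imp_iff]
    rw [funext_iff]
    rfl
  · rw [hA, mem_coordSpan, ← Submodule.prodEquivOfIsCompl_symm_apply_fst_eq_zero W W' h, ← key]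
    have h1 : (f₂ (f₁ (f.symm u))).1 = 0 ↔ (f₁ (f.symm u)).1 = 0 := by
      change (Module.finBasis K W).equivFun.symm (f₁ (f.symm u)).1 = 0 ↔ _
      rw [LinearEquiv.map_eq_zero_iff]
    rw [h1, ← e.forall_congr_right]
    simp only [Finset.mem_compl, Finset.mem_filter, Finset.mem_univ, true_and,
      Equiv.symm_apply_apply, Sum.forall]
    simp only [Sum.isLeft_inl, not_true_eq_false, false_imp_iff, implies_true, and_true,
      Sum.isLeft_inr, Bool.false_eq_true, not_false_eq_true, true_imp_iff]
    rw [funext_iff]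
    rfl

/-! ### Directions of vertices -/

/-- The indicator vector of `I`. -/
def ind (I : Finset (Fin n)) : Fin n → ℝ := fun i => if i ∈ I then 1 else 0

theorem ind_of_mem {I : Finset (Fin n)} {i : Fin n} (h : i ∈ I) : ind I i = 1 := if_pos h

theorem ind_of_notMem {I : Finset (Fin n)} {i : Fin n} (h : i ∉ I) : ind I i = 0 := if_neg h

theorem mk_ind_ne_zero {I : Finset (Fin n)} (h₀ : I ≠ ∅) (h₁ : I ≠ Finset.univ) :
    Apt.mk (ind I) ≠ 0 := by
  rw [Ne, Apt.mk_eq_zero_iff]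
  rintro ⟨r, hr⟩
  obtain ⟨i, hi⟩ := Finset.nonempty_iff_ne_empty.2 h₀
  have : ∃ j, j ∉ I := by
    by_contra! h
    exact h₁ (Finset.eq_univ_iff_forall.2 h)
  obtain ⟨j, hj⟩ := this
  have a := hr i
  have b := hr j
  rw [ind_of_mem hi] at a
  rw [ind_of_notMem hj] at b
  linarith

theorem mk_ind_ne_zero_iff {I : Finset (Fin n)} :
    Apt.mk (ind I) ≠ 0 ↔ I ≠ ∅ ∧ I ≠ Finset.univ := by
  refine ⟨fun h => ⟨?_, ?_⟩, fun h => mk_ind_ne_zero h.1 h.2⟩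
  · rintro rfl
    exact h (Apt.mk_eq_zero_iff.2 ⟨0, fun i => by simp [ind]⟩)
  · rintro rfl
    exact h (Apt.mk_eq_zero_iff.2 ⟨1, fun i => by simp [ind]⟩)

theorem exists_isDir_ind {I : Finset (Fin n)} (h₀ : I ≠ ∅) (h₁ : I ≠ Finset.univ) :
    ∃ c, IsDir (ind I) c := ⟨_, mk_ind_ne_zero h₀ h₁, rfl⟩

/-! ### Stabilizers of coordinate subspaces are generated by root groups and the torus -/

section Generation

variable {I : Finset (Fin n)} {c : Module.Ray ℝ (Apt n)}

variable (K) in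
/-- The matrices whose classes lie in `P_c`. -/
def stabMatrices (c : Module.Ray ℝ (Apt n)) : Submonoid (Matrix (Fin n) (Fin n) K) :=
  ((stab (K := K) (Sum.inr c)).comap ProjGenLinGroup.mk).toSubmonoid.map
    (Units.coeHom (Matrix (Fin n) (Fin n) K))

theorem mem_stabMatrices_iff {A : GL (Fin n) K} :
    (A : Matrix (Fin n) (Fin n) K) ∈ stabMatrices K c ↔
      ProjGenLinGroup.mk A ∈ stab (Sum.inr c) := by
  constructor
  · rintro ⟨A', hA', h⟩
    have : A' = A := Units.ext h
    subst this
    exact hA'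
  · intro h
    exact ⟨A, h, rfl⟩

theorem diagonal_mem_stabMatrices {D : Fin n → K} (hD : ∀ i, D i ≠ 0) :
    Matrix.diagonal D ∈ stabMatrices K c := by
  let A : GL (Fin n) K := ⟨Matrix.diagonal D, Matrix.diagonal fun i => (D i)⁻¹, by
    simp [hD], by simp [hD]⟩
  refine (mem_stabMatrices_iff (A := A)).2 (Subgroup.subset_closure (Or.inl
    ⟨fun i => Units.mk0 (D i) (hD i), A, ?_, rfl⟩))
  ext i j
  simp only [A, monomial, Equiv.Perm.one_apply, Matrix.of_apply, Units.val_mk0]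
  by_cases h : i = j
  · subst h; simp
  · simp [h]

theorem isUnit_one_add_single {i j : Fin n} (hij : i ≠ j) (u : K) :
    ∃ A : GL (Fin n) K, (A : Matrix (Fin n) (Fin n) K) = 1 + Matrix.single i j u := by
  have h : ∀ w : K, (1 + Matrix.single i j w) * (1 + Matrix.single i j (-w)) = 1 := by
    intro w
    have : Matrix.single i j w * Matrix.single i j (-w) = 0 :=
      Matrix.single_mul_single_of_ne _ _ _ _ hij.symm _
    rw [mul_add, add_mul, add_mul, this]
    simp only [one_mul, mul_one, add_zero, add_assoc, ← Matrix.single_add, add_neg_cancel]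
    simp
  exact ⟨⟨_, _, h u, by simpa using h (-u)⟩, rfl⟩

theorem one_add_single_mem_stabMatrices (hc : IsDir (ind I) c) {i j : Fin n} (hij : i ≠ j) (u : K)
    (h : j ∈ I → i ∈ I) : 1 + Matrix.single i j u ∈ stabMatrices K c := by
  obtain ⟨A, hA⟩ := isUnit_one_add_single hij u
  rw [← hA, mem_stabMatrices_iff]
  refine Subgroup.subset_closure (Or.inr ⟨i, j, u, hij, ?_, A, hA, rfl⟩)
  obtain ⟨a, ha, e⟩ := hc.exists_someVector
  rw [e, map_smul, root_mk, smul_eq_mul]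
  refine mul_nonneg ha.le (sub_nonneg.2 ?_)
  by_cases hj : j ∈ I
  · rw [ind_of_mem hj, ind_of_mem (h hj)]
  · rw [ind_of_notMem hj, ind]
    split_ifs <;> norm_num

/-- Block matrices with respect to the decomposition into `I` and its complement. -/
def blocks (P : Matrix {i // i ∈ I} {i // i ∈ I} K) (Q : Matrix {i // i ∈ I} {i // i ∉ I} K)
    (D : Matrix {i // i ∉ I} {i // i ∉ I} K) : Matrix (Fin n) (Fin n) K :=
  (Matrix.fromBlocks P Q 0 D).submatrix (Equiv.sumCompl (· ∈ I)).symm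
    (Equiv.sumCompl (· ∈ I)).symm

theorem blocks_apply (P : Matrix {i // i ∈ I} {i // i ∈ I} K)
    (Q : Matrix {i // i ∈ I} {i // i ∉ I} K) (D : Matrix {i // i ∉ I} {i // i ∉ I} K)
    (a b : {i // i ∈ I} ⊕ {i // i ∉ I}) :
    blocks P Q D (Equiv.sumCompl (· ∈ I) a) (Equiv.sumCompl (· ∈ I) b) =
      Matrix.fromBlocks P Q 0 D a b := by
  rw [blocks, Matrix.submatrix_apply, Equiv.symm_apply_apply, Equiv.symm_apply_apply]

theorem blocks_mul (P P' : Matrix {i // i ∈ I} {i // i ∈ I} K)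
    (Q Q' : Matrix {i // i ∈ I} {i // i ∉ I} K) (D D' : Matrix {i // i ∉ I} {i // i ∉ I} K) :
    blocks P Q D * blocks P' Q' D' = blocks (P * P') (P * Q' + Q * D') (D * D') := by
  rw [blocks, blocks, Matrix.submatrix_mul_equiv, Matrix.fromBlocks_multiply, blocks]
  simp

theorem blocks_diagonal (d : {i // i ∈ I} → K) (d' : {i // i ∉ I} → K) :
    blocks (Matrix.diagonal d) 0 (Matrix.diagonal d') =
      Matrix.diagonal (fun i => Sum.elim d d' ((Equiv.sumCompl (· ∈ I)).symm i)) := by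
  rw [blocks, Matrix.fromBlocks_diagonal, Matrix.submatrix_diagonal_equiv]
  rfl

theorem blocks_one : blocks (1 : Matrix {i // i ∈ I} {i // i ∈ I} K) 0 1 = 1 := by
  rw [blocks, Matrix.fromBlocks_one, Matrix.submatrix_one_equiv]

theorem blocks_add_single_left (i j : {i // i ∈ I}) (u : K) :
    blocks (1 + Matrix.single i j u) 0 (1 : Matrix {i // i ∉ I} {i // i ∉ I} K) =
      1 + Matrix.single (i : Fin n) (j : Fin n) u := by
  ext a b
  obtain ⟨a, rfl⟩ := (Equiv.sumCompl (· ∈ I)).surjective a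
  obtain ⟨b, rfl⟩ := (Equiv.sumCompl (· ∈ I)).surjective b
  obtain ⟨i, hi⟩ := i
  obtain ⟨j, hj⟩ := j
  rw [blocks_apply]
  rcases a with ⟨a, ha⟩ | ⟨a, ha⟩ <;> rcases b with ⟨b, hb⟩ | ⟨b, hb⟩ <;>
    simp only [Matrix.add_apply,
      Equiv.sumCompl_apply_inl, Equiv.sumCompl_apply_inr, Matrix.fromBlocks_apply₁₁,
      Matrix.fromBlocks_apply₁₂, Matrix.fromBlocks_apply₂₁, Matrix.fromBlocks_apply₂₂,
      Matrix.single_apply, Matrix.one_apply, Matrix.zero_apply, Subtype.mk.injEq] <;>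
    grind

theorem blocks_add_single_right (i j : {i // i ∉ I}) (u : K) :
    blocks (1 : Matrix {i // i ∈ I} {i // i ∈ I} K) 0 (1 + Matrix.single i j u) =
      1 + Matrix.single (i : Fin n) (j : Fin n) u := by
  ext a b
  obtain ⟨a, rfl⟩ := (Equiv.sumCompl (· ∈ I)).surjective a
  obtain ⟨b, rfl⟩ := (Equiv.sumCompl (· ∈ I)).surjective b
  obtain ⟨i, hi⟩ := i
  obtain ⟨j, hj⟩ := j
  rw [blocks_apply]
  rcases a with ⟨a, ha⟩ | ⟨a, ha⟩ <;> rcases b with ⟨b, hb⟩ | ⟨b, hb⟩ <;>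
    simp only [Matrix.add_apply,
      Equiv.sumCompl_apply_inl, Equiv.sumCompl_apply_inr, Matrix.fromBlocks_apply₁₁,
      Matrix.fromBlocks_apply₁₂, Matrix.fromBlocks_apply₂₁, Matrix.fromBlocks_apply₂₂,
      Matrix.single_apply, Matrix.one_apply, Matrix.zero_apply, Subtype.mk.injEq] <;>
    grind

theorem blocks_single_upper (i : {i // i ∈ I}) (j : {i // i ∉ I}) (u : K) :
    blocks (1 : Matrix {i // i ∈ I} {i // i ∈ I} K) (Matrix.single i j u) 1 =
      1 + Matrix.single (i : Fin n) (j : Fin n) u := by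
  ext a b
  obtain ⟨a, rfl⟩ := (Equiv.sumCompl (· ∈ I)).surjective a
  obtain ⟨b, rfl⟩ := (Equiv.sumCompl (· ∈ I)).surjective b
  obtain ⟨i, hi⟩ := i
  obtain ⟨j, hj⟩ := j
  rw [blocks_apply]
  rcases a with ⟨a, ha⟩ | ⟨a, ha⟩ <;> rcases b with ⟨b, hb⟩ | ⟨b, hb⟩ <;>
    simp only [Matrix.add_apply,
      Equiv.sumCompl_apply_inl, Equiv.sumCompl_apply_inr, Matrix.fromBlocks_apply₁₁,
      Matrix.fromBlocks_apply₁₂, Matrix.fromBlocks_apply₂₁, Matrix.fromBlocks_apply₂₂,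
      Matrix.single_apply, Matrix.one_apply, Matrix.zero_apply, Subtype.mk.injEq] <;>
    grind

/-- Gaussian elimination: an invertible block is a product of transvections and an invertible
diagonal matrix. Inside one block `ind I` is constant, so the corresponding roots vanish on `c` and
all these factors are generators of `P_c`. -/
theorem blocks_left_mem (hc : IsDir (ind I) c) {P : Matrix {i // i ∈ I} {i // i ∈ I} K}
    (hP : P.det ≠ 0) : blocks P 0 1 ∈ stabMatrices K c := by
  refine Matrix.diagonal_transvection_induction_of_det_ne_zero
    (fun M => blocks M 0 1 ∈ stabMatrices K c) P hP (fun D hD => ?_) (fun t => ?_)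
    fun A A' _ _ h h' => ?_
  · rw [← Matrix.diagonal_one, blocks_diagonal]
    apply diagonal_mem_stabMatrices
    intro i
    rw [Matrix.det_diagonal, Finset.prod_ne_zero_iff] at hD
    rcases (Equiv.sumCompl (· ∈ I)).symm i with a | a
    · exact hD a (Finset.mem_univ _)
    · exact one_ne_zero
  · rw [TransvectionStruct.toMatrix, Matrix.transvection, blocks_add_single_left]
    exact one_add_single_mem_stabMatrices hc (fun h => t.hij (Subtype.ext h)) _ fun _ => t.i.2
  · have := mul_mem h h'
    rwa [blocks_mul, Matrix.mul_zero, Matrix.zero_mul, add_zero, mul_one] at this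

theorem blocks_right_mem (hc : IsDir (ind I) c) {D : Matrix {i // i ∉ I} {i // i ∉ I} K}
    (hD : D.det ≠ 0) : blocks 1 0 D ∈ stabMatrices K c := by
  refine Matrix.diagonal_transvection_induction_of_det_ne_zero
    (fun M => blocks 1 0 M ∈ stabMatrices K c) D hD (fun D hD => ?_) (fun t => ?_)
    fun A A' _ _ h h' => ?_
  · rw [← Matrix.diagonal_one, blocks_diagonal]
    apply diagonal_mem_stabMatrices
    intro i
    rw [Matrix.det_diagonal, Finset.prod_ne_zero_iff] at hD
    rcases (Equiv.sumCompl (· ∈ I)).symm i with a | a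
    · exact one_ne_zero
    · exact hD a (Finset.mem_univ _)
  · rw [TransvectionStruct.toMatrix, Matrix.transvection, blocks_add_single_right]
    exact one_add_single_mem_stabMatrices hc (fun h => t.hij (Subtype.ext h)) _
      fun h => (t.j.2 h).elim
  · have := mul_mem h h'
    rwa [blocks_mul, Matrix.mul_zero, Matrix.zero_mul, add_zero, mul_one] at this

/-- Unipotent upper blocks multiply by adding `Q`, so matrices `Q` with a single nonzero entry
suffice. For these the root is positive on `c`. -/
theorem blocks_upper_mem (hc : IsDir (ind I) c) (Q : Matrix {i // i ∈ I} {i // i ∉ I} K) :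
    blocks 1 Q 1 ∈ stabMatrices K c := by
  induction Q using Matrix.induction_on' with
  | h_zero => rw [blocks_one]; exact one_mem _
  | h_add p q hp hq =>
    have := mul_mem hp hq
    rwa [blocks_mul, Matrix.mul_one, Matrix.one_mul, Matrix.mul_one, Matrix.mul_one, add_comm] at this
  | h_std_basis i j x =>
    rw [blocks_single_upper]
    exact one_add_single_mem_stabMatrices hc (fun h => j.2 (by rw [← h]; exact i.2)) _
      fun h => (j.2 h).elim

/-- The stabilizer of a coordinate subspace is contained in the parabolic subgroup `P_c`. -/
theorem mk_mem_stab_of_mem_subspaceStabilizer (hc : IsDir (ind I) c) {A : GL (Fin n) K}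
    (hA : A ∈ subspaceStabilizer (coordSpan K I)) :
    ProjGenLinGroup.mk A ∈ stab (Sum.inr c) := by
  rw [← mem_stabMatrices_iff]
  set M : Matrix (Fin n) (Fin n) K := ↑A with hM
  have h0 : ∀ i j, i ∉ I → j ∈ I → M i j = 0 := by
    intro i j hi hj
    have h1 : (Pi.single j 1 : Fin n → K) ∈ coordSpan K I := by
      rw [mem_coordSpan]
      intro k hk
      exact Pi.single_eq_of_ne (fun h => hk (by rw [h]; exact hj)) _
    have h2 := mem_coordSpan.1 ((hA _).2 h1) i hi
    rwa [Matrix.mulVec_single_one] at h2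
  set P : Matrix {i // i ∈ I} {i // i ∈ I} K := M.submatrix (↑) (↑) with hP
  set Q : Matrix {i // i ∈ I} {i // i ∉ I} K := M.submatrix (↑) (↑) with hQ
  set D : Matrix {i // i ∉ I} {i // i ∉ I} K := M.submatrix (↑) (↑) with hD
  have hB : M = blocks P Q D := by
    ext a b
    obtain ⟨a, rfl⟩ := (Equiv.sumCompl (· ∈ I)).surjective a
    obtain ⟨b, rfl⟩ := (Equiv.sumCompl (· ∈ I)).surjective b
    rcases a with a | a <;> rcases b with b | b <;> simp [blocks, P, Q, D]
    exact h0 _ _ a.2 b.2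
  have hdet : P.det * D.det ≠ 0 := by
    have h1 : M.det ≠ 0 := ((Matrix.isUnit_iff_isUnit_det _).1 A.isUnit).ne_zero
    rwa [hB, blocks, Matrix.det_submatrix_equiv_self, Matrix.det_fromBlocks_zero₂₁] at h1
  have hDu : IsUnit D.det := isUnit_iff_ne_zero.2 (right_ne_zero_of_mul hdet)
  -- The Levi decomposition of a block triangular matrix.
  have h3 : M = blocks 1 (Q * D⁻¹) 1 * (blocks P 0 1 * blocks 1 0 D) := by
    rw [blocks_mul, blocks_mul, hB]
    simp [Matrix.mul_assoc, Matrix.nonsing_inv_mul _ hDu]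
  rw [h3]
  exact mul_mem (blocks_upper_mem hc _) (mul_mem (blocks_left_mem hc (left_ne_zero_of_mul hdet))
    (blocks_right_mem hc (right_ne_zero_of_mul hdet)))

end Generation

end

end BTBuilding

namespace BTBuilding

noncomputable section

set_option linter.unusedSectionVars false

/-! ### Vertices of the boundary -/

variable {n : ℕ} {K : Type*} [NormedField K]

/-- A permutation preserves the maximum and the minimum of `x`, so the increasing affine map fixes
both, and these are different because `x` is not constant. Hence an element fixing a boundary point
cannot rescale the weights of its flag. -/
theorem eq_one_of_affine_perm {x : Fin n → ℝ} (hx : Apt.mk x ≠ 0) {σ : Equiv.Perm (Fin n)}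
    {l m : ℝ} (h : ∀ i, x (σ i) = l * x i + m) (hl : 0 < l) : l = 1 ∧ m = 0 := by
  have hne : Nonempty (Fin n) := by
    by_contra h0
    rw [not_nonempty_iff] at h0
    exact hx (Apt.mk_eq_zero_iff.2 ⟨0, fun i => (h0.false i).elim⟩)
  obtain ⟨i, hi⟩ := Finite.exists_max x
  obtain ⟨j, hj⟩ := Finite.exists_min x
  have h1 := h i
  have h2 := h (σ.symm i)
  have h3 := h j
  have h4 := h (σ.symm j)
  rw [Equiv.apply_symm_apply] at h2 h4
  have e1 : x i = l * x i + m := by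
    have := mul_le_mul_of_nonneg_left (hi (σ.symm i)) hl.le
    have := hi (σ i)
    linarith
  have e2 : x j = l * x j + m := by
    have := mul_le_mul_of_nonneg_left (hj (σ.symm j)) hl.le
    have := hj (σ j)
    linarith
  have hij : x i - x j ≠ 0 := by
    intro h0
    exact hx (Apt.mk_eq_zero_iff.2 ⟨x i, fun k => le_antisymm (hi k) (by linarith [hj k])⟩)
  have e3 : (l - 1) * (x i - x j) = 0 := by linarith
  have e4 : l = 1 := by
    rcases mul_eq_zero.1 e3 with h0 | h0
    · linarith
    · exact (hij h0).elim
  exact ⟨e4, by rw [e4] at e1; linarith⟩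

theorem exists_gl_eq_monomial (σ : Equiv.Perm (Fin n)) : ∃ M : GL (Fin n) K,
    (M : Matrix (Fin n) (Fin n) K) = monomial 1 σ := by
  obtain ⟨M, hM, -⟩ := exists_gl_of_linearEquiv (LinearEquiv.funCongrLeft K K σ.symm)
  refine ⟨M, Matrix.ext_of_mulVec_single fun j => ?_⟩
  rw [hM]
  ext i
  rw [monomial_mulVec]
  simp [LinearMap.funLeft_apply]

theorem nuAct_one (a : AptBar n) : nuAct (K := K) 1 1 a = a := by
  have hw : ∀ y : Apt n, weyl (1 : Equiv.Perm (Fin n)) y = y := by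
    intro y
    obtain ⟨x, rfl⟩ := Apt.mk_surjective y
    rw [weyl_mk]
    rfl
  obtain x | c := a
  · have : nuTorus (K := K) (n := n) 1 = 0 := by
      refine Apt.mk_eq_zero_iff.2 ⟨0, fun i => ?_⟩
      simp [val]
    rw [nuAct, this, zero_add, hw]
  · rw [nuAct]
    have : weyl (1 : Equiv.Perm (Fin n)) = LinearEquiv.refl ℝ _ := LinearEquiv.ext hw
    rw [this, Module.Ray.map_refl]
    rfl

theorem xbar_mk_mul_of_mem_stab (g : ProjGenLinGroup (Fin n) K) {h : ProjGenLinGroup (Fin n) K}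
    {a : AptBar n} (hh : h ∈ stab a) : XBar.mk (g * h) a = XBar.mk g a := by
  obtain ⟨M, hM⟩ := exists_gl_eq_monomial (K := K) (1 : Equiv.Perm (Fin n))
  have h1 : M = 1 := by
    refine Units.ext (Matrix.ext_of_mulVec_single fun j => ?_)
    rw [hM]
    ext i
    rw [monomial_mulVec]
    simp [Matrix.one_apply, Pi.single_apply]
    rfl
  refine (Quot.sound ⟨ProjGenLinGroup.mk M, 1, 1, ⟨M, hM, rfl⟩, nuAct_one a, ?_⟩).symm
  rw [h1]
  simpa using hh

theorem smul_xbar_mk (g h : ProjGenLinGroup (Fin n) K) (a : AptBar n) :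
    g • XBar.mk h a = XBar.mk (g * h) a := rfl

theorem forall_one_le_ind_iff {I : Finset (Fin n)} {v : Fin n → K} :
    (∀ i, v i ≠ 0 → 1 ≤ ind I i) ↔ v ∈ coordSpan K I := by
  rw [mem_coordSpan]
  refine forall_congr' fun i => ?_
  by_cases hi : i ∈ I
  · simp [ind_of_mem hi, hi]
  · simp only [ind_of_notMem hi, hi, not_false_eq_true, forall_const]
    constructor
    · intro h
      by_contra h0
      exact absurd (h h0) (by norm_num)
    · intro h h0
      exact (h0 h).elim

section Prime

variable [PrimeNormBounds K] [IsUltrametricDist K]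

theorem mem_flagStabilizer_of_smul_eq {A Q : GL (Fin n) K} {x : Fin n → ℝ}
    {c : Module.Ray ℝ (Apt n)} (hx : IsDir x c)
    (h : XBar.mk (ProjGenLinGroup.mk (A * Q)) (Sum.inr c) =
      XBar.mk (ProjGenLinGroup.mk A) (Sum.inr c)) : Q ∈ flagStabilizer x := by
  obtain ⟨σ, l, m, hl, h1, h2⟩ := sameInvariants_of_mk_eq h (A * Q) A x x rfl rfl hx hx
  obtain ⟨rfl, rfl⟩ := eq_one_of_affine_perm hx.1 h1 hl
  intro s v
  have := h2 s ((A : Matrix (Fin n) (Fin n) K) *ᵥ ((Q : Matrix (Fin n) (Fin n) K) *ᵥ v))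
  rw [_root_.mul_inv_rev, Units.val_mul, ← Matrix.mulVec_mulVec, inv_mulVec_mulVec,
    inv_mulVec_mulVec] at this
  simpa using this

/-- An element fixing the point preserves its flag, whose step at threshold `1` is `W`. Conversely,
the conjugate by `A` of an element stabilizing `W` lies in `P_c`, because `P_c` contains every
stabilizer of the coordinate subspace. -/
theorem stabilizer_xbar_mk {W : Submodule K (Fin n → K)} {A : GL (Fin n) K} {I : Finset (Fin n)}
    (hA : IsImageCoordSpan W A I) {c : Module.Ray ℝ (Apt n)} (hc : IsDir (ind I) c) :
    MulAction.stabilizer (ProjGenLinGroup (Fin n) K)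
      (XBar.mk (ProjGenLinGroup.mk A) (Sum.inr c)) =
      (subspaceStabilizer W).map ProjGenLinGroup.mk := by
  have key : ∀ H : GL (Fin n) K,
      H ∈ subspaceStabilizer W ↔ A⁻¹ * H * A ∈ subspaceStabilizer (coordSpan K I) := by
    intro H
    have e : ∀ v, ((A⁻¹ * H * A : GL (Fin n) K) : Matrix (Fin n) (Fin n) K) *ᵥ v =
        (↑A⁻¹ : Matrix (Fin n) (Fin n) K) *ᵥ ((H : Matrix (Fin n) (Fin n) K) *ᵥ
          ((A : Matrix (Fin n) (Fin n) K) *ᵥ v)) := by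
      intro v
      rw [Units.val_mul, Units.val_mul, Matrix.mulVec_mulVec, Matrix.mulVec_mulVec]
    constructor
    · intro h v
      rw [e, ← hA, h, hA, inv_mulVec_mulVec]
    · intro h u
      have := h ((↑A⁻¹ : Matrix (Fin n) (Fin n) K) *ᵥ u)
      rwa [e, ← hA, ← hA, mulVec_inv_mulVec] at this
  have e : ∀ H : GL (Fin n) K, H * A = A * (A⁻¹ * H * A) := by intro H; group
  ext g
  obtain ⟨H, rfl⟩ := ProjGenLinGroup.mk_surjective g
  rw [MulAction.mem_stabilizer_iff, smul_xbar_mk, ← map_mul, e]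
  constructor
  · intro h
    refine ⟨H, (key H).2 fun v => ?_, rfl⟩
    have := mem_flagStabilizer_of_smul_eq hc h 1 v
    rwa [forall_one_le_ind_iff, forall_one_le_ind_iff] at this
  · intro h
    rw [map_mul]
    exact xbar_mk_mul_of_mem_stab _ (mk_mem_stab_of_mem_subspaceStabilizer hc
      ((key H).1 (mem_of_mk_mem_map (scalar_mem_subspaceStabilizer W) h)))

theorem IsImageCoordSpan.nontrivial {W : Submodule K (Fin n → K)} {A : GL (Fin n) K}
    {I : Finset (Fin n)} (hA : IsImageCoordSpan W A I) (hW₀ : W ≠ ⊥) (hW₁ : W ≠ ⊤) :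
    I ≠ ∅ ∧ I ≠ Finset.univ := by
  constructor
  · rintro rfl
    refine hW₀ ((Submodule.eq_bot_iff _).2 fun u hu => ?_)
    have h0 : (↑A⁻¹ : Matrix (Fin n) (Fin n) K) *ᵥ u = 0 := by
      ext i
      exact mem_coordSpan.1 ((hA u).1 hu) i (by simp)
    rw [← mulVec_inv_mulVec A u, h0, Matrix.mulVec_zero]
  · rintro rfl
    exact hW₁ (Submodule.eq_top_iff'.2 fun u => (hA u).2 (mem_coordSpan.2 fun i hi => by simp at hi))

/-- Both index sets have `dim W` elements, so a permutation matches them. After it the two bases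
adapted to `W` differ by an element stabilizing the coordinate subspace, that is, by an element of
`P_c`. -/
theorem xbar_mk_eq_of_isImageCoordSpan {W : Submodule K (Fin n → K)} {A A' : GL (Fin n) K}
    {I I' : Finset (Fin n)} {c c' : Module.Ray ℝ (Apt n)} (hA : IsImageCoordSpan W A I)
    (hA' : IsImageCoordSpan W A' I') (hc : IsDir (ind I) c) (hc' : IsDir (ind I') c') :
    XBar.mk (ProjGenLinGroup.mk A) (Sum.inr c) = XBar.mk (ProjGenLinGroup.mk A') (Sum.inr c') := by
  have hcard : I.card = I'.card := hA.finrank_eq.symm.trans hA'.finrank_eq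
  let f : {i // i ∈ I} ≃ {i // i ∈ I'} := Fintype.equivOfCardEq (by simpa using hcard)
  let σ : Equiv.Perm (Fin n) := f.extendSubtype
  have hσ : ∀ i, σ i ∈ I' ↔ i ∈ I := fun i =>
    ⟨fun h => by_contra fun h0 => f.extendSubtype_not_mem i h0 h, fun h => f.extendSubtype_mem i h⟩
  obtain ⟨M, hM⟩ := exists_gl_eq_monomial (K := K) σ
  have hMv : ∀ v, (M : Matrix (Fin n) (Fin n) K) *ᵥ v ∈ coordSpan K I' ↔ v ∈ coordSpan K I := by
    intro v
    rw [hM, mem_coordSpan, mem_coordSpan, ← σ.forall_congr_right]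
    refine forall_congr' fun i => ?_
    rw [monomial_mulVec, hσ]
    simp
  refine Quot.sound ⟨ProjGenLinGroup.mk M, 1, σ, ⟨M, hM, rfl⟩, ?_, ?_⟩
  · have h1 := hc.map_weyl σ
    have h2 : (fun i => ind I (σ.symm i)) = ind I' := by
      ext i
      have := hσ (σ.symm i)
      rw [Equiv.apply_symm_apply] at this
      simp only [ind, this]
    rw [h2] at h1
    obtain ⟨h0, rfl⟩ := hc'
    rw [nuAct, ← h1.2]
  · change (ProjGenLinGroup.mk A)⁻¹ * ProjGenLinGroup.mk A' * ProjGenLinGroup.mk M ∈ _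
    rw [← map_inv, ← map_mul, ← map_mul]
    refine mk_mem_stab_of_mem_subspaceStabilizer hc fun v => ?_
    rw [Units.val_mul, Units.val_mul, ← Matrix.mulVec_mulVec, ← Matrix.mulVec_mulVec, ← hA, hA',
      inv_mulVec_mulVec, hMv]

/-- Subtracting the identity from a diagonal matrix with a single entry different from one isolates
a coordinate. Thus `W` contains the `i`-th basis vector as soon as some vector of `W` has a nonzero
`i`-th coordinate. -/
theorem eq_coordSpan_of_forall_diagonal {W : Submodule K (Fin n → K)} {a : K} (ha : a ≠ 1)
    (h : ∀ i, ∀ u ∈ W, Matrix.diagonal (Function.update 1 i a) *ᵥ u ∈ W) :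
    ∃ I, W = coordSpan K I := by
  classical
  refine ⟨Finset.univ.filter fun i => Pi.single i 1 ∈ W, ?_⟩
  ext u
  rw [mem_coordSpan]
  constructor
  · intro hu i hi
    by_contra hui
    refine hi ?_
    have h1 := W.sub_mem (h i u hu) hu
    have h2 : Matrix.diagonal (Function.update 1 i a) *ᵥ u - u =
        ((a - 1) * u i) • (Pi.single i 1 : Fin n → K) := by
      ext j
      rw [Pi.sub_apply, Matrix.mulVec_diagonal]
      by_cases hj : j = i
      · subst hj; simp; ring
      · simp [hj]
    rw [h2, Submodule.smul_mem_iff _ (mul_ne_zero (sub_ne_zero.2 ha) hui)] at h1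
    simpa using h1
  · intro hu
    rw [pi_eq_sum_univ' u]
    refine Submodule.sum_mem _ fun i _ => ?_
    by_cases hi : Pi.single i 1 ∈ W
    · exact W.smul_mem _ hi
    · rw [hu i (by simpa using hi), zero_smul]
      exact W.zero_mem

theorem exists_norm_lt_one (K : Type*) [NormedField K] [PrimeNormBounds K] :
    ∃ a : K, a ≠ 0 ∧ ‖a‖ < 1 := by
  have h := PrimeNormBounds.pos (K := K)
  rw [primeNorm] at h
  obtain ⟨r, ⟨hr1, a, rfl⟩, hr⟩ := exists_lt_of_lt_csSup
    (s := {r : ℝ | r < 1 ∧ ∃ x : K, r = ‖x‖}) ⟨0, by norm_num, (0 : K), by simp⟩ h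
  exact ⟨a, norm_pos_iff.1 hr, hr1⟩

/-- The torus of the apartment of `A` fixes the point and hence stabilizes `W`, which is therefore
spanned by columns of `A`. A root group that stabilizes `W` fixes the point, hence its flag, which
gives `x j ≤ x i`. These inequalities make `x` constant on `I` and on its complement, with the
larger value on `I`. -/
theorem exists_isImageCoordSpan_of_stabilizer {W : Submodule K (Fin n → K)} (hW₀ : W ≠ ⊥)
    (hW₁ : W ≠ ⊤) {y : XBar n K} (hy : y ∈ boundary n K)
    (hs : MulAction.stabilizer (ProjGenLinGroup (Fin n) K) y =
      (subspaceStabilizer W).map ProjGenLinGroup.mk) :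
    ∃ A I c, IsImageCoordSpan W A I ∧ IsDir (ind I) c ∧
      y = XBar.mk (ProjGenLinGroup.mk A) (Sum.inr c) := by
  obtain ⟨g, c, rfl⟩ := exists_mk_inr_of_mem_boundary hy
  obtain ⟨A, rfl⟩ := ProjGenLinGroup.mk_surjective g
  obtain ⟨x, hx⟩ := exists_isDir c
  have e : ∀ Q : GL (Fin n) K, A * Q * A⁻¹ * A = A * Q := by intro Q; group
  have hmem : ∀ Q : GL (Fin n) K, XBar.mk (ProjGenLinGroup.mk (A * Q)) (Sum.inr c) =
      XBar.mk (ProjGenLinGroup.mk A) (Sum.inr c) ↔ A * Q * A⁻¹ ∈ subspaceStabilizer W := by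
    intro Q
    have h1 : ProjGenLinGroup.mk (A * Q) =
        ProjGenLinGroup.mk (A * Q * A⁻¹) * ProjGenLinGroup.mk A := by rw [← map_mul, e]
    rw [h1, ← smul_xbar_mk, ← MulAction.mem_stabilizer_iff, hs]
    exact ⟨mem_of_mk_mem_map (scalar_mem_subspaceStabilizer W), fun h => ⟨_, h, rfl⟩⟩
  have hconj : ∀ (Q : GL (Fin n) K) (u : Fin n → K),
      ((A * Q * A⁻¹ : GL (Fin n) K) : Matrix (Fin n) (Fin n) K) *ᵥ
        ((A : Matrix (Fin n) (Fin n) K) *ᵥ u) =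
        (A : Matrix (Fin n) (Fin n) K) *ᵥ ((Q : Matrix (Fin n) (Fin n) K) *ᵥ u) := by
    intro Q u
    rw [Units.val_mul, Units.val_mul, ← Matrix.mulVec_mulVec, inv_mulVec_mulVec,
      ← Matrix.mulVec_mulVec]
  obtain ⟨a, ha0, ha⟩ := exists_norm_lt_one K
  have ha1 : a ≠ 1 := by rintro rfl; simp at ha
  let W₁ : Submodule K (Fin n → K) := W.comap (Matrix.mulVecLin (A : Matrix (Fin n) (Fin n) K))
  have hW₁mem : ∀ u, u ∈ W₁ ↔ (A : Matrix (Fin n) (Fin n) K) *ᵥ u ∈ W := fun _ => Iff.rfl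
  obtain ⟨I, hI⟩ : ∃ I, W₁ = coordSpan K I := by
    refine eq_coordSpan_of_forall_diagonal ha1 fun i u hu => ?_
    have hd : Matrix.diagonal (Function.update 1 i a) ∈ stabMatrices K c :=
      diagonal_mem_stabMatrices fun j => by
        by_cases hj : j = i
        · subst hj; simpa using ha0
        · simp [hj]
    obtain ⟨Q, hQ, hQe⟩ := hd
    have h1 := (hmem Q).1 (by rw [map_mul]; exact xbar_mk_mul_of_mem_stab _ hQ)
    have h2 := (h1 ((A : Matrix (Fin n) (Fin n) K) *ᵥ u)).2 hu
    rw [hconj] at h2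
    rw [← hQe]
    exact h2
  have hAI : IsImageCoordSpan W A I := by
    intro u
    rw [← hI, hW₁mem, mulVec_inv_mulVec]
  obtain ⟨hI₀, hI₁⟩ := hAI.nontrivial hW₀ hW₁
  have hle : ∀ i j, i ≠ j → (j ∈ I → i ∈ I) → x j ≤ x i := by
    intro i j hij hIJ
    obtain ⟨Q, hQ⟩ := isUnit_one_add_single hij (1 : K)
    have hind : ind I j ≤ ind I i := by
      by_cases hj : j ∈ I
      · rw [ind_of_mem hj, ind_of_mem (hIJ hj)]
      · rw [ind_of_notMem hj, ind]
        split_ifs <;> norm_num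
    have h1 : A * Q * A⁻¹ ∈ subspaceStabilizer W := by
      intro u
      obtain ⟨v, rfl⟩ : ∃ v, (A : Matrix (Fin n) (Fin n) K) *ᵥ v = u := ⟨_, mulVec_inv_mulVec A u⟩
      rw [hconj, ← hW₁mem, ← hW₁mem, hI, ← forall_one_le_ind_iff, ← forall_one_le_ind_iff, hQ]
      exact flagStabilizer_one_add_single hij hind 1 v
    have h2 := mem_flagStabilizer_of_smul_eq hx ((hmem Q).2 h1) (x j) (Pi.single j 1)
    rw [hQ, one_add_single_mulVec] at h2
    refine h2.2 (fun k hk => ?_) i ?_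
    · have : k = j := by
        by_contra h0
        exact hk (by simp [h0])
      rw [this]
    · simp [hij]
  have hx' : ∃ a b : ℝ, 0 < a ∧ ∀ i, x i = a * ind I i + b := by
    obtain ⟨i₀, hi₀⟩ := Finset.nonempty_iff_ne_empty.2 hI₀
    obtain ⟨j₀, hj₀⟩ : ∃ j, j ∉ I := by
      by_contra! h
      exact hI₁ (Finset.eq_univ_iff_forall.2 h)
    have h1 : ∀ i, x i = (x i₀ - x j₀) * ind I i + x j₀ := by
      intro i
      by_cases hi : i ∈ I
      · rw [ind_of_mem hi]
        rcases eq_or_ne i i₀ with rfl | hne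
        · ring
        · linarith [hle i i₀ hne fun _ => hi, hle i₀ i hne.symm fun _ => hi₀]
      · rw [ind_of_notMem hi]
        rcases eq_or_ne i j₀ with rfl | hne
        · ring
        · linarith [hle i j₀ hne fun h => (hj₀ h).elim, hle j₀ i hne.symm fun h => (hi h).elim]
    refine ⟨x i₀ - x j₀, x j₀, lt_of_le_of_ne ?_ ?_, h1⟩
    · exact sub_nonneg.2 (hle i₀ j₀ (fun h => hj₀ (h ▸ hi₀)) fun _ => hi₀)
    · intro h0
      refine hx.1 (Apt.mk_eq_zero_iff.2 ⟨x j₀, fun i => ?_⟩)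
      rw [h1 i, ← h0]
      ring
  obtain ⟨α, β, hα, hαβ⟩ := hx'
  refine ⟨A, I, c, hAI, (isDir_iff_affine hx).2 ⟨α⁻¹, -(α⁻¹ * β), inv_pos.2 hα, fun i => ?_⟩, rfl⟩
  rw [hαβ]
  field_simp
  ring

theorem existsUnique_mem_boundary_stabilizer {W : Submodule K (Fin n → K)} (hW₀ : W ≠ ⊥)
    (hW₁ : W ≠ ⊤) : ∃! y : XBar n K, y ∈ boundary n K ∧
      MulAction.stabilizer (ProjGenLinGroup (Fin n) K) y =
      (subspaceStabilizer W).map ProjGenLinGroup.mk := by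
  obtain ⟨W', hW'⟩ := exists_isCompl W
  obtain ⟨A, I, hA, -⟩ := exists_isImageCoordSpan_of_isCompl hW'
  obtain ⟨hI₀, hI₁⟩ := hA.nontrivial hW₀ hW₁
  obtain ⟨c, hc⟩ := exists_isDir_ind hI₀ hI₁
  refine ⟨XBar.mk (ProjGenLinGroup.mk A) (Sum.inr c), ⟨mk_inr_mem_boundary _ _,
    stabilizer_xbar_mk hA hc⟩, ?_⟩
  rintro y ⟨hy, hs⟩
  obtain ⟨A', I', c', hA', hc', rfl⟩ := exists_isImageCoordSpan_of_stabilizer hW₀ hW₁ hy hs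
  exact xbar_mk_eq_of_isImageCoordSpan hA' hA hc' hc

end Prime

end

end BTBuilding

namespace BTBuilding

noncomputable section

set_option linter.unusedSectionVars false

/-! ### The topology of the compactified apartment -/

variable {n : ℕ}

namespace InvScalarProduct

variable (B : InvScalarProduct n)

/-- A multiple of the class of `e_i - e_j` works, because its coordinate sum is zero. Root
inequalities thereby become half-space conditions, which can be compared with the cones defining the
topology. -/
theorem exists_form_eq_root (hn : 2 ≤ n) (i j : Fin n) :
    ∃ w, ∀ x, B.form w x = root i j x := by
  obtain ⟨l, m, hl, h⟩ := B.exists_form_eq hn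
  refine ⟨l⁻¹ • Apt.mk (Pi.single i 1 - Pi.single j 1), fun x => ?_⟩
  obtain ⟨x, rfl⟩ := Apt.mk_surjective x
  rw [map_smul, LinearMap.smul_apply, h, root_mk]
  simp only [Pi.sub_apply, sub_mul, Finset.sum_sub_distrib]
  simp [Pi.single_apply]
  field_simp

theorem angle_smul_right {r : ℝ} (hr : 0 < r) (x y : Apt n) : B.angle x (r • y) = B.angle x y := by
  rw [angle, angle, len_smul, map_smul, smul_eq_mul, abs_of_pos hr, mul_left_comm,
    mul_div_mul_left _ _ hr.ne']

theorem exists_forall_angle_lt_form_pos {w c : Apt n} (hc : c ≠ 0) (h : 0 < B.form w c) :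
    ∃ ε > 0, ∀ v, v ≠ 0 → B.angle c v < ε → 0 < B.form w v := by
  have hlc := B.len_pos hc
  have hw : w ≠ 0 := by rintro rfl; simp at h
  have hlw := B.len_pos hw
  set q : ℝ := B.form w c / (B.len w * B.len c) with hq
  have hqpos : 0 < q := by positivity
  have hq1 : q ≤ 1 := by
    rw [hq, div_le_one (by positivity)]
    exact B.form_le w c
  have hlt : 1 - q ^ 2 / 2 < 1 := by nlinarith
  -- Unit vectors whose scalar product exceeds `1 - q² / 2` have distance less than `q`. Since `q`
  -- is the cosine of the angle between `w` and `c`, moving from `c` to `v` cannot make the scalar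
  -- product with `w` vanish.
  refine ⟨Real.arccos (1 - q ^ 2 / 2), Real.arccos_pos.2 hlt, fun v hv hang => ?_⟩
  have hlv := B.len_pos hv
  have h1 : 1 - q ^ 2 / 2 < B.form c v / (B.len c * B.len v) := by
    by_contra! h0
    exact absurd hang (not_lt.2 (Real.arccos_le_arccos h0))
  rw [lt_div_iff₀ (by positivity)] at h1
  -- compare the unit vectors in the directions of `c` and `v`
  set d : Apt n := B.len c • v - B.len v • c with hd
  have h2 : B.len d ^ 2 < (q * (B.len c * B.len v)) ^ 2 := by
    have hsym := B.symm v c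
    rw [len_sq, hd]
    simp only [map_sub, map_smul, LinearMap.sub_apply, LinearMap.smul_apply, smul_eq_mul, hsym,
      ← len_sq]
    nlinarith [mul_pos hlc hlv]
  have h3 : B.len d < q * (B.len c * B.len v) := lt_of_pow_lt_pow_left₀ 2 (by positivity) h2
  have h4 : -(B.len w * B.len d) ≤ B.form w d := by
    have := B.form_le w (-d)
    rw [len_neg, map_neg] at this
    linarith
  have h5 : B.form w d = B.len c * B.form w v - B.len v * B.form w c := by
    simp [hd]
  have h6 : B.form w c = q * (B.len w * B.len c) := by
    rw [hq]; field_simp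
  have h7 : B.len w * B.len d < B.len w * (q * (B.len c * B.len v)) :=
    mul_lt_mul_of_pos_left h3 hlw
  have h8 : 0 < B.len c * B.form w v := by nlinarith
  exact (pos_iff_pos_of_mul_pos h8).1 hlc

end InvScalarProduct

variable (B : InvScalarProduct n)

theorem form_halfspace_mem_nhds {w : Apt n} {c : Module.Ray ℝ (Apt n)}
    (h : 0 < B.form w c.someVector) (R : ℝ) :
    {z : AptBar n | z.elim (fun x => R < B.form w x) fun e => 0 < B.form w e.someVector} ∈
      @nhds _ (aptBarTopology B) (Sum.inr c) := by
  let _ := aptBarTopology B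
  obtain ⟨ε, hε, H⟩ := B.exists_forall_angle_lt_form_pos c.someVector_ne_zero h
  -- The apex lies on the ray at height exactly `R`, so all points seen from it near the direction
  -- `c` lie above height `R`.
  have ho : IsOpen (cone B ((R / B.form w c.someVector) • c.someVector) c ε) :=
    TopologicalSpace.isOpen_generateFrom_of_mem (Or.inr ⟨_, _, _, hε, rfl⟩)
  refine Filter.mem_of_superset (ho.mem_nhds ?_) ?_
  · change B.angle c.someVector c.someVector < ε
    have : B.form c.someVector c.someVector ≠ 0 := (B.pos _ c.someVector_ne_zero).ne'
    rw [InvScalarProduct.angle, ← sq, B.len_sq, div_self this, Real.arccos_one]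
    exact hε
  · rintro (x | e) hz
    · have h1 := H _ (sub_ne_zero.2 hz.1) hz.2
      rw [map_sub, map_smul, smul_eq_mul, div_mul_cancel₀ _ h.ne'] at h1
      exact sub_pos.1 h1
    · exact H _ e.someVector_ne_zero hz

/-- Seen from any apex `x`, the point `f t • v` has the direction of `v - (f t)⁻¹ • x`, which tends
to that of `v`. -/
theorem tendsto_inl_smul {v : Apt n} {c : Module.Ray ℝ (Apt n)} (hv : v ≠ 0)
    (hc : rayOfNeZero ℝ v hv = c) {f : ℝ → ℝ} {F : Filter ℝ} (hf : Tendsto f F atTop) :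
    Tendsto (fun t => (Sum.inl (f t • v) : AptBar n)) F (@nhds _ (aptBarTopology B) (Sum.inr c)) := by
  have hcv : ∃ a : ℝ, 0 < a ∧ c.someVector = a • v := by
    obtain ⟨x, rfl⟩ := Apt.mk_surjective v
    exact IsDir.exists_someVector ⟨hv, hc⟩
  obtain ⟨a, ha, hav⟩ := hcv
  refine TopologicalSpace.tendsto_nhds_generateFrom_iff.2 ?_
  rintro s (⟨u, -, rfl⟩ | ⟨x, e, ε, hε, rfl⟩) hs
  · simp at hs
  · have h1 : B.angle e.someVector v < ε := by
      have : B.angle e.someVector c.someVector < ε := hs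
      rwa [hav, B.angle_smul_right ha] at this
    have hne : e.someVector ≠ 0 := e.someVector_ne_zero
    -- the angle is a continuous function of the inverse of the parameter
    have h2 : Tendsto (fun s : ℝ => B.angle e.someVector (v - s • x)) (𝓝 0)
        (𝓝 (B.angle e.someVector v)) := by
      have hform : ∀ s : ℝ, B.form e.someVector (v - s • x) =
          B.form e.someVector v - s * B.form e.someVector x := by intro s; simp
      have hlen : ∀ s : ℝ, B.len (v - s • x) =
          Real.sqrt (B.form v v - s * B.form v x - s * B.form x v + s * s * B.form x x) := by
        intro s
        rw [InvScalarProduct.len]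
        congr 1
        simp
        ring
      have hc : ContinuousAt (fun s : ℝ => B.angle e.someVector (v - s • x)) 0 := by
        simp only [InvScalarProduct.angle, hform, hlen]
        refine Real.continuous_arccos.continuousAt.comp ?_
        refine ContinuousAt.div (by fun_prop) (by fun_prop) ?_
        have h3 := B.len_pos hne
        have h4 := B.len_pos hv
        rw [InvScalarProduct.len] at h4
        have : 0 < B.len e.someVector * Real.sqrt (B.form v v) := mul_pos h3 h4
        simpa using this.ne'
      have := hc.tendsto
      simpa using this
    have h3 : Tendsto (fun t => (f t)⁻¹) F (𝓝 0) := tendsto_inv_atTop_zero.comp hf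
    have h5 : ∀ᶠ s : ℝ in 𝓝 0, v - s • x ≠ 0 := by
      have hvv := B.pos v hv
      have : ContinuousAt (fun s : ℝ => B.form v (v - s • x)) 0 := by
        have hform : ∀ s : ℝ, B.form v (v - s • x) = B.form v v - s * B.form v x := by
          intro s; simp
        simp only [hform]
        fun_prop
      have h6 : (0 : ℝ) < B.form v (v - (0 : ℝ) • x) := by simpa using hvv
      filter_upwards [this.tendsto.eventually_const_lt h6] with s hs h0
      simp [h0] at hs
    filter_upwards [h3.eventually (h2.eventually_lt_const h1), h3.eventually h5,
      hf.eventually_gt_atTop 0] with t ht1 ht2 ht3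
    have e1 : f t • v - x = f t • (v - (f t)⁻¹ • x) := by
      rw [smul_sub, smul_inv_smul₀ ht3.ne']
    refine ⟨?_, ?_⟩
    · rw [← sub_ne_zero, e1]
      exact smul_ne_zero ht3.ne' ht2
    · rw [e1, B.angle_smul_right ht3]
      exact ht1

end

end BTBuilding

namespace BTBuilding

noncomputable section

set_option linter.unusedSectionVars false

/-! ### Neighbourhoods of boundary points -/

variable {n : ℕ} {K : Type*} [NormedField K]

/-- The logarithm of the factor by which `N` stretches `u`, compared with the sup norm. -/
def stretch (N : (Fin n → K) → ℝ) (u : Fin n → K) : ℝ := Real.log (N u) - Real.log ‖u‖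

/-- On some `k`-dimensional subspace close to the kernel of `P`, the norm `N` is nearly minimal,
on some subspace of complementary dimension it is nearly maximal, and the errors are small compared
with the gap between the two. -/
def IsNearInterior (P : Matrix (Fin n) (Fin n) K) (k : ℕ) (ε η : ℝ) (N : (Fin n → K) → ℝ) : Prop :=
  ∃ U U' : Submodule K (Fin n → K), Module.finrank K U = k ∧ Module.finrank K U' + k = n ∧
    (∀ u ∈ U, u ≠ 0 → ‖P *ᵥ u‖ < ε * ‖u‖) ∧
    -- Only differences of `stretch` occur, so homothetic norms satisfy the same condition. The
    -- slack `δ` makes the condition stable under small changes of the norm.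
    ∃ δ : ℝ, 0 < δ ∧ ∀ u ∈ U, ∀ u' ∈ U', ∀ w ∈ U, ∀ w' ∈ U', ∀ v, u ≠ 0 → u' ≠ 0 → w ≠ 0 →
      w' ≠ 0 → v ≠ 0 →
      stretch N u - stretch N v + δ ≤ η * (stretch N w' - stretch N w) ∧
      stretch N v - stretch N u' + δ ≤ η * (stretch N w' - stretch N w)

/-- The analogue of `IsNearInterior` for points of the boundary. -/
def IsNearBoundary (P : Matrix (Fin n) (Fin n) K) (k : ℕ) (ε η : ℝ) (A : GL (Fin n) K)
    (x : Fin n → ℝ) : Prop :=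
  ∃ J : Finset (Fin n), J.card = k ∧
    (∀ i j, (i ∈ J ∨ j ∉ J) → ∀ m ∈ J, ∀ l, l ∉ J → x j - x i < η * (x m - x l)) ∧
    ∀ v ∈ coordSpan K J, v ≠ 0 → ‖P *ᵥ ((A : Matrix (Fin n) (Fin n) K) *ᵥ v)‖ <
      ε * ‖(A : Matrix (Fin n) (Fin n) K) *ᵥ v‖

/-- The pairs that represent points close to a given point of the boundary. -/
def nearSet (P : Matrix (Fin n) (Fin n) K) (k : ℕ) (ε η : ℝ) :
    Set (ProjGenLinGroup (Fin n) K × AptBar n) :=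
  {p | match p with
    | (g, Sum.inl a) => ∃ A x, ProjGenLinGroup.mk A = g ∧ Apt.mk x = a ∧
        IsNearInterior P k ε η (nrm A x)
    | (g, Sum.inr c) => ∃ A x, ProjGenLinGroup.mk A = g ∧ IsDir x c ∧ IsNearBoundary P k ε η A x}

variable {P : Matrix (Fin n) (Fin n) K} {k : ℕ} {ε η : ℝ}

theorem IsNearInterior.exists_of_close (hη : 0 < η) {N : (Fin n → K) → ℝ}
    (h : IsNearInterior P k ε η N) : ∃ τ > 0, ∀ N' : (Fin n → K) → ℝ,
      (∃ r : ℝ, ∀ u, u ≠ 0 → |Real.log (N' u) - Real.log (N u) - r| ≤ τ) →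
        IsNearInterior P k ε η N' := by
  obtain ⟨U, U', hU, hU', hP, δ, hδ, H⟩ := h
  -- Both sides of the inequalities involve two values of `stretch`, each known up to `τ`. The total
  -- error `2 τ + 2 η τ` uses up half of the slack.
  refine ⟨δ / (4 * (1 + η)), by positivity, fun N' hN' => ⟨U, U', hU, hU', hP, δ / 2, by positivity,
    ?_⟩⟩
  obtain ⟨r, hr⟩ := hN'
  intro u hu u' hu' w hw w' hw' v hu0 hu0' hw0 hw0' hv0
  obtain ⟨h1, h2⟩ := H u hu u' hu' w hw w' hw' v hu0 hu0' hw0 hw0' hv0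
  set τ := δ / (4 * (1 + η)) with hτ
  have hτδ : 2 * τ + η * (2 * τ) = δ / 2 := by rw [hτ]; field_simp; ring
  have key : ∀ z, z ≠ 0 → |stretch N' z - stretch N z - r| ≤ τ := by
    intro z hz
    have := hr z hz
    rw [stretch, stretch]
    convert this using 2
    ring
  have ku := abs_le.1 (key u hu0)
  have ku' := abs_le.1 (key u' hu0')
  have kw := abs_le.1 (key w hw0)
  have kw' := abs_le.1 (key w' hw0')
  have kv := abs_le.1 (key v hv0)
  have h3 : η * (stretch N w' - stretch N w) ≤
      η * ((stretch N' w' - stretch N' w) + 2 * τ) := by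
    apply mul_le_mul_of_nonneg_left _ hη.le
    linarith [ku.1]
  rw [mul_add] at h3
  constructor <;> linarith [ku.1, ku.2, ku'.1, ku'.2, kv.1, kv.2]

section Prime

variable [PrimeNormBounds K]

/-- This saturation is what makes `nearSet` descend to an open subset of the quotient `X̄`. On the
boundary, `J` is a superlevel set of the weights, so its coordinate subspace is a step of the flag
and does not depend on the representative. -/
theorem mem_nearSet_of_sameInvariants (hη : 0 < η) (hk : 0 < k)
    {p q : ProjGenLinGroup (Fin n) K × AptBar n}
    (hp : p ∈ nearSet P k ε η) (h : SameInvariants p q) : q ∈ nearSet P k ε η := by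
  obtain ⟨g, a | a⟩ := p <;> obtain ⟨g', b | b⟩ := q
  · obtain ⟨A, x, rfl, rfl, hN⟩ := hp
    obtain ⟨A', rfl⟩ := ProjGenLinGroup.mk_surjective g'
    obtain ⟨x', rfl⟩ := Apt.mk_surjective b
    obtain ⟨r, hr⟩ := h A A' x x' rfl rfl rfl rfl
    obtain ⟨τ, hτ, H⟩ := hN.exists_of_close hη
    refine ⟨A', x', rfl, rfl, H _ ⟨Real.log (primeNorm K ^ r), fun u hu => ?_⟩⟩
    rw [hr, Real.log_mul (primeNorm_rpow_pos K r).ne' (nrm_pos hu).ne']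
    simpa using hτ.le
  · exact h.elim
  · exact h.elim
  · obtain ⟨A, x, rfl, hx, J, hJ, hc, hP⟩ := hp
    obtain ⟨A', rfl⟩ := ProjGenLinGroup.mk_surjective g'
    obtain ⟨x', hx'⟩ := exists_isDir b
    obtain ⟨σ, l, m, hl, h1, h2⟩ := h A A' x x' rfl rfl hx hx'
    refine ⟨A', x', rfl, hx', J.map σ.toEmbedding, by simpa using hJ, ?_, ?_⟩
    · intro i j hij p hp q hq
      obtain ⟨i, rfl⟩ := σ.surjective i
      obtain ⟨j, rfl⟩ := σ.surjective j
      obtain ⟨p, rfl⟩ := σ.surjective p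
      obtain ⟨q, rfl⟩ := σ.surjective q
      simp only [Finset.mem_map_equiv, Equiv.symm_apply_apply] at hij hp hq
      have := mul_lt_mul_of_pos_left (hc i j hij p hp q hq) hl
      simp only [h1]
      linarith
    · obtain ⟨m₀, hm₀, hmin⟩ := Finset.exists_min_image J x (Finset.card_pos.1 (hJ ▸ hk))
      have hJs : ∀ i, x m₀ ≤ x i ↔ i ∈ J := by
        refine fun i => ⟨fun hi => ?_, hmin i⟩
        by_contra hi'
        -- Equal first indices turn the estimate into strict positivity of the gap.
        have := hc m₀ m₀ (Or.inl hm₀) m₀ hm₀ i hi'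
        rw [sub_self] at this
        linarith [(pos_iff_pos_of_mul_pos this).1 hη]
      intro v hv hv0
      have h3 := h2 (x m₀) ((A' : Matrix (Fin n) (Fin n) K) *ᵥ v)
      rw [inv_mulVec_mulVec] at h3
      have h4 : (↑A⁻¹ : Matrix (Fin n) (Fin n) K) *ᵥ ((A' : Matrix (Fin n) (Fin n) K) *ᵥ v) ∈
          coordSpan K J := by
        rw [mem_coordSpan]
        intro i hi
        by_contra h0
        refine hi ((hJs i).1 (h3.1 (fun j hj => ?_) i h0))
        obtain ⟨j, rfl⟩ := σ.surjective j
        rw [h1]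
        have hjJ : j ∈ J := by
          by_contra hjJ
          exact hj (mem_coordSpan.1 hv _ (by simpa using hjJ))
        have := mul_le_mul_of_nonneg_left (hmin j hjJ) hl.le
        linarith
      have h5 := hP _ h4 (fun h0 => hv0 ?_)
      · rwa [mulVec_inv_mulVec] at h5
      · have : (A' : Matrix (Fin n) (Fin n) K) *ᵥ v = 0 := by
          rw [← mulVec_inv_mulVec A ((A' : Matrix (Fin n) (Fin n) K) *ᵥ v), h0, Matrix.mulVec_zero]
        rw [← inv_mulVec_mulVec A' v, this, Matrix.mulVec_zero]

end Prime

/-! ### Small perturbations -/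

theorem pgl_mem_nhds (A₀ : GL (Fin n) K) {ρ : ℝ} (hρ : 0 < ρ) :
    {g | ∃ (A : GL (Fin n) K) (D : Matrix (Fin n) (Fin n) K), ProjGenLinGroup.mk A = g ∧
      (A : Matrix (Fin n) (Fin n) K) = (1 + D) * A₀ ∧ ∀ i j, ‖D i j‖ < ρ} ∈
      𝓝 (ProjGenLinGroup.mk A₀) := by
  have hsc : ∀ (A : GL (Fin n) K) (u : Kˣ),
      ((A * GeneralLinearGroup.scalar (Fin n) u : GL (Fin n) K) : Matrix (Fin n) (Fin n) K) =
        (u : K) • (A : Matrix (Fin n) (Fin n) K) := by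
    intro A u
    ext i j
    simp [Matrix.scalar_apply, mul_comm]
  have ho : IsOpen {A : GL (Fin n) K | ∃ u : Kˣ, ∀ i j,
      ‖((u : K) • ((A : Matrix (Fin n) (Fin n) K) * (↑A₀⁻¹ : Matrix (Fin n) (Fin n) K)) - 1 :
        Matrix (Fin n) (Fin n) K) i j‖ < ρ} := by
    simp only [Set.ofPred_exists, Set.ofPred_forall]
    refine isOpen_iUnion fun u => isOpen_iInter_of_finite fun i => isOpen_iInter_of_finite fun j =>
      isOpen_lt (Continuous.norm ?_) continuous_const
    refine Continuous.matrix_elem ?_ i j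
    exact ((Units.continuous_val.mul continuous_const).const_smul (u : K)).sub continuous_const
  have hs : IsOpen {g | ∃ (A : GL (Fin n) K) (D : Matrix (Fin n) (Fin n) K),
      ProjGenLinGroup.mk A = g ∧
      (A : Matrix (Fin n) (Fin n) K) = (1 + D) * A₀ ∧ ∀ i j, ‖D i j‖ < ρ} := by
    refine isOpen_coinduced.2 ?_
    convert ho using 1
    ext A
    constructor
    · rintro ⟨A', D, hA', hD, hDρ⟩
      obtain ⟨u, rfl⟩ := ProjGenLinGroup.mk_eq_mk_iff.1 hA'
      refine ⟨u⁻¹, fun i j => ?_⟩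
      have : (↑u⁻¹ : K) • (((A' * GeneralLinearGroup.scalar (Fin n) u : GL (Fin n) K) :
          Matrix (Fin n) (Fin n) K) * (↑A₀⁻¹ : Matrix (Fin n) (Fin n) K)) - 1 = D := by
        rw [hsc, Matrix.smul_mul, smul_smul, Units.inv_mul, one_smul, hD, Matrix.mul_assoc,
          ← Units.val_mul, mul_inv_cancel, Units.val_one, Matrix.mul_one, add_sub_cancel_left]
      rw [this]
      exact hDρ i j
    · rintro ⟨u, hu⟩
      refine ⟨A * GeneralLinearGroup.scalar (Fin n) u, _, ?_, ?_, hu⟩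
      · exact (ProjGenLinGroup.mk_eq_mk_iff.2 ⟨u, rfl⟩).symm
      · rw [hsc, add_sub_cancel, Matrix.smul_mul, Matrix.mul_assoc, ← Units.val_mul,
          inv_mul_cancel, Units.val_one, Matrix.mul_one]
  refine hs.mem_nhds ⟨A₀, 0, rfl, by simp, fun i j => by simpa using hρ⟩

theorem apt_mem_nhds (x₀ : Fin n → ℝ) {τ : ℝ} (hτ : 0 < τ) :
    {a | ∃ x, Apt.mk x = a ∧ ∀ i, |x i - x₀ i| < τ} ∈ 𝓝 (Apt.mk x₀) := by
  have ho : IsOpen {x : Fin n → ℝ | ∀ i, |x i - x₀ i| < τ} := by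
    simp only [Set.ofPred_forall]
    exact isOpen_iInter_of_finite fun i => isOpen_lt (by fun_prop) continuous_const
  have := (Submodule.isOpenMap_mkQ (Submodule.span ℝ {(fun _ => 1 : Fin n → ℝ)})) _ ho
  refine Filter.mem_of_superset (this.mem_nhds ⟨x₀, fun i => by simpa using hτ, rfl⟩) ?_
  rintro _ ⟨x, hx, rfl⟩
  exact ⟨x, rfl, hx⟩

/-! ### Stability of the norms and openness of the neighbourhoods -/

section Ultra

variable [PrimeNormBounds K] [IsUltrametricDist K]

theorem norm_one_add_mulVec {D : Matrix (Fin n) (Fin n) K} (hD : ∀ i j, ‖D i j‖ ≤ 1 / 2)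
    (v : Fin n → K) : ‖(1 + D) *ᵥ v‖ = ‖v‖ := by
  have h := norm_mulVec_le (by norm_num) hD v
  rw [Matrix.add_mulVec, Matrix.one_mulVec]
  rcases eq_or_ne v 0 with rfl | hv
  · simp
  have hv' := norm_pos_iff.2 hv
  have h1 : ∀ w : Fin n → K, nrm 1 0 w = ‖w‖ := by
    intro w
    rw [nrm, wnorm]
    simp only [inv_one, Units.val_one, Matrix.one_mulVec, Pi.zero_apply, Real.rpow_zero, mul_one]
    simp [Pi.norm_def]
  rw [← h1, ← h1 v]
  apply nrm_add_eq_of_lt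
  rw [h1, h1]
  linarith

/-- The norm is locally constant in `A`: `D w` is strictly shorter than `w`, so adding it does not
change the length. The two factors `C` in the bound for `D` pay for passing to the sup norm and
back. -/
theorem exists_nrm_eq_of_close (A₀ : GL (Fin n) K) (x : Fin n → ℝ) :
    ∃ ρ > 0, ∀ (A : GL (Fin n) K) (D : Matrix (Fin n) (Fin n) K),
      (A : Matrix (Fin n) (Fin n) K) = (1 + D) * A₀ → (∀ i j, ‖D i j‖ < ρ) →
      ∀ u, nrm A x u = nrm A₀ x u := by
  obtain ⟨C, hC1, hC⟩ := exists_nrm_bounds A₀ x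
  refine ⟨1 / (2 * C ^ 2), by positivity, fun A D hA hD u => ?_⟩
  obtain ⟨v, rfl⟩ : ∃ v, (A : Matrix (Fin n) (Fin n) K) *ᵥ v = u := ⟨_, mulVec_inv_mulVec A u⟩
  rw [nrm_mulVec, hA, ← Matrix.mulVec_mulVec, ← nrm_mulVec A₀]
  set w := (A₀ : Matrix (Fin n) (Fin n) K) *ᵥ v
  rw [Matrix.add_mulVec, Matrix.one_mulVec]
  rcases eq_or_ne w 0 with hw | hw
  · simp [hw]
  · refine (nrm_add_eq_of_lt ?_).symm
    have h1 := norm_mulVec_le (by positivity) (fun i j => (hD i j).le) w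
    have hpos : 0 < nrm A₀ x w := nrm_pos hw
    calc nrm A₀ x (D *ᵥ w) ≤ C * ‖D *ᵥ w‖ := (hC _).1
      _ ≤ C * (1 / (2 * C ^ 2) * (C * nrm A₀ x w)) := by
          refine mul_le_mul_of_nonneg_left (h1.trans ?_) (by positivity)
          exact mul_le_mul_of_nonneg_left (hC w).2 (by positivity)
      _ = nrm A₀ x w / 2 := by field_simp
      _ < nrm A₀ x w := by linarith

theorem abs_log_nrm_sub_le {A : GL (Fin n) K} {x y : Fin n → ℝ} {τ : ℝ}
    (h : ∀ i, |x i - y i| ≤ τ) {u : Fin n → K} (hu : u ≠ 0) :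
    |Real.log (nrm A x u) - Real.log (nrm A y u)| ≤ τ * -Real.log (primeNorm K) := by
  have key : ∀ x y : Fin n → ℝ, (∀ i, |x i - y i| ≤ τ) →
      Real.log (nrm A y u) ≤ -τ * Real.log (primeNorm K) + Real.log (nrm A x u) := by
    intro x y h
    have h1 : nrm A y u ≤ primeNorm K ^ (-τ) * nrm A x u :=
      wnorm_le_of_support fun i _ => by linarith [(abs_le.1 (h i)).2]
    have h2 := Real.log_le_log (nrm_pos hu) h1
    rwa [Real.log_mul (primeNorm_rpow_pos K _).ne' (nrm_pos hu).ne',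
      Real.log_rpow (primeNorm_pos K)] at h2
  have h1 := key x y h
  have h2 := key y x fun i => by rw [abs_sub_comm]; exact h i
  rw [abs_le]
  constructor <;> linarith

theorem nearSet_mem_nhds_inl (B : InvScalarProduct n) (hη : 0 < η) {A₀ : GL (Fin n) K}
    {x₀ : Fin n → ℝ} (h : IsNearInterior P k ε η (nrm A₀ x₀)) :
    nearSet P k ε η ∈ @nhds _ (@instTopologicalSpaceProd _ _ pglTopology (aptBarTopology B))
      (ProjGenLinGroup.mk A₀, Sum.inl (Apt.mk x₀)) := by
  let _ := aptBarTopology B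
  obtain ⟨τ, hτ, H⟩ := h.exists_of_close hη
  obtain ⟨ρ, hρ, hA₀⟩ := exists_nrm_eq_of_close A₀ x₀
  have hL : 0 < -Real.log (primeNorm K) :=
    neg_pos.2 (Real.log_neg (primeNorm_pos K) (primeNorm_lt_one K))
  have h1 : Sum.inl '' {a | ∃ x, Apt.mk x = a ∧ ∀ i, |x i - x₀ i| <
      τ / -Real.log (primeNorm K)} ∈ 𝓝 (Sum.inl (Apt.mk x₀) : AptBar n) := by
    obtain ⟨u, hu, huo, hxu⟩ := mem_nhds_iff.1 (apt_mem_nhds x₀ (div_pos hτ hL))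
    have : IsOpen (Sum.inl '' u : Set (AptBar n)) :=
      TopologicalSpace.isOpen_generateFrom_of_mem (Or.inl ⟨u, huo, rfl⟩)
    exact Filter.mem_of_superset (this.mem_nhds ⟨_, hxu, rfl⟩) (Set.image_mono hu)
  refine Filter.mem_of_superset (prod_mem_nhds (pgl_mem_nhds A₀ hρ) h1) ?_
  rintro ⟨g, a⟩ ⟨⟨A, D, rfl, hA, hD⟩, ⟨_, ⟨x, rfl, hx⟩, rfl⟩⟩
  refine ⟨A, x, rfl, rfl, H _ ⟨0, fun u hu => ?_⟩⟩
  rw [← hA₀ A D hA hD, sub_zero]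
  refine (abs_log_nrm_sub_le (fun i => (hx i).le) hu).trans ?_
  rw [div_mul_cancel₀ _ hL.ne']

/-- Two-sided bounds for the stretching factor, in terms of the support of the coordinates. -/
theorem exists_le_stretch_le [NeZero n] {A : GL (Fin n) K} {C : ℝ} (hC : 1 ≤ C)
    (hA : ∀ v : Fin n → K, ‖(A : Matrix (Fin n) (Fin n) K) *ᵥ v‖ ≤ C * ‖v‖ ∧
      ‖v‖ ≤ C * ‖(A : Matrix (Fin n) (Fin n) K) *ᵥ v‖) (x : Fin n → ℝ) {u : Fin n → K}
    (hu : u ≠ 0) : ∃ i j, ((↑A⁻¹ : Matrix (Fin n) (Fin n) K) *ᵥ u) i ≠ 0 ∧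
      ((↑A⁻¹ : Matrix (Fin n) (Fin n) K) *ᵥ u) j ≠ 0 ∧
      Real.log (primeNorm K) * x i - Real.log C ≤ stretch (nrm A x) u ∧
      stretch (nrm A x) u ≤ Real.log (primeNorm K) * x j + Real.log C := by
  set v := (↑A⁻¹ : Matrix (Fin n) (Fin n) K) *ᵥ u with hv
  have hAv : (A : Matrix (Fin n) (Fin n) K) *ᵥ v = u := mulVec_inv_mulVec A u
  have hv0 : v ≠ 0 := by rintro h0; rw [h0, Matrix.mulVec_zero] at hAv; exact hu hAv.symm
  have hvp := norm_pos_iff.2 hv0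
  have hup := norm_pos_iff.2 hu
  have hCp : 0 < C := by linarith
  have hb := hA v
  rw [hAv] at hb
  obtain ⟨j, hj⟩ := exists_eq_wnorm x v
  obtain ⟨i, hi⟩ : ∃ i, ‖v i‖ = ‖v‖ := by
    obtain ⟨i, -, hi⟩ := Finset.exists_max_image (Finset.univ : Finset (Fin n))
      (fun i => ‖v i‖) ⟨0, Finset.mem_univ _⟩
    exact ⟨i, le_antisymm (norm_le_pi_norm v i)
      ((pi_norm_le_iff_of_nonneg (norm_nonneg _)).2 fun k => hi k (Finset.mem_univ _))⟩
  have hN : nrm A x u = wnorm x v := rfl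
  have hwp : 0 < wnorm x v := wnorm_pos hv0
  have hj0 : v j ≠ 0 := by
    rintro h0
    rw [h0, norm_zero, zero_mul] at hj
    exact hwp.ne' hj
  refine ⟨i, j, fun h0 => ?_, hj0, ?_, ?_⟩
  · rw [h0, norm_zero] at hi
    exact hvp.ne hi
  · have h1 := le_wnorm x v i
    rw [hi] at h1
    have h2 := Real.log_le_log (mul_pos hvp (primeNorm_rpow_pos K _)) h1
    have h3 := Real.log_le_log hup hb.1
    rw [Real.log_mul hvp.ne' (primeNorm_rpow_pos K _).ne', Real.log_rpow (primeNorm_pos K)] at h2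
    rw [Real.log_mul hCp.ne' hvp.ne'] at h3
    rw [stretch, hN]
    linarith
  · have h2 : Real.log (wnorm x v) = Real.log ‖v j‖ + x j * Real.log (primeNorm K) := by
      rw [hj, Real.log_mul (norm_pos_iff.2 hj0).ne' (primeNorm_rpow_pos K _).ne',
        Real.log_rpow (primeNorm_pos K)]
    have h3 := Real.log_le_log (norm_pos_iff.2 hj0) (norm_le_pi_norm v j)
    have h4 := Real.log_le_log hvp hb.2
    rw [Real.log_mul hCp.ne' hup.ne'] at h4
    rw [stretch, hN, h2]
    linarith

/-- These are finitely many linear inequalities that are strict on the limiting direction. Near that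
direction in `Ā` they hold with any prescribed margin `R` at the points of the apartment. -/
theorem eventually_forall_lt (B : InvScalarProduct n) (hn : 2 ≤ n) {x₀ : Fin n → ℝ}
    {c₀ : Module.Ray ℝ (Apt n)} (hx₀ : IsDir x₀ c₀) {J : Finset (Fin n)}
    (hJ : ∀ i j, (i ∈ J ∨ j ∉ J) → ∀ m ∈ J, ∀ l, l ∉ J → x₀ j - x₀ i < η * (x₀ m - x₀ l))
    (R : ℝ) :
    {z : AptBar n | z.elim (fun a => ∀ x, Apt.mk x = a → ∀ i j, (i ∈ J ∨ j ∉ J) → ∀ m ∈ J, ∀ l,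
        l ∉ J → x j - x i + R < η * (x m - x l))
      fun c => ∀ x, IsDir x c → ∀ i j, (i ∈ J ∨ j ∉ J) → ∀ m ∈ J, ∀ l,
        l ∉ J → x j - x i < η * (x m - x l)} ∈ @nhds _ (aptBarTopology B) (Sum.inr c₀) := by
  let _ := aptBarTopology B
  choose w hw using B.exists_form_eq_root hn
  have key : ∀ i j m l x, B.form (η • w m l - w j i) (Apt.mk x) = η * (x m - x l) - (x j - x i) := by
    intro i j m l x
    simp [hw]
  have h : ∀ i j m l, (i ∈ J ∨ j ∉ J) → m ∈ J → l ∉ J → ∀ᶠ z in 𝓝 (Sum.inr c₀ : AptBar n),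
      z.elim (fun x => R < B.form (η • w m l - w j i) x)
        fun e => 0 < B.form (η • w m l - w j i) e.someVector := by
    intro i j m l hij hm hl
    refine form_halfspace_mem_nhds B ?_ R
    obtain ⟨a, ha, hac⟩ := hx₀.exists_someVector
    rw [hac, map_smul, key, smul_eq_mul]
    exact mul_pos ha (sub_pos.2 (hJ i j hij m hm l hl))
  simp only [← Filter.eventually_all] at h
  refine Filter.mem_of_superset h ?_
  rintro (a | c) hz
  · rintro x rfl i j hij m hm l hl
    have := hz i j m l hij hm hl
    simp only [Sum.elim_inl, key] at this
    linarith
  · rintro x hx i j hij m hm l hl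
    have := hz i j m l hij hm hl
    obtain ⟨a, ha, hac⟩ := hx.exists_someVector
    simp only [Sum.elim_inr, hac, map_smul, key, smul_eq_mul] at this
    linarith [(pos_iff_pos_of_mul_pos this).1 ha]

/-- Small perturbations of `A₀` keep the sup norms of all `A v` and thus the constant `C`. At
interior points `U` and `U'` are the coordinate subspaces of `J` and its complement, and their
stretching is read off from the exponents up to `log C`. -/
theorem nearSet_mem_nhds_inr (B : InvScalarProduct n) (hn : 2 ≤ n) (hε : 0 < ε) (hη : 0 < η)
    {A₀ : GL (Fin n) K} {x₀ : Fin n → ℝ} {c₀ : Module.Ray ℝ (Apt n)} (hx₀ : IsDir x₀ c₀)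
    (h : IsNearBoundary P k ε η A₀ x₀) :
    nearSet P k ε η ∈ @nhds _ (@instTopologicalSpaceProd _ _ pglTopology (aptBarTopology B))
      (ProjGenLinGroup.mk A₀, Sum.inr c₀) := by
  let _ := aptBarTopology B
  have := neZero_of_two_le hn
  obtain ⟨J, hJk, hJ, hP⟩ := h
  obtain ⟨C, hC1, hC⟩ := exists_norm_mulVec_le A₀
  obtain ⟨Q, hQ, hPQ⟩ := exists_forall_norm_entry_le P
  have hL : 0 < -Real.log (primeNorm K) :=
    neg_pos.2 (Real.log_neg (primeNorm_pos K) (primeNorm_lt_one K))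
  -- The margin covers two errors `log C` on each side of the estimate, those on the right weighted
  -- by `η`, and leaves the slack `δ = 1`. The division changes the base of the logarithm.
  set R : ℝ := (2 * Real.log C * (1 + η) + 1) / -Real.log (primeNorm K) with hR
  have hρ : 0 < min (1 / 2) (ε / (2 * Q)) := by positivity
  refine Filter.mem_of_superset (prod_mem_nhds (pgl_mem_nhds A₀ hρ)
    (eventually_forall_lt B hn hx₀ hJ R)) ?_
  rintro ⟨g, a⟩ ⟨⟨A, D, rfl, hA, hD⟩, ha⟩
  have hD2 : ∀ i j, ‖D i j‖ ≤ 1 / 2 := fun i j => (hD i j).le.trans (min_le_left _ _)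
  have hAv : ∀ v, (A : Matrix (Fin n) (Fin n) K) *ᵥ v =
      (1 + D) *ᵥ ((A₀ : Matrix (Fin n) (Fin n) K) *ᵥ v) := by
    intro v
    rw [hA, Matrix.mulVec_mulVec]
  have hnorm : ∀ v, ‖(A : Matrix (Fin n) (Fin n) K) *ᵥ v‖ =
      ‖(A₀ : Matrix (Fin n) (Fin n) K) *ᵥ v‖ := fun v => by
    rw [hAv, norm_one_add_mulVec hD2]
  have hcone : ∀ v ∈ coordSpan K J, v ≠ 0 → ‖P *ᵥ ((A : Matrix (Fin n) (Fin n) K) *ᵥ v)‖ <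
      ε * ‖(A : Matrix (Fin n) (Fin n) K) *ᵥ v‖ := by
    intro v hv hv0
    have h1 := hP v hv hv0
    set w := (A₀ : Matrix (Fin n) (Fin n) K) *ᵥ v with hw
    rw [hnorm, hAv, Matrix.add_mulVec, Matrix.one_mulVec, Matrix.mulVec_add]
    have hwp : 0 < ‖w‖ := norm_pos_iff.2 fun h0 => hv0 (by
      rw [← inv_mulVec_mulVec A₀ v, ← hw, h0, Matrix.mulVec_zero])
    have h2 : ‖P *ᵥ (D *ᵥ w)‖ < ε * ‖w‖ := by
      calc ‖P *ᵥ (D *ᵥ w)‖ ≤ Q * ‖D *ᵥ w‖ := norm_mulVec_le hQ.le hPQ _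
        _ ≤ Q * (ε / (2 * Q) * ‖w‖) := mul_le_mul_of_nonneg_left (norm_mulVec_le (by positivity)
            (fun i j => (hD i j).le.trans (min_le_right _ _)) w) hQ.le
        _ = ε * ‖w‖ / 2 := by field_simp
        _ < ε * ‖w‖ := by linarith [mul_pos hε hwp]
    exact (IsUltrametricDist.norm_add_le_max _ _).trans_lt (max_lt h1 h2)
  obtain a | c := a
  · obtain ⟨x, rfl⟩ := Apt.mk_surjective a
    refine ⟨A, x, rfl, rfl, ?_⟩
    have hx := ha x rfl
    let U := (coordSpan K J).comap (Matrix.mulVecLin (↑A⁻¹ : Matrix (Fin n) (Fin n) K))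
    let U' := (coordSpan K Jᶜ).comap (Matrix.mulVecLin (↑A⁻¹ : Matrix (Fin n) (Fin n) K))
    have hU : IsImageCoordSpan U A J := fun u => Iff.rfl
    have hU' : IsImageCoordSpan U' A Jᶜ := fun u => Iff.rfl
    refine ⟨U, U', by rw [hU.finrank_eq, hJk], ?_, ?_, 1, one_pos, ?_⟩
    · rw [hU'.finrank_eq, ← hJk, Finset.card_compl, Fintype.card_fin]
      exact Nat.sub_add_cancel (by simpa using J.card_le_univ)
    · intro u hu hu0
      have := hcone _ hu fun h0 => hu0 (by
        rw [← mulVec_inv_mulVec A u]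
        exact (congrArg _ h0).trans (Matrix.mulVec_zero _))
      simpa using this
    · intro u hu u' hu' w hw w' hw' v hu0 hu0' hw0 hw0' hv0
      have hCA : ∀ v : Fin n → K, ‖(A : Matrix (Fin n) (Fin n) K) *ᵥ v‖ ≤ C * ‖v‖ ∧
          ‖v‖ ≤ C * ‖(A : Matrix (Fin n) (Fin n) K) *ᵥ v‖ := by
        intro v
        rw [hnorm]
        exact hC v
      have hs : ∀ z ∈ U, ∀ i, ((↑A⁻¹ : Matrix (Fin n) (Fin n) K) *ᵥ z) i ≠ 0 → i ∈ J :=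
        fun z hz i hi => by_contra fun h0 => hi (mem_coordSpan.1 hz i h0)
      have hs' : ∀ z ∈ U', ∀ i, ((↑A⁻¹ : Matrix (Fin n) (Fin n) K) *ᵥ z) i ≠ 0 → i ∉ J :=
        fun z hz i hi h0 => hi (mem_coordSpan.1 hz i (by simpa using h0))
      obtain ⟨-, j₁, -, hj₁, -, h₁⟩ := exists_le_stretch_le hC1 hCA x hu0
      obtain ⟨i₂, -, hi₂, -, h₂, -⟩ := exists_le_stretch_le hC1 hCA x hu0'
      obtain ⟨-, j₃, -, hj₃, -, h₃⟩ := exists_le_stretch_le hC1 hCA x hw0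
      obtain ⟨i₄, -, hi₄, -, h₄, -⟩ := exists_le_stretch_le hC1 hCA x hw0'
      obtain ⟨i₅, j₅, -, -, h₅, h₅'⟩ := exists_le_stretch_le hC1 hCA x hv0
      have hRL : R * -Real.log (primeNorm K) = 2 * Real.log C * (1 + η) + 1 := by
        rw [hR, div_mul_cancel₀ _ hL.ne']
      have h6 : η * (Real.log (primeNorm K) * x i₄ - Real.log C -
          (Real.log (primeNorm K) * x j₃ + Real.log C)) ≤
          η * (stretch (nrm A x) w' - stretch (nrm A x) w) :=
        mul_le_mul_of_nonneg_left (by linarith) hη.le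
      constructor
      · have h7 := mul_lt_mul_of_pos_right
          (hx j₁ i₅ (Or.inl (hs u hu _ hj₁)) j₃ (hs w hw _ hj₃) i₄ (hs' w' hw' _ hi₄)) hL
        nlinarith
      · have h7 := mul_lt_mul_of_pos_right
          (hx j₅ i₂ (Or.inr (hs' u' hu' _ hi₂)) j₃ (hs w hw _ hj₃) i₄ (hs' w' hw' _ hi₄)) hL
        nlinarith
  · obtain ⟨x, hx⟩ := exists_isDir c
    exact ⟨A, x, rfl, hx, J, hJk, ha x hx, hcone⟩

theorem isOpen_nearSet (B : InvScalarProduct n) (hn : 2 ≤ n) (hε : 0 < ε) (hη : 0 < η) :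
    @IsOpen _ (@instTopologicalSpaceProd _ _ pglTopology (aptBarTopology B))
      (nearSet P k ε η) := by
  let _ := aptBarTopology B
  rw [isOpen_iff_mem_nhds]
  rintro ⟨g, a | c⟩ h
  · obtain ⟨A, x, rfl, rfl, h⟩ := h
    exact nearSet_mem_nhds_inl B hη h
  · obtain ⟨A, x, rfl, hx, h⟩ := h
    exact nearSet_mem_nhds_inr B hn hε hη hx h

/-- Points that converge to a vertex of the boundary are eventually near it. -/
theorem eventually_isNearInterior (B : InvScalarProduct n) (hn : 2 ≤ n) {γ : ℝ → XBar n K}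
    {F : Filter ℝ} {W : Submodule K (Fin n → K)} {A : GL (Fin n) K} {I : Finset (Fin n)}
    {c : Module.Ray ℝ (Apt n)} (hA : IsImageCoordSpan W A I) (hc : IsDir (ind I) c)
    (hγ : Tendsto γ F (@nhds _ (xBarTopology B) (XBar.mk (ProjGenLinGroup.mk A) (Sum.inr c))))
    (hP : ∀ u ∈ W, P *ᵥ u = 0) (hε : 0 < ε) (hη : 0 < η) :
    ∀ᶠ t in F, ∀ A' x', γ t = XBar.mk (ProjGenLinGroup.mk A') (Sum.inl (Apt.mk x')) →
      IsNearInterior P (Module.finrank K W) ε η (nrm A' x') := by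
  have hk : 0 < Module.finrank K W := by
    rw [hA.finrank_eq, Finset.card_pos, Finset.nonempty_iff_ne_empty]
    exact (mk_ind_ne_zero_iff.1 hc.1).1
  let _ := xBarTopology (K := K) B
  let S : Set (XBar n K) := {z | ∃ p ∈ nearSet P (Module.finrank K W) ε η, z = XBar.mk p.1 p.2}
  have hS : IsOpen S := by
    refine isOpen_coinduced.2 ?_
    convert isOpen_nearSet (P := P) (k := Module.finrank K W) B hn hε hη using 1
    ext p
    constructor
    · rintro ⟨q, hq, e⟩
      exact mem_nearSet_of_sameInvariants hη hk hq (sameInvariants_of_mk_eq e.symm)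
    · exact fun h => ⟨p, h, rfl⟩
  have hmem : XBar.mk (ProjGenLinGroup.mk A) (Sum.inr c) ∈ S := by
    refine ⟨(ProjGenLinGroup.mk A, Sum.inr c), ⟨A, ind I, rfl, hc, I, hA.finrank_eq.symm, ?_, ?_⟩, rfl⟩
    · intro i j hij m hm l hl
      rw [ind_of_mem hm, ind_of_notMem hl]
      have h01 : ∀ i, 0 ≤ ind I i ∧ ind I i ≤ 1 := fun i => by
        rw [ind]; split_ifs <;> norm_num
      rcases hij with h | h
      · rw [ind_of_mem h]; linarith [h01 j]
      · rw [ind_of_notMem h]; linarith [h01 i]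
    · intro v hv hv0
      have h0 : (A : Matrix (Fin n) (Fin n) K) *ᵥ v ≠ 0 := fun h0 => hv0 (by
        rw [← inv_mulVec_mulVec A v, h0, Matrix.mulVec_zero])
      rw [hP _ ((hA _).2 (by rwa [inv_mulVec_mulVec])), norm_zero]
      exact mul_pos hε (norm_pos_iff.2 h0)
  filter_upwards [hγ.eventually (hS.mem_nhds hmem)] with t ht A' x' e
  obtain ⟨p, hp, hpe⟩ := ht
  obtain ⟨A'', x'', h1, h2, hN⟩ := mem_nearSet_of_sameInvariants hη hk hp
    (sameInvariants_of_mk_eq (hpe.symm.trans e))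
  obtain ⟨r, hr⟩ := nrm_eq_of_mk_eq h1 h2
  obtain ⟨τ, hτ, H⟩ := hN.exists_of_close hη
  refine H _ ⟨Real.log (primeNorm K ^ r), fun u hu => ?_⟩
  rw [hr, Real.log_mul (primeNorm_rpow_pos K r).ne' (nrm_pos hu).ne']
  simpa using hτ.le

end Ultra

end

end BTBuilding

namespace BTBuilding

noncomputable section

set_option linter.unusedSectionVars false

/-! ### The direction of a geodesic that converges to a vertex of the boundary -/

variable {n : ℕ} {K : Type*} [NormedField K]

theorem exists_ne_zero_mem_of_finrank {U S : Submodule K (Fin n → K)}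
    (h : n < Module.finrank K U + Module.finrank K S) : ∃ u ∈ U, u ∈ S ∧ u ≠ 0 := by
  by_contra! hc
  have hd : Disjoint U S := by
    rw [Submodule.disjoint_def]
    exact hc
  have h1 := Submodule.finrank_add_finrank_le_of_disjoint hd
  rw [Module.finrank_fin_fun] at h1
  omega

theorem exists_top_set (e : Fin n → ℝ) {k : ℕ} (hk : k ≤ n) :
    ∃ J : Finset (Fin n), J.card = k ∧ ∀ i ∈ J, ∀ j, j ∉ J → e j ≤ e i := by
  obtain ⟨σ, hσ⟩ := exists_antitone_perm e
  refine ⟨(Finset.univ.filter fun j : Fin n => (j : ℕ) < k).map σ.toEmbedding, ?_, ?_⟩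
  · rw [Finset.card_map, Fin.card_filter_val_lt]
    exact min_eq_right hk
  · intro i hi j hj
    obtain ⟨i, rfl⟩ := σ.surjective i
    obtain ⟨j, rfl⟩ := σ.surjective j
    simp only [Finset.mem_map_equiv, Equiv.symm_apply_apply, Finset.mem_filter, Finset.mem_univ,
      true_and, not_lt] at hi hj
    exact hσ (Fin.le_def.2 (by omega))

section Prime

variable [PrimeNormBounds K]

theorem stretch_add_le {A : GL (Fin n) K} {x e : Fin n → ℝ} {r : ℝ} {u : Fin n → K} (hu : u ≠ 0)
    (h : ∀ i, ((↑A⁻¹ : Matrix (Fin n) (Fin n) K) *ᵥ u) i ≠ 0 → r ≤ e i) :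
    stretch (nrm A (x + e)) u ≤ stretch (nrm A x) u + r * Real.log (primeNorm K) := by
  have h1 : nrm A (x + e) u ≤ primeNorm K ^ r * nrm A x u :=
    wnorm_le_of_support fun i hi => by simpa using h i hi
  have h2 := Real.log_le_log (nrm_pos hu) h1
  rw [Real.log_mul (primeNorm_rpow_pos K _).ne' (nrm_pos hu).ne',
    Real.log_rpow (primeNorm_pos K)] at h2
  rw [stretch, stretch]
  linarith

theorem le_stretch_add {A : GL (Fin n) K} {x e : Fin n → ℝ} {r : ℝ} {u : Fin n → K} (hu : u ≠ 0)
    (h : ∀ i, ((↑A⁻¹ : Matrix (Fin n) (Fin n) K) *ᵥ u) i ≠ 0 → e i ≤ r) :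
    stretch (nrm A x) u + r * Real.log (primeNorm K) ≤ stretch (nrm A (x + e)) u := by
  have h1 : primeNorm K ^ r * nrm A x u ≤ nrm A (x + e) u :=
    le_wnorm_of_support fun i hi => by simpa using h i hi
  have h2 := Real.log_le_log (mul_pos (primeNorm_rpow_pos K _) (nrm_pos hu)) h1
  rw [Real.log_mul (primeNorm_rpow_pos K _).ne' (nrm_pos hu).ne',
    Real.log_rpow (primeNorm_pos K)] at h2
  rw [stretch, stretch]
  linarith

/-- A norm that is obtained from a bounded one by stretching with exponents `e` and that is close
to a vertex of the boundary: the `k` largest exponents and the remaining ones are nearly equal. -/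
theorem IsNearInterior.spread_le {P : Matrix (Fin n) (Fin n) K} {k : ℕ} {ε η : ℝ}
    {A : GL (Fin n) K} {x e : Fin n → ℝ} (hN : IsNearInterior P k ε η (nrm A (x + e)))
    (hη : 0 < η) (hk : 0 < k) (hkn : k < n) {c ρ : ℝ}
    (hc : ∀ u, u ≠ 0 → |stretch (nrm A x) u - ρ| ≤ c) {J : Finset (Fin n)} (hJk : J.card = k)
    (hJ : ∀ i ∈ J, ∀ j, j ∉ J → e j ≤ e i) {S : ℝ} (hS : ∀ i j, e i - e j ≤ S) (i j : Fin n)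
    (hij : i ∈ J ∨ j ∉ J) :
    -Real.log (primeNorm K) * (e j - e i) ≤ 2 * c + η * (-Real.log (primeNorm K) * S + 2 * c) := by
  have hL : 0 < -Real.log (primeNorm K) :=
    neg_pos.2 (Real.log_neg (primeNorm_pos K) (primeNorm_lt_one K))
  obtain ⟨U, U', hU, hU', -, δ, hδ, H⟩ := hN
  have hup : ∀ u : Fin n → K, u ≠ 0 → ∀ r, (∀ i, ((↑A⁻¹ : Matrix (Fin n) (Fin n) K) *ᵥ u) i ≠ 0 →
      r ≤ e i) → stretch (nrm A (x + e)) u ≤ ρ + c + r * Real.log (primeNorm K) := by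
    intro u hu r h
    have := (abs_le.1 (hc u hu)).2
    linarith [stretch_add_le (x := x) hu h]
  have hlo : ∀ u : Fin n → K, u ≠ 0 → ∀ r, (∀ i, ((↑A⁻¹ : Matrix (Fin n) (Fin n) K) *ᵥ u) i ≠ 0 →
      e i ≤ r) → ρ - c + r * Real.log (primeNorm K) ≤ stretch (nrm A (x + e)) u := by
    intro u hu r h
    have := (abs_le.1 (hc u hu)).1
    linarith [le_stretch_add (x := x) hu h]
  have hgap : ∀ w w' : Fin n → K, w ≠ 0 → w' ≠ 0 →
      η * (stretch (nrm A (x + e)) w' - stretch (nrm A (x + e)) w) ≤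
        η * (-Real.log (primeNorm K) * S + 2 * c) := by
    intro w w' hw hw'
    have := neZero_of_two_le (show 2 ≤ n by omega)
    obtain ⟨i₁, h₁⟩ := Finite.exists_max e
    obtain ⟨i₂, h₂⟩ := Finite.exists_min e
    have h3 := hup w' hw' (e i₂) fun i _ => h₂ i
    have h4 := hlo w hw (e i₁) fun i _ => h₁ i
    have h5 := mul_le_mul_of_nonneg_left (hS i₁ i₂) hL.le
    exact mul_le_mul_of_nonneg_left (by linarith) hη.le
  have hspan : ∀ I : Finset (Fin n), ∃ S : Submodule K (Fin n → K), Module.finrank K S = I.card ∧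
      ∀ u ∈ S, ∀ i, ((↑A⁻¹ : Matrix (Fin n) (Fin n) K) *ᵥ u) i ≠ 0 → i ∈ I := by
    intro I
    have hI : IsImageCoordSpan ((coordSpan K I).comap
      (Matrix.mulVecLin (↑A⁻¹ : Matrix (Fin n) (Fin n) K))) A I := fun u => Iff.rfl
    exact ⟨_, hI.finrank_eq, fun u hu i hi => by_contra fun h0 => hi (mem_coordSpan.1 hu i h0)⟩
  have hJc : Jᶜ.card = n - k := by rw [Finset.card_compl, hJk, Fintype.card_fin]
  obtain ⟨w, hw, hw0⟩ : ∃ w ∈ U, w ≠ 0 := Submodule.exists_mem_ne_zero_of_ne_bot (by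
    rintro rfl; simp at hU; omega)
  obtain ⟨w', hw', hw0'⟩ : ∃ w ∈ U', w ≠ 0 := Submodule.exists_mem_ne_zero_of_ne_bot (by
    rintro rfl; simp at hU'; omega)
  have hsingle : ∀ i : Fin n, (A : Matrix (Fin n) (Fin n) K) *ᵥ Pi.single i 1 ≠ 0 ∧
      ∀ l, ((↑A⁻¹ : Matrix (Fin n) (Fin n) K) *ᵥ
        ((A : Matrix (Fin n) (Fin n) K) *ᵥ (Pi.single i 1 : Fin n → K))) l ≠ 0 → l = i := by
    intro i
    constructor
    · intro h0
      have h1 := inv_mulVec_mulVec A (Pi.single i 1 : Fin n → K)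
      rw [h0, Matrix.mulVec_zero] at h1
      have := congrFun h1 i
      simp at this
    · intro l hl
      rw [inv_mulVec_mulVec] at hl
      by_contra h0
      exact hl (by simp [h0])
  rcases hij with hi | hj
  -- `U` has dimension `k` and `T` has dimension `n - k + 1`, so they meet. On a common vector all
  -- exponents are at most `e i`, so it bounds from below the nearly minimal stretching on `U`,
  -- which is then compared with the `j`-th basis vector.
  · obtain ⟨T, hT, hTs⟩ := hspan (insert i Jᶜ)
    rw [Finset.card_insert_of_notMem (by simpa using hi), hJc] at hT
    obtain ⟨u, hu, huT, hu0⟩ := exists_ne_zero_mem_of_finrank (U := U) (S := T) (by omega)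
    have h1 := hlo u hu0 (e i) fun l hl => by
      rcases Finset.mem_insert.1 (hTs u huT l hl) with rfl | h
      · exact le_rfl
      · exact hJ i hi l (by simpa using h)
    obtain ⟨hv0, hv⟩ := hsingle j
    have h2 := hup _ hv0 (e j) fun l hl => (congrArg e (hv l hl)).ge
    have h3 := (H u hu w' hw' w hw w' hw' _ hu0 hw0' hw0 hw0' hv0).1
    have h4 := hgap w w' hw0 hw0'
    linarith
  · obtain ⟨T, hT, hTs⟩ := hspan (insert j J)
    rw [Finset.card_insert_of_notMem hj, hJk] at hT
    obtain ⟨u, hu, huT, hu0⟩ := exists_ne_zero_mem_of_finrank (U := U') (S := T) (by omega)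
    have h1 := hup u hu0 (e j) fun l hl => by
      rcases Finset.mem_insert.1 (hTs u huT l hl) with rfl | h
      · exact le_rfl
      · exact hJ l h j hj
    obtain ⟨hv0, hv⟩ := hsingle i
    have h2 := hlo _ hv0 (e i) fun l hl => (congrArg e (hv l hl)).le
    have h3 := (H w hw u hu w hw w' hw' _ hw0 hu0 hw0 hw0' hv0).2
    have h4 := hgap w w' hw0 hw0'
    linarith

end Prime

variable [PrimeNormBounds K] [IsUltrametricDist K]

theorem abs_stretch_le {A : GL (Fin n) K} {x : Fin n → ℝ} {C : ℝ} (hC1 : 1 ≤ C)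
    (hC : ∀ v : Fin n → K, nrm A x v ≤ C * ‖v‖ ∧ ‖v‖ ≤ C * nrm A x v) {u : Fin n → K}
    (hu : u ≠ 0) : |stretch (nrm A x) u| ≤ Real.log C := by
  have hCp : 0 < C := by linarith
  have hup := norm_pos_iff.2 hu
  have hNp := nrm_pos (A := A) (x := x) hu
  have h1 := Real.log_le_log hNp (hC u).1
  have h2 := Real.log_le_log hup (hC u).2
  rw [Real.log_mul hCp.ne' hup.ne'] at h1
  rw [Real.log_mul hCp.ne' hNp.ne'] at h2
  rw [stretch, abs_le]
  constructor <;> linarith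

/-- For `T > t` the equality case of the triangle inequality makes the difference from `γ s` to `γ
T` a permuted multiple of `d`, up to a constant vector, with factor `m = (T - s) / (t - s)`.
Closeness to the vertex bounds the deviation from being two-valued by a small multiple of `m` plus a
constant. Dividing by `m` and letting `T` grow leaves no deviation for `d`. -/
theorem IsGeodesic.exists_two_valued (hn : 2 ≤ n) {B : InvScalarProduct n}
    {γ : ℝ → building n K} (hγ : IsGeodesic B γ) {W : Submodule K (Fin n → K)}
    {A₀ : GL (Fin n) K} {I : Finset (Fin n)} {c₀ : Module.Ray ℝ (Apt n)}
    (hA₀ : IsImageCoordSpan W A₀ I) (hc₀ : IsDir (ind I) c₀)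
    (hlim : Tendsto (fun t => (γ t : XBar n K)) atTop
      (@nhds _ (xBarTopology B) (XBar.mk (ProjGenLinGroup.mk A₀) (Sum.inr c₀))))
    {s t : ℝ} (hst : s < t) {A : GL (Fin n) K} {x y : Fin n → ℝ}
    (hx : (γ s : XBar n K) = XBar.mk (ProjGenLinGroup.mk A) (Sum.inl (Apt.mk x)))
    (hy : (γ t : XBar n K) = XBar.mk (ProjGenLinGroup.mk A) (Sum.inl (Apt.mk y))) :
    ∃ J : Finset (Fin n), J.card = Module.finrank K W ∧
      ∀ i j, (i ∈ J ∨ j ∉ J) → (y - x) j ≤ (y - x) i := by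
  obtain ⟨hI₀, hI₁⟩ := mk_ind_ne_zero_iff.1 hc₀.1
  have hk : 0 < Module.finrank K W := by
    rw [hA₀.finrank_eq, Finset.card_pos, Finset.nonempty_iff_ne_empty]
    exact hI₀
  have hkn : Module.finrank K W < n := by
    rw [hA₀.finrank_eq]
    have := (Finset.card_lt_iff_ne_univ I).2 hI₁
    rwa [Fintype.card_fin] at this
  have hL : 0 < -Real.log (primeNorm K) :=
    neg_pos.2 (Real.log_neg (primeNorm_pos K) (primeNorm_lt_one K))
  set L := -Real.log (primeNorm K) with hLdef
  set d := y - x with hd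
  obtain ⟨J, hJk, hJ⟩ := exists_top_set d hkn.le
  refine ⟨J, hJk, fun i j hij => ?_⟩
  by_contra! hlt
  obtain ⟨C, hC1, hC⟩ := exists_nrm_bounds A x
  have hlogC : 0 ≤ Real.log C := Real.log_nonneg hC1
  obtain ⟨S, hS⟩ : ∃ S : ℝ, ∀ i j, d i - d j ≤ S := by
    obtain ⟨S, hS⟩ := (Set.finite_range fun p : Fin n × Fin n => d p.1 - d p.2).bddAbove
    exact ⟨S, fun i j => hS ⟨(i, j), rfl⟩⟩
  have hS0 : 0 ≤ S := by simpa using hS i i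
  set g := L * (d j - d i) with hg
  have hgp : 0 < g := mul_pos hL (sub_pos.2 hlt)
  -- With this `η`, a deviation `g > 0` would give `m g ≤ m g / 2 + 4 log C`. The choice of `T`
  -- below makes `m > 8 log C / g`, a contradiction.
  set η : ℝ := min 1 (g / (2 * (L * S + 1))) with hη
  have hηp : 0 < η := by positivity
  have hηS : η * (L * S) ≤ g / 2 := by
    calc η * (L * S) ≤ g / (2 * (L * S + 1)) * (L * S + 1) :=
          mul_le_mul (min_le_right _ _) (by linarith) (by positivity) (by positivity)
      _ = g / 2 := by field_simp
  have hnear := eventually_isNearInterior (P := 0) B hn hA₀ hc₀ hlim (fun u _ => by simp)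
    (ε := 1) one_pos hηp
  obtain ⟨T, hT, htT, hTbig⟩ := (hnear.and ((eventually_gt_atTop t).and
    (eventually_gt_atTop (s + (t - s) * (8 * Real.log C / g))))).exists
  have hts : 0 < t - s := sub_pos.2 hst
  have hTs : 0 < T - s := by linarith
  obtain ⟨A', y', z', hy', hz', hlen'⟩ := hγ.exists_apartment hn htT.ne
  obtain ⟨A'', x'', z'', hx'', hz'', hlen''⟩ := hγ.exists_apartment hn (hst.trans htT).ne
  have hlen : B.len (Apt.mk d) = t - s := by
    have h1 := bdDist_eq hn B hy hx
    rw [hγ t s, abs_of_pos hts] at h1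
    exact h1.symm
  obtain ⟨-, hpar⟩ := len_triangle hn B (y := y) (nrm_eq_of_xbar_eq (hx.symm.trans hx''))
    (nrm_eq_of_xbar_eq (hy.symm.trans hy')) (nrm_eq_of_xbar_eq (hz''.symm.trans hz'))
  rw [← hd, hlen, hlen', hlen'', abs_sub_comm, abs_of_pos hTs, abs_sub_comm,
    abs_of_pos (sub_pos.2 htT)] at hpar
  -- On a geodesic the lengths are differences of parameters, so the triangle inequality is an
  -- equality.
  obtain ⟨τ, hτ⟩ := hpar (by ring)
  rw [← Apt.mk_smul, ← Apt.mk_smul, Apt.mk_eq_mk_iff] at hτ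
  obtain ⟨r, hr⟩ := hτ
  set e := z'' - x'' with he
  set m := (T - s) / (t - s) with hm
  have hmp : 0 < m := div_pos hTs hts
  have hed : ∀ i, e (τ i) = m * d i - r / (t - s) := by
    intro i
    have := hr i
    simp only [Pi.smul_apply, smul_eq_mul, Function.comp_apply] at this
    rw [hm]
    field_simp
    linarith
  have hN : IsNearInterior 0 (Module.finrank K W) 1 η (nrm A'' (x'' + e)) := by
    have : x'' + e = z'' := by rw [he]; abel
    rw [this]
    exact hT A'' z'' hz''
  obtain ⟨ρ, hρ⟩ := nrm_eq_of_xbar_eq (hx.symm.trans hx'')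
  have hc : ∀ u, u ≠ 0 → |stretch (nrm A'' x'') u - ρ * Real.log (primeNorm K)| ≤ Real.log C := by
    intro u hu
    have := abs_stretch_le hC1 hC hu
    rw [stretch] at this
    rw [stretch, hρ, Real.log_mul (primeNorm_rpow_pos K _).ne' (nrm_pos hu).ne',
      Real.log_rpow (primeNorm_pos K)]
    convert this using 2
    ring
  have hfin := hN.spread_le hηp hk hkn hc (J := J.map τ.toEmbedding) (by rw [Finset.card_map, hJk])
    (S := m * S) ?_ ?_ (τ i) (τ j) (by simpa using hij)
  · rw [hed, hed, ← hLdef] at hfin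
    have h1 : L * (m * d j - r / (t - s) - (m * d i - r / (t - s))) = m * g := by
      rw [hg]; ring
    rw [h1] at hfin
    have h2 : η * (L * (m * S) + 2 * Real.log C) ≤ m * (g / 2) + 2 * Real.log C := by
      have h3 := mul_le_mul_of_nonneg_left hηS hmp.le
      have h4 := mul_le_mul_of_nonneg_right (min_le_left 1 (g / (2 * (L * S + 1)))) hlogC
      rw [← hη] at h4
      nlinarith
    have h5 : 8 * Real.log C / g < m := by
      rw [hm, lt_div_iff₀ hts]
      linarith
    rw [div_lt_iff₀ hgp] at h5
    linarith
  · intro p hp q hq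
    obtain ⟨p, rfl⟩ := τ.surjective p
    obtain ⟨q, rfl⟩ := τ.surjective q
    simp only [Finset.mem_map_equiv, Equiv.symm_apply_apply] at hp hq
    rw [hed, hed]
    have := mul_le_mul_of_nonneg_left (hJ p hp q hq) hmp.le
    linarith
  · intro p q
    obtain ⟨p, rfl⟩ := τ.surjective p
    obtain ⟨q, rfl⟩ := τ.surjective q
    rw [hed, hed]
    have := mul_le_mul_of_nonneg_left (hS p q) hmp.le
    linarith

end

end BTBuilding

namespace BTBuilding

noncomputable section

set_option linter.unusedSectionVars false

/-! ### Vertices that are connected by a geodesic -/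

variable {n : ℕ} {K : Type*} [NormedField K]

/-- The norm `N'` arises from `N` by stretching with the factor `μ` on one subspace and with the
factor `μ * q` on an orthogonal complement. -/
structure TwoValued (N N' : (Fin n → K) → ℝ) (μ q : ℝ) : Prop where
  pos : 0 < μ
  le : ∀ v, μ * N v ≤ N' v
  ge : ∀ v, N' v ≤ μ * q * N v
  exists_eq_min : ∃ a, a ≠ 0 ∧ N' a = μ * N a
  exists_eq_max : ∃ b, b ≠ 0 ∧ N' b = μ * q * N b
  exists_add : ∀ u, ∃ a b, u = a + b ∧ N' a = μ * N a ∧ N' b = μ * q * N b ∧ N a ≤ N u ∧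
    N b ≤ N u ∧ N' b ≤ N' u

/-- A vector of minimal total stretching shows `μ μ' ≤ μ''`, and one of maximal total stretching
shows the reverse. -/
theorem TwoValued.eq_mul {N₁ N₂ N₃ : (Fin n → K) → ℝ} {μ μ' μ'' q q' : ℝ} (hq : 0 < q)
    (hq' : 0 < q') (hN : ∀ v, v ≠ 0 → 0 < N₁ v) (h : TwoValued N₁ N₂ μ q)
    (h' : TwoValued N₂ N₃ μ' q') (h'' : TwoValued N₁ N₃ μ'' (q * q')) : μ'' = μ * μ' := by
  obtain ⟨a, ha, hae⟩ := h''.exists_eq_min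
  obtain ⟨b, hb, hbe⟩ := h''.exists_eq_max
  have h1 := mul_le_mul_of_nonneg_left (h.le a) h'.pos.le
  have h2 := h'.le a
  have h3 := mul_le_mul_of_nonneg_left (h.ge b) (mul_pos h'.pos hq').le
  have h4 := h'.ge b
  refine le_antisymm ?_ ?_
  · have : μ'' * (q * q' * N₁ b) ≤ μ * μ' * (q * q' * N₁ b) := by linarith
    exact le_of_mul_le_mul_right this (mul_pos (mul_pos hq hq') (hN b hb))
  · have : μ * μ' * N₁ a ≤ μ'' * N₁ a := by linarith
    exact le_of_mul_le_mul_right this (hN a ha)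

variable [PrimeNormBounds K] [IsUltrametricDist K]

theorem nrm_support_le (A : GL (Fin n) K) (x : Fin n → ℝ) (J : Finset (Fin n)) (u : Fin n → K) :
    nrm A x ((A : Matrix (Fin n) (Fin n) K) *ᵥ
      (fun i => if i ∈ J then ((↑A⁻¹ : Matrix (Fin n) (Fin n) K) *ᵥ u) i else 0)) ≤ nrm A x u := by
  rw [nrm_mulVec, wnorm_le_iff (nrm_nonneg _ _ _)]
  intro i
  split_ifs with h
  · exact le_wnorm _ _ i
  · rw [norm_zero, zero_mul]
    exact nrm_nonneg _ _ _

theorem twoValued_add (A : GL (Fin n) K) (x : Fin n → ℝ) {J : Finset (Fin n)} (hJ₀ : J ≠ ∅)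
    (hJ₁ : J ≠ Finset.univ) {α β : ℝ} {y : Fin n → ℝ} (hy : ∀ i, y i = x i + (α * ind J i + β))
    (hα : 0 ≤ α) : TwoValued (nrm A x) (nrm A y) (primeNorm K ^ (α + β)) (primeNorm K ^ (-α)) := by
  have hq : primeNorm K ^ (α + β) * primeNorm K ^ (-α) = primeNorm K ^ β := by
    rw [← primeNorm_rpow_add]
    congr 1
    ring
  have hmem : ∀ v : Fin n → K, (∀ i, v i ≠ 0 → i ∈ J) →
      wnorm y v = primeNorm K ^ (α + β) * wnorm x v := fun v hv =>
    le_antisymm (wnorm_le_of_support fun i hi => by rw [hy, ind_of_mem (hv i hi)]; linarith)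
      (le_wnorm_of_support fun i hi => by rw [hy, ind_of_mem (hv i hi)]; linarith)
  have hnot : ∀ v : Fin n → K, (∀ i, v i ≠ 0 → i ∉ J) →
      wnorm y v = primeNorm K ^ β * wnorm x v := fun v hv =>
    le_antisymm (wnorm_le_of_support fun i hi => by rw [hy, ind_of_notMem (hv i hi)]; linarith)
      (le_wnorm_of_support fun i hi => by rw [hy, ind_of_notMem (hv i hi)]; linarith)
  have h01 : ∀ i, 0 ≤ ind J i ∧ ind J i ≤ 1 := fun i => by rw [ind]; split_ifs <;> norm_num
  have hne : ∀ i, (A : Matrix (Fin n) (Fin n) K) *ᵥ Pi.single i 1 ≠ 0 := by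
    intro i h0
    have h1 := inv_mulVec_mulVec A (Pi.single i 1 : Fin n → K)
    rw [h0, Matrix.mulVec_zero] at h1
    simpa using congrFun h1 i
  refine ⟨primeNorm_rpow_pos K _, fun v => ?_, fun v => ?_, ?_, ?_, fun u => ?_⟩
  · refine le_wnorm_of_support fun i _ => ?_
    rw [hy]
    linarith [mul_le_mul_of_nonneg_left (h01 i).2 hα]
  · rw [hq]
    refine wnorm_le_of_support fun i _ => ?_
    rw [hy]
    linarith [mul_nonneg hα (h01 i).1]
  · obtain ⟨i, hi⟩ := Finset.nonempty_iff_ne_empty.2 hJ₀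
    refine ⟨_, hne i, ?_⟩
    rw [nrm_mulVec, nrm_mulVec]
    refine hmem _ fun l hl => ?_
    by_contra h0
    exact hl (by rw [Pi.single_apply, if_neg]; rintro rfl; exact h0 hi)
  · obtain ⟨i, hi⟩ : ∃ i, i ∉ J := by
      by_contra! h
      exact hJ₁ (Finset.eq_univ_iff_forall.2 h)
    refine ⟨_, hne i, ?_⟩
    rw [nrm_mulVec, nrm_mulVec, hq]
    refine hnot _ fun l hl h0 => ?_
    exact hl (by rw [Pi.single_apply, if_neg]; rintro rfl; exact hi h0)
  · have hle := fun z J => nrm_support_le A z J u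
    refine ⟨_, _, ?_, ?_, ?_, hle x J, hle x Jᶜ, hle y Jᶜ⟩
    · rw [← Matrix.mulVec_add, eq_comm]
      refine Eq.trans ?_ (mulVec_inv_mulVec A u)
      congr 1
      ext i
      by_cases h : i ∈ J <;> simp [h]
    · rw [nrm_mulVec, nrm_mulVec]
      exact hmem _ fun i hi => by by_contra h; exact hi (if_neg h)
    · rw [nrm_mulVec, nrm_mulVec, hq]
      exact hnot _ fun i hi => by
        intro h
        exact hi (if_neg (by simpa using h))

theorem TwoValued.of_smul {N N' M M' : (Fin n → K) → ℝ} {μ q r r' : ℝ} (h : TwoValued N N' μ q)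
    (hr : 0 < r) (hr' : 0 < r') (hM : ∀ u, M u = r * N u) (hM' : ∀ u, M' u = r' * N' u) :
    TwoValued M M' (r' * μ / r) q := by
  have e1 : ∀ u, r' * μ / r * M u = r' * (μ * N u) := by
    intro u; rw [hM]; field_simp
  have e2 : ∀ u, r' * μ / r * q * M u = r' * (μ * q * N u) := by
    intro u; rw [hM]; field_simp
  refine ⟨div_pos (mul_pos hr' h.pos) hr, fun v => ?_, fun v => ?_, ?_, ?_, fun u => ?_⟩
  · rw [e1, hM']
    exact mul_le_mul_of_nonneg_left (h.le v) hr'.le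
  · rw [e2, hM']
    exact mul_le_mul_of_nonneg_left (h.ge v) hr'.le
  · obtain ⟨a, ha, e⟩ := h.exists_eq_min
    exact ⟨a, ha, by rw [e1, hM', e]⟩
  · obtain ⟨a, ha, e⟩ := h.exists_eq_max
    exact ⟨a, ha, by rw [e2, hM', e]⟩
  · obtain ⟨a, b, h1, h2, h3, h4, h5, h6⟩ := h.exists_add u
    refine ⟨a, b, h1, by rw [e1, hM', h2], by rw [e2, hM', h3], ?_, ?_, ?_⟩
    · rw [hM, hM]; exact mul_le_mul_of_nonneg_left h4 hr.le
    · rw [hM, hM]; exact mul_le_mul_of_nonneg_left h5 hr.le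
    · rw [hM', hM']; exact mul_le_mul_of_nonneg_left h6 hr'.le

theorem len_ind_eq_of_card_eq (hn : 2 ≤ n) (B : InvScalarProduct n) {I J : Finset (Fin n)}
    (h : I.card = J.card) : B.len (Apt.mk (ind I)) = B.len (Apt.mk (ind J)) := by
  obtain ⟨l, m, -, hB⟩ := B.exists_form_eq hn
  have h1 : ∀ I : Finset (Fin n), ∑ i, ind I i = I.card := fun I => by simp [ind]
  have h2 : ∀ I : Finset (Fin n), ∑ i, ind I i * ind I i = I.card := fun I => by simp [ind]
  rw [InvScalarProduct.len, InvScalarProduct.len, hB, hB, h1, h1, h2, h2, h]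

section Geodesic

variable {B : InvScalarProduct n} {γ : ℝ → building n K} {W : Submodule K (Fin n → K)}
  {A₀ : GL (Fin n) K} {I : Finset (Fin n)} {c₀ : Module.Ray ℝ (Apt n)}

/-- A two-valued difference is `α • ind J` up to a constant vector, and its length `α ℓ` must be `t
- s`. The length `ℓ` depends only on the cardinality of `J`, whence the same `θ` for all pairs of
times. -/
theorem IsGeodesic.exists_twoValued (hn : 2 ≤ n) (hγ : IsGeodesic B γ)
    (hA₀ : IsImageCoordSpan W A₀ I) (hc₀ : IsDir (ind I) c₀)
    (hlim : Tendsto (fun t => (γ t : XBar n K)) atTop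
      (@nhds _ (xBarTopology B) (XBar.mk (ProjGenLinGroup.mk A₀) (Sum.inr c₀))))
    {A : ℝ → GL (Fin n) K} {x : ℝ → Fin n → ℝ}
    (hrep : ∀ t, (γ t : XBar n K) = XBar.mk (ProjGenLinGroup.mk (A t)) (Sum.inl (Apt.mk (x t)))) :
    ∃ θ : ℝ, 1 < θ ∧ ∀ s t, s < t →
      ∃ μ, TwoValued (nrm (A s) (x s)) (nrm (A t) (x t)) μ (θ ^ (t - s)) := by
  obtain ⟨hI₀, hI₁⟩ := mk_ind_ne_zero_iff.1 hc₀.1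
  have hℓ := B.len_pos hc₀.1
  set ℓ := B.len (Apt.mk (ind I)) with hℓdef
  refine ⟨primeNorm K ^ (-ℓ⁻¹), ?_, fun s t hst => ?_⟩
  · have h1 := (primeNorm_rpow_lt_iff K 0 (-ℓ⁻¹)).2 (neg_lt_zero.2 (inv_pos.2 hℓ))
    rwa [Real.rpow_zero] at h1
  obtain ⟨M, y, z, hy, hz, hlen⟩ := hγ.exists_apartment hn hst.ne
  obtain ⟨J, hJk, hJ⟩ := hγ.exists_two_valued hn hA₀ hc₀ hlim hst hy hz
  rw [hA₀.finrank_eq] at hJk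
  have hJ₀ : J ≠ ∅ := by
    rw [Ne, ← Finset.card_eq_zero, hJk, Finset.card_eq_zero]
    exact hI₀
  have hJ₁ : J ≠ Finset.univ := by
    rw [Ne, ← Finset.card_eq_iff_eq_univ, hJk, Finset.card_eq_iff_eq_univ]
    exact hI₁
  have hts : 0 < t - s := sub_pos.2 hst
  obtain ⟨i₀, hi₀⟩ := Finset.nonempty_iff_ne_empty.2 hJ₀
  obtain ⟨j₀, hj₀⟩ : ∃ j, j ∉ J := by
    by_contra! h
    exact hJ₁ (Finset.eq_univ_iff_forall.2 h)
  set d := z - y with hd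
  have hαβ : ∀ i, d i = (d i₀ - d j₀) * ind J i + d j₀ := by
    intro i
    by_cases hi : i ∈ J
    · rw [ind_of_mem hi]
      linarith [hJ i i₀ (Or.inl hi), hJ i₀ i (Or.inl hi₀)]
    · rw [ind_of_notMem hi]
      linarith [hJ i j₀ (Or.inr hj₀), hJ j₀ i (Or.inr hi)]
  have hα : 0 ≤ d i₀ - d j₀ := sub_nonneg.2 (hJ i₀ j₀ (Or.inl hi₀))
  set α := d i₀ - d j₀
  have hαℓ : α = (t - s) / ℓ := by
    have h1 : Apt.mk d = α • Apt.mk (ind J) := by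
      rw [← Apt.mk_smul, eq_comm, Apt.mk_eq_mk_iff]
      exact ⟨d j₀, hαβ⟩
    rw [h1, InvScalarProduct.len_smul, abs_of_nonneg hα, len_ind_eq_of_card_eq hn B hJk, ← hℓdef,
      abs_sub_comm, abs_of_pos hts] at hlen
    rw [← hlen, mul_div_cancel_right₀ _ hℓ.ne']
  have h1 := twoValued_add M y hJ₀ hJ₁ (y := z) (α := α) (β := d j₀)
    (fun i => by rw [← hαβ, hd]; simp) hα
  obtain ⟨r, hr⟩ := nrm_eq_of_xbar_eq (hy.symm.trans (hrep s))
  obtain ⟨r', hr'⟩ := nrm_eq_of_xbar_eq (hz.symm.trans (hrep t))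
  have h2 := h1.of_smul (primeNorm_rpow_pos K r) (primeNorm_rpow_pos K r') hr hr'
  have hq : primeNorm K ^ (-α) = (primeNorm K ^ (-ℓ⁻¹)) ^ (t - s) := by
    rw [← Real.rpow_mul (primeNorm_pos K).le, hαℓ]
    congr 1
    field_simp
  rw [hq] at h2
  exact ⟨_, h2⟩

theorem exists_projection (hA₀ : IsImageCoordSpan W A₀ I) :
    ∃ P : Matrix (Fin n) (Fin n) K, (∀ w ∈ W, P *ᵥ w = 0) ∧ ∀ u, u - P *ᵥ u ∈ W := by
  refine ⟨(A₀ : Matrix (Fin n) (Fin n) K) * Matrix.diagonal (fun i => if i ∈ I then 0 else 1) *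
    (↑A₀⁻¹ : Matrix (Fin n) (Fin n) K), fun w hw => ?_, fun u => ?_⟩
  · have h := mem_coordSpan.1 ((hA₀ w).1 hw)
    rw [← Matrix.mulVec_mulVec, ← Matrix.mulVec_mulVec]
    have : Matrix.diagonal (fun i => if i ∈ I then (0 : K) else 1) *ᵥ
        ((↑A₀⁻¹ : Matrix (Fin n) (Fin n) K) *ᵥ w) = 0 := by
      ext i
      rw [Matrix.mulVec_diagonal]
      by_cases hi : i ∈ I
      · simp [hi]
      · rw [h i hi, mul_zero, Pi.zero_apply]
    rw [this, Matrix.mulVec_zero]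
  · rw [hA₀, mem_coordSpan]
    intro i hi
    rw [Matrix.mulVec_sub, ← Matrix.mulVec_mulVec, ← Matrix.mulVec_mulVec, inv_mulVec_mulVec,
      Pi.sub_apply, Matrix.mulVec_diagonal]
    simp [hi]

/-- On a subspace of the right dimension that is close to `W`, every vector of `W` can be
approximated. -/
theorem exists_mem_sub_mulVec_eq {P : Matrix (Fin n) (Fin n) K} (hP : ∀ u, u - P *ᵥ u ∈ W)
    {U : Submodule K (Fin n → K)} (hU : Module.finrank K U = Module.finrank K W) {ε : ℝ}
    (hε : ε ≤ 1) (hUP : ∀ u ∈ U, u ≠ 0 → ‖P *ᵥ u‖ < ε * ‖u‖) {w : Fin n → K} (hw : w ∈ W) :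
    ∃ u ∈ U, u - P *ᵥ u = w := by
  let φ : U →ₗ[K] W := ((LinearMap.id - Matrix.mulVecLin P).domRestrict U).codRestrict W
    fun u => hP u
  have hφ : ∀ u, (φ u : Fin n → K) = u - P *ᵥ u := fun u => rfl
  have hinj : Function.Injective φ := by
    rw [injective_iff_map_eq_zero]
    intro u hu
    have h1 := hφ u
    rw [hu, Submodule.coe_zero, eq_comm, sub_eq_zero] at h1
    by_contra h0
    have h0' : (u : Fin n → K) ≠ 0 := fun h => h0 (Subtype.ext h)
    have h2 := hUP u u.2 h0'
    rw [← h1] at h2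
    have := norm_pos_iff.2 h0'
    nlinarith
  obtain ⟨u, hu⟩ := (LinearMap.injective_iff_surjective_of_finrank_eq_finrank hU).1 hinj ⟨w, hw⟩
  exact ⟨u, u.2, by rw [← hφ, hu]⟩

/-- For large `T` a subspace `U` close to `W` is almost minimally stretched up to time `T`.
Approximate `w` by `u` in `U`, and split `u = a + b` into parts stretched minimally and maximally up
to `T`. Then `b` is tiny at time zero, so `w` is `a` plus a remainder so small that even the factor
`θ ^ t` does no harm. -/
theorem IsGeodesic.nrm_le_of_mem (hn : 2 ≤ n)
    (hA₀ : IsImageCoordSpan W A₀ I) (hc₀ : IsDir (ind I) c₀)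
    (hlim : Tendsto (fun t => (γ t : XBar n K)) atTop
      (@nhds _ (xBarTopology B) (XBar.mk (ProjGenLinGroup.mk A₀) (Sum.inr c₀))))
    {A : ℝ → GL (Fin n) K} {x : ℝ → Fin n → ℝ}
    (hrep : ∀ t, (γ t : XBar n K) = XBar.mk (ProjGenLinGroup.mk (A t)) (Sum.inl (Apt.mk (x t))))
    {θ : ℝ} (hθ : 1 < θ) (htv : ∀ s t, s < t →
      ∃ μ, TwoValued (nrm (A s) (x s)) (nrm (A t) (x t)) μ (θ ^ (t - s)))
    {t : ℝ} (ht : 0 < t) {μ : ℝ}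
    (hμ : TwoValued (nrm (A 0) (x 0)) (nrm (A t) (x t)) μ (θ ^ t)) {w : Fin n → K} (hw : w ∈ W) :
    nrm (A t) (x t) w ≤ μ * nrm (A 0) (x 0) w := by
  rcases eq_or_ne w 0 with rfl | hw0
  · rw [nrm_eq_zero.2 rfl, nrm_eq_zero.2 rfl, mul_zero]
  have hkn : Module.finrank K W < n := by
    rw [hA₀.finrank_eq]
    have := (Finset.card_lt_iff_ne_univ I).2 (mk_ind_ne_zero_iff.1 hc₀.1).2
    rwa [Fintype.card_fin] at this
  have hθ0 : 0 < θ := by linarith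
  have hlθ : 0 < Real.log θ := Real.log_pos hθ
  obtain ⟨P, hPW, hP⟩ := exists_projection hA₀
  obtain ⟨C, hC1, hC⟩ := exists_nrm_bounds (A 0) (x 0)
  have hCp : 0 < C := by linarith
  have hqt : 1 ≤ θ ^ t := Real.one_le_rpow hθ.le ht.le
  set ε := (θ ^ t)⁻¹ with hε
  have hεp : 0 < ε := by positivity
  have hε1 : ε ≤ 1 := inv_le_one_of_one_le₀ hqt
  have hε₁ : 0 < min (1 / 2) (ε / C ^ 2) := by positivity
  set ε₁ := min (1 / 2) (ε / C ^ 2)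
  have hnear := eventually_isNearInterior (P := P) B hn hA₀ hc₀ hlim hPW
    hε₁ (η := 1 / 2) (by norm_num)
  -- Near-minimality with `η = 1 / 2` gives `log N₀ b ≤ log N₀ w + 3 log C - (T / 2) log θ`. The
  -- bound on `T` makes this at most `log N₀ w - t log θ`.
  obtain ⟨T, hT, htT, hTbig⟩ := (hnear.and ((eventually_gt_atTop t).and
    (eventually_gt_atTop (2 * (3 * Real.log C + t * Real.log θ) / Real.log θ)))).exists
  have hT0 : 0 < T := ht.trans htT
  obtain ⟨μT, hμT⟩ := htv 0 T hT0
  obtain ⟨μ', hμ'⟩ := htv t T htT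
  rw [sub_zero] at hμT
  have hmul : μT = μ * μ' := by
    refine TwoValued.eq_mul (Real.rpow_pos_of_pos hθ0 t) (Real.rpow_pos_of_pos hθ0 (T - t))
      (fun v hv => nrm_pos hv) hμ hμ' ?_
    rwa [← Real.rpow_add hθ0, add_sub_cancel]
  obtain ⟨U, U', hU, hU', hUP, δ, hδ, H⟩ := hT _ _ (hrep T)
  have hε₁2 : ε₁ ≤ 1 / 2 := min_le_left _ _
  obtain ⟨u, hu, huw⟩ := exists_mem_sub_mulVec_eq hP hU (hε₁2.trans (by norm_num)) hUP hw
  have hu0 : u ≠ 0 := by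
    rintro rfl
    rw [Matrix.mulVec_zero, sub_zero] at huw
    exact hw0 huw.symm
  have hup := norm_pos_iff.2 hu0
  have hPu := hUP u hu hu0
  have huw' : ‖u‖ ≤ ‖w‖ := by
    have h1 : ‖w + P *ᵥ u‖ ≤ max ‖w‖ ‖P *ᵥ u‖ := IsUltrametricDist.norm_add_le_max _ _
    rw [← huw, sub_add_cancel, huw] at h1
    rcases le_max_iff.1 h1 with h | h
    · exact h
    · nlinarith
  obtain ⟨u', hu', hu0'⟩ : ∃ w ∈ U', w ≠ 0 := Submodule.exists_mem_ne_zero_of_ne_bot (by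
    rintro rfl; simp at hU'; omega)
  obtain ⟨a, b, hab, ha, hb, -, hb0, hbT⟩ := hμT.exists_add u
  obtain ⟨a₁, ha₁0, ha₁⟩ := hμT.exists_eq_min
  set N₀ := nrm (A 0) (x 0) with hN₀
  set NT := nrm (A T) (x T) with hNT
  have hN₀pos : ∀ {v}, v ≠ 0 → 0 < N₀ v := fun hv => nrm_pos hv
  have hNTpos : ∀ {v}, v ≠ 0 → 0 < NT v := fun hv => nrm_pos hv
  have hqT : 0 < θ ^ T := Real.rpow_pos_of_pos hθ0 T
  have hwp := hN₀pos hw0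
  -- the component `b` is small
  have hsmall : N₀ b ≤ ε * N₀ w := by
    rcases eq_or_ne b 0 with rfl | hb00
    · rw [hN₀, nrm_eq_zero.2 rfl]
      positivity
    have h1 := (H u hu u' hu' u hu u' hu' a₁ hu0 hu0' hu0 hu0' ha₁0).1
    have h2 : stretch NT a₁ = Real.log μT + stretch N₀ a₁ := by
      rw [stretch, stretch, ha₁, Real.log_mul hμT.pos.ne' (hN₀pos ha₁0).ne']
      ring
    have h3 : stretch NT u' ≤ Real.log μT + T * Real.log θ + stretch N₀ u' := by
      have := Real.log_le_log (hNTpos hu0') (hμT.ge u')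
      rw [Real.log_mul (mul_pos hμT.pos hqT).ne' (hN₀pos hu0').ne', Real.log_mul hμT.pos.ne' hqT.ne',
        Real.log_rpow hθ0] at this
      rw [stretch, stretch]
      linarith
    have h4 : Real.log μT + stretch N₀ u ≤ stretch NT u := by
      have := Real.log_le_log (mul_pos hμT.pos (hN₀pos hu0)) (hμT.le u)
      rw [Real.log_mul hμT.pos.ne' (hN₀pos hu0).ne'] at this
      rw [stretch, stretch]
      linarith
    have h5 := abs_le.1 (abs_stretch_le hC1 hC ha₁0)
    have h6 := abs_le.1 (abs_stretch_le hC1 hC hu0')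
    have h7 := abs_le.1 (abs_stretch_le hC1 hC hu0)
    have h8 := Real.log_le_log (hNTpos hb00) hbT
    rw [hb, Real.log_mul (mul_pos hμT.pos hqT).ne' (hN₀pos hb00).ne', Real.log_mul hμT.pos.ne' hqT.ne',
        Real.log_rpow hθ0] at h8
    have h9 : Real.log (NT u) = stretch NT u + Real.log ‖u‖ := by rw [stretch]; ring
    have h10 := Real.log_le_log hup huw'
    have h11 := Real.log_le_log (norm_pos_iff.2 hw0) (hC w).2
    rw [Real.log_mul hCp.ne' hwp.ne'] at h11
    rw [div_lt_iff₀ hlθ] at hTbig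
    have h12 : Real.log ε = -(t * Real.log θ) := by
      rw [hε, Real.log_inv, Real.log_rpow hθ0]
    rw [← Real.log_le_log_iff (hN₀pos hb00) (mul_pos hεp hwp), Real.log_mul hεp.ne' hwp.ne', h12]
    linarith [h5.2, h6.2, h7.1]
  have hPsmall : N₀ (P *ᵥ u) ≤ ε * N₀ w := by
    calc N₀ (P *ᵥ u) ≤ C * ‖P *ᵥ u‖ := (hC _).1
      _ ≤ C * (ε / C ^ 2 * (C * N₀ w)) := by
          refine mul_le_mul_of_nonneg_left ?_ hCp.le
          refine hPu.le.trans (mul_le_mul (min_le_right _ _) (huw'.trans (hC w).2) hup.le ?_)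
          positivity
      _ = ε * N₀ w := by field_simp
  set r := b - P *ᵥ u with hr
  have hwar : w = a + r := by rw [hr, ← add_sub_assoc, ← hab, huw]
  have hrs : N₀ r ≤ ε * N₀ w := (nrm_sub_le _ _ _ _).trans (max_le hsmall hPsmall)
  have haw : N₀ a ≤ N₀ w := by
    have h1 : N₀ (w - r) ≤ max (N₀ w) (N₀ r) := nrm_sub_le _ _ _ _
    have h2 : w - r = a := sub_eq_of_eq_add hwar
    rw [h2] at h1
    refine h1.trans (max_le le_rfl (hrs.trans ?_))
    nlinarith
  -- Minimal stretching over the whole interval up to `T` forces minimal stretching up to `t`,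
  -- because the minimal factors multiply.
  have hta : nrm (A t) (x t) a ≤ μ * N₀ a := by
    have h1 := hμ'.le a
    rw [ha, hmul] at h1
    have : μ' * nrm (A t) (x t) a ≤ μ' * (μ * N₀ a) := by linarith
    exact le_of_mul_le_mul_left this hμ'.pos
  have htr : nrm (A t) (x t) r ≤ μ * N₀ w := by
    refine (hμ.ge r).trans ?_
    have h1 := mul_le_mul_of_nonneg_left hrs (mul_pos hμ.pos (zero_lt_one.trans_le hqt)).le
    have h2 : μ * θ ^ t * (ε * N₀ w) = μ * N₀ w := by rw [hε]; field_simp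
    rwa [h2] at h1
  calc nrm (A t) (x t) w ≤ max (nrm (A t) (x t) a) (nrm (A t) (x t) r) := by
        conv_lhs => rw [hwar]
        exact nrm_add_le _ _ _ _
    _ ≤ μ * N₀ w := max_le (hta.trans (mul_le_mul_of_nonneg_left haw hμ.pos.le)) htr

/-- A vector in both subspaces is stretched maximally from time `-1` to `0` and minimally from `0`
to `1`. Splitting it as `a + b` over the whole interval, one part is at least as long as the vector
at time zero. Each part is stretched uniformly throughout, which contradicts one of the two
behaviours. -/
theorem ConnectedByGeodesic.isCompl (hn : 2 ≤ n) {W' : Submodule K (Fin n → K)}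
    {A₀' : GL (Fin n) K} {I' : Finset (Fin n)} {c₀' : Module.Ray ℝ (Apt n)}
    (hA₀ : IsImageCoordSpan W A₀ I) (hc₀ : IsDir (ind I) c₀)
    (hA₀' : IsImageCoordSpan W' A₀' I') (hc₀' : IsDir (ind I') c₀')
    (h : ConnectedByGeodesic B (XBar.mk (ProjGenLinGroup.mk A₀) (Sum.inr c₀))
      (XBar.mk (ProjGenLinGroup.mk A₀') (Sum.inr c₀'))) : IsCompl W W' := by
  obtain ⟨γ, hγ, hlim, hlim'⟩ := h
  have hγ' : IsGeodesic B fun t => γ (-t) := by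
    intro s t
    rw [hγ, abs_sub_comm]
    congr 1
    ring
  have hlim'' : Tendsto (fun t => (γ (-t) : XBar n K)) atTop
      (@nhds _ (xBarTopology B) (XBar.mk (ProjGenLinGroup.mk A₀') (Sum.inr c₀'))) :=
    hlim'.comp tendsto_neg_atTop_atBot
  have hrep : ∀ t, ∃ (A : GL (Fin n) K) (x : Fin n → ℝ),
      (γ t : XBar n K) = XBar.mk (ProjGenLinGroup.mk A) (Sum.inl (Apt.mk x)) := by
    intro t
    obtain ⟨g, a, e⟩ := (γ t).2
    obtain ⟨A, rfl⟩ := ProjGenLinGroup.mk_surjective g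
    obtain ⟨x, rfl⟩ := Apt.mk_surjective a
    exact ⟨A, x, e⟩
  choose A x hAx using hrep
  obtain ⟨θ, hθ, htv⟩ := hγ.exists_twoValued hn hA₀ hc₀ hlim hAx
  obtain ⟨θ', hθ', htv'⟩ := hγ'.exists_twoValued hn hA₀' hc₀' hlim'' (A := fun t => A (-t))
    (x := fun t => x (-t)) fun t => hAx (-t)
  have hθ0 : 0 < θ := by linarith
  have hdisj : W ⊓ W' = ⊥ := by
    rw [Submodule.eq_bot_iff]
    rintro u ⟨huW, huW'⟩
    by_contra hu0
    obtain ⟨μ, hμ⟩ := htv 0 1 one_pos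
    obtain ⟨ν, hν⟩ := htv (-1) 0 (by norm_num)
    obtain ⟨κ, hκ⟩ := htv (-1) 1 (by norm_num)
    obtain ⟨μ', hμ'⟩ := htv' 0 1 one_pos
    rw [sub_zero] at hμ hμ'
    rw [show (0 : ℝ) - -1 = 1 by norm_num] at hν
    rw [show (1 : ℝ) - -1 = 1 + 1 by norm_num, Real.rpow_add hθ0] at hκ
    have h1 := IsGeodesic.nrm_le_of_mem hn hA₀ hc₀ hlim hAx hθ htv one_pos hμ huW
    have h2 := IsGeodesic.nrm_le_of_mem (γ := fun t => γ (-t)) hn hA₀' hc₀' hlim''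
      (A := fun t => A (-t)) (x := fun t => x (-t)) (fun t => hAx (-t)) hθ' htv' one_pos hμ' huW'
    simp only [neg_zero] at h2 hμ'
    rw [Real.rpow_one] at hμ hν hκ
    have hmul : κ = ν * μ := TwoValued.eq_mul hθ0 hθ0 (fun v hv => nrm_pos hv) hν hμ hκ
    set N₀ := nrm (A 0) (x 0)
    set N₁ := nrm (A 1) (x 1)
    set N₂ := nrm (A (-1)) (x (-1))
    have hN₀ : ∀ {v}, v ≠ 0 → 0 < N₀ v := fun hv => nrm_pos hv
    have hN₂ : ∀ {v}, v ≠ 0 → 0 < N₂ v := fun hv => nrm_pos hv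
    -- Stretching maximally forwards from `-1` to `0` and then returning by at least the factor `μ'`
    -- cannot lengthen a vector.
    have h3 : ν * θ * μ' ≤ 1 := by
      obtain ⟨b, hb0, hb⟩ := hν.exists_eq_max
      have h4 := mul_le_mul_of_nonneg_left (hμ'.le b) (mul_pos hν.pos hθ0).le
      rw [← hb] at h4
      have : (ν * θ * μ') * N₀ b ≤ 1 * N₀ b := by linarith
      exact le_of_mul_le_mul_right this (hN₀ hb0)
    have h5 : ν * θ * N₂ u ≤ N₀ u := by
      have h6 := mul_le_mul_of_nonneg_left h2 (mul_pos hν.pos hθ0).le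
      have h7 := mul_le_mul_of_nonneg_right h3 (hN₀ hu0).le
      linarith
    obtain ⟨a, b, hab, ha, hb, haN, hbN, hbN'⟩ := hκ.exists_add u
    have h8 : N₀ u ≤ max (N₀ a) (N₀ b) := by
      rw [hab]; exact nrm_add_le _ _ _ _
    rcases le_max_iff.1 h8 with h9 | h9
    · -- `N₀ a = ν * N₂ a`
      have h10 : μ * N₀ a ≤ μ * (ν * N₂ a) := by
        have := hμ.le a
        rw [ha, hmul] at this
        linarith
      have h11 := le_of_mul_le_mul_left h10 hμ.pos
      have h12 := mul_le_mul_of_nonneg_left haN hν.pos.le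
      have h13 : 0 < ν * N₂ u := mul_pos hν.pos (hN₂ hu0)
      nlinarith
    · -- `N₁ b = μ * θ * N₀ b`
      have h10 : μ * θ * N₀ b ≤ N₁ b := by
        have := mul_le_mul_of_nonneg_left (hν.ge b) (mul_pos hμ.pos hθ0).le
        rw [hb, hmul]
        linarith
      have h11 : μ * θ * N₀ u ≤ μ * θ * N₀ b :=
        mul_le_mul_of_nonneg_left h9 (mul_pos hμ.pos hθ0).le
      have h13 : 0 < μ * N₀ u := mul_pos hμ.pos (hN₀ hu0)
      nlinarith
  have hdim : Module.finrank K W + Module.finrank K W' = n := by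
    obtain ⟨M, y, z, hy, hz, hlen⟩ := hγ.exists_apartment hn (s := 0) (t := 1) (by norm_num)
    obtain ⟨J, hJk, hJ⟩ := hγ.exists_two_valued hn hA₀ hc₀ hlim one_pos hy hz
    obtain ⟨J', hJk', hJ'⟩ := hγ'.exists_two_valued hn hA₀' hc₀' hlim'' (s := -1) (t := 0)
      (by norm_num) (A := M) (x := z) (y := y) (by rw [neg_neg]; exact hz)
      (by rw [neg_zero]; exact hy)
    have hne : ¬ ∃ r : ℝ, ∀ i, (z - y) i = r := by
      rw [← Apt.mk_eq_zero_iff, ← B.len_eq_zero, hlen]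
      norm_num
    -- Reversing time changes the sign of the difference, so an index in both sets, or in neither,
    -- would make the difference constant. Its length is `1`, so it is not.
    have hJJ : J' = Jᶜ := by
      ext i
      rw [Finset.mem_compl]
      constructor
      · intro hi' hi
        refine hne ⟨(z - y) i, fun j => le_antisymm (hJ i j (Or.inl hi)) ?_⟩
        have := hJ' i j (Or.inl hi')
        simp only [Pi.sub_apply] at this ⊢
        linarith
      · intro hi
        by_contra hi'
        refine hne ⟨(z - y) i, fun j => le_antisymm ?_ (hJ j i (Or.inr hi))⟩
        have := hJ' j i (Or.inr hi')
        simp only [Pi.sub_apply] at this ⊢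
        linarith
    rw [← hJk, ← hJk', hJJ, Finset.card_add_card_compl, Fintype.card_fin]
  have hd := disjoint_iff.2 hdisj
  exact ⟨hd, codisjoint_iff.2 (Submodule.eq_top_of_disjoint _ _ (by
    rw [hdim, Module.finrank_fin_fun]) hd)⟩

/-! ### Geodesics in an apartment -/

theorem tendsto_xbar_mk {g : ProjGenLinGroup (Fin n) K} {f : ℝ → AptBar n} {F : Filter ℝ}
    {a : AptBar n} (h : Tendsto f F (@nhds _ (aptBarTopology B) a)) :
    Tendsto (fun t => XBar.mk g (f t)) F (@nhds _ (xBarTopology B) (XBar.mk g a)) := by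
  let _ := aptBarTopology B
  let _ := xBarTopology (K := K) B
  have h1 : Continuous fun p : ProjGenLinGroup (Fin n) K × AptBar n => XBar.mk p.1 p.2 :=
    continuous_coinduced_rng
  have h2 : Continuous fun a : AptBar n => XBar.mk g a := h1.comp (Continuous.prodMk_right g)
  exact (h2.tendsto a).comp h

theorem mk_ind_compl (I : Finset (Fin n)) : Apt.mk (ind Iᶜ) = -Apt.mk (ind I) := by
  rw [← Apt.mk_neg, Apt.mk_eq_mk_iff]
  refine ⟨-1, fun i => ?_⟩
  by_cases h : i ∈ I
  · rw [Pi.neg_apply, ind_of_mem h, ind_of_notMem (by simpa using h)]; norm_num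
  · rw [Pi.neg_apply, ind_of_notMem h, ind_of_mem (by simpa using h)]; norm_num

/-- A basis adapted to the decomposition puts both vertices on the boundary of one apartment as
opposite directions. The line through the origin, parametrized by arc length, connects them. -/
theorem connectedByGeodesic_of_isCompl (hn : 2 ≤ n) (B : InvScalarProduct n)
    {W' : Submodule K (Fin n → K)}
    {A₀' : GL (Fin n) K} {I' : Finset (Fin n)} {c₀' : Module.Ray ℝ (Apt n)}
    (hA₀ : IsImageCoordSpan W A₀ I) (hc₀ : IsDir (ind I) c₀)
    (hA₀' : IsImageCoordSpan W' A₀' I') (hc₀' : IsDir (ind I') c₀') (h : IsCompl W W') :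
    ConnectedByGeodesic B (XBar.mk (ProjGenLinGroup.mk A₀) (Sum.inr c₀))
      (XBar.mk (ProjGenLinGroup.mk A₀') (Sum.inr c₀')) := by
  obtain ⟨A, J, hA, hA'⟩ := exists_isImageCoordSpan_of_isCompl h
  have hcard : J.card = I.card := hA.finrank_eq.symm.trans hA₀.finrank_eq
  obtain ⟨hI₀, hI₁⟩ := mk_ind_ne_zero_iff.1 hc₀.1
  have hJ₀ : J ≠ ∅ := by
    rw [Ne, ← Finset.card_eq_zero, hcard, Finset.card_eq_zero]
    exact hI₀
  have hJ₁ : J ≠ Finset.univ := by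
    rw [Ne, ← Finset.card_eq_iff_eq_univ, hcard, Finset.card_eq_iff_eq_univ]
    exact hI₁
  have hne : Apt.mk (ind J) ≠ 0 := mk_ind_ne_zero hJ₀ hJ₁
  have hne' : -Apt.mk (ind J) ≠ 0 := neg_ne_zero.2 hne
  have hc : IsDir (ind J) (rayOfNeZero ℝ _ hne) := ⟨hne, rfl⟩
  have hc' : IsDir (ind Jᶜ) (rayOfNeZero ℝ _ hne') := by
    refine ⟨by rw [mk_ind_compl]; exact hne', ?_⟩
    simp only [mk_ind_compl]
  rw [xbar_mk_eq_of_isImageCoordSpan hA₀ hA hc₀ hc,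
    xbar_mk_eq_of_isImageCoordSpan hA₀' hA' hc₀' hc']
  have hℓ := B.len_pos hne
  set v := Apt.mk (ind J)
  set ℓ := B.len v
  refine ⟨fun t => ⟨XBar.mk (ProjGenLinGroup.mk A) (Sum.inl ((t / ℓ) • v)), _, _, rfl⟩, ?_, ?_, ?_⟩
  · intro s t
    rw [bdDist_eq hn B rfl rfl, ← sub_smul, InvScalarProduct.len_smul, ← sub_div, abs_div,
      abs_of_pos hℓ, div_mul_cancel₀ _ hℓ.ne']
  · exact tendsto_xbar_mk (tendsto_inl_smul B hne rfl (tendsto_id.atTop_div_const hℓ))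
  · have h1 := tendsto_xbar_mk (B := B) (g := ProjGenLinGroup.mk A) (tendsto_inl_smul B hne' rfl
      (f := fun t : ℝ => -t / ℓ) (F := atBot) (tendsto_neg_atBot_atTop.atTop_div_const hℓ))
    refine h1.congr fun t => ?_
    rw [neg_div, smul_neg, neg_smul, neg_neg]

end Geodesic

end

end BTBuilding

namespace BTBuilding

noncomputable section

set_option linter.unusedSectionVars false

/-! ### Transvections -/

variable {n : ℕ} {K : Type*} [NormedField K]

theorem vecMulVec_mulVec_eq_smul (w f v : Fin n → K) :
    Matrix.vecMulVec w f *ᵥ v = (f ⬝ᵥ v) • w := by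
  ext i
  simp only [Matrix.mulVec, dotProduct, Matrix.vecMulVec_apply, Pi.smul_apply, smul_eq_mul,
    Finset.sum_mul]
  exact Finset.sum_congr rfl fun j _ => by ring

theorem trace_vecMulVec_mul (w f : Fin n → K) (M : Matrix (Fin n) (Fin n) K) :
    (Matrix.vecMulVec w f * M).trace = f ⬝ᵥ M *ᵥ w := by
  rw [Matrix.vecMulVec_mul, Matrix.trace_vecMulVec, dotProduct_mulVec, dotProduct_comm]

theorem exists_gl_transvection {w f : Fin n → K} (h : f ⬝ᵥ w = 0) : ∃ E : GL (Fin n) K,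
    (E : Matrix (Fin n) (Fin n) K) = 1 + Matrix.vecMulVec w f ∧
      (↑E⁻¹ : Matrix (Fin n) (Fin n) K) = 1 - Matrix.vecMulVec w f := by
  have h0 : Matrix.vecMulVec w f * Matrix.vecMulVec w f = 0 := by
    refine Matrix.ext_of_mulVec_single fun j => ?_
    rw [← Matrix.mulVec_mulVec, vecMulVec_mulVec_eq_smul, vecMulVec_mulVec_eq_smul,
      dotProduct_smul, h, smul_zero, zero_smul, Matrix.zero_mulVec]
  refine ⟨⟨1 + Matrix.vecMulVec w f, 1 - Matrix.vecMulVec w f, ?_, ?_⟩, rfl, rfl⟩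
  · rw [add_mul, mul_sub, mul_sub, h0]
    simp
  · rw [sub_mul, mul_add, mul_add, h0]
    simp

theorem exists_dotProduct_eq (φ : (Fin n → K) →ₗ[K] K) : ∃ f : Fin n → K, ∀ v, φ v = f ⬝ᵥ v := by
  refine ⟨fun i => φ (Pi.single i 1), fun v => ?_⟩
  rw [LinearMap.pi_apply_eq_sum_univ, dotProduct]
  refine Finset.sum_congr rfl fun i _ => ?_
  rw [smul_eq_mul, mul_comm]
  congr 2
  ext j
  simp [Pi.single_apply, eq_comm]

theorem exists_dotProduct_ne_zero {W : Submodule K (Fin n → K)} {x : Fin n → K} (hx : x ∉ W) :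
    ∃ f : Fin n → K, (∀ u ∈ W, f ⬝ᵥ u = 0) ∧ f ⬝ᵥ x ≠ 0 := by
  obtain ⟨φ, hφx, hφ⟩ := Submodule.exists_le_ker_of_notMem hx
  obtain ⟨f, hf⟩ := exists_dotProduct_eq φ
  exact ⟨f, fun u hu => by rw [← hf]; exact hφ hu, by rwa [← hf]⟩

/-- The linear forms vanishing at `w` are not the union of two proper subspaces. -/
theorem exists_dotProduct_ne_zero_and {w x y : Fin n → K} (hx : x ∉ Submodule.span K {w})
    (hy : y ∉ Submodule.span K {w}) :
    ∃ f : Fin n → K, f ⬝ᵥ w = 0 ∧ f ⬝ᵥ x ≠ 0 ∧ f ⬝ᵥ y ≠ 0 := by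
  obtain ⟨f, hf, hfx⟩ := exists_dotProduct_ne_zero hx
  obtain ⟨g, hg, hgy⟩ := exists_dotProduct_ne_zero hy
  have hfw := hf w (Submodule.mem_span_singleton_self w)
  have hgw := hg w (Submodule.mem_span_singleton_self w)
  by_cases hfy : f ⬝ᵥ y = 0
  · by_cases hgx : g ⬝ᵥ x = 0
    · refine ⟨f + g, ?_, ?_, ?_⟩
      · rw [add_dotProduct, hfw, hgw, add_zero]
      · rwa [add_dotProduct, hgx, add_zero]
      · rwa [add_dotProduct, hfy, zero_add]
    · exact ⟨g, hgw, hgx, hgy⟩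
  · exact ⟨f, hfw, hfx, hfy⟩

/-! ### Unipotent radicals -/

theorem det_eq_one_of_isNilpotent {M : Matrix (Fin n) (Fin n) K} (h : IsNilpotent (M - 1)) :
    M.det = 1 := by
  have h1 : IsNilpotent (1 - M) := by rw [← neg_sub]; exact h.neg
  have h2 := (Matrix.isNilpotent_charpoly_sub_pow_of_isNilpotent h1).eq_zero
  have h3 := congrArg (Polynomial.eval 1) (sub_eq_zero.1 h2)
  rw [Matrix.eval_charpoly] at h3
  simpa using h3

theorem trace_eq_of_isNilpotent {M : Matrix (Fin n) (Fin n) K} (h : IsNilpotent (M - 1)) :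
    M.trace = n := by
  have := (Matrix.isNilpotent_trace_of_isNilpotent h).eq_zero
  rw [Matrix.trace_sub, Matrix.trace_one, sub_eq_zero] at this
  simpa using this

theorem eq_one_of_isNilpotent_of_mulVec {M : Matrix (Fin n) (Fin n) K} (h : IsNilpotent (M - 1))
    {w : Fin n → K} (hw : w ≠ 0) {k : K} (hk : M *ᵥ w = k • w) : k = 1 := by
  obtain ⟨m, hm⟩ := h
  have h1 : ∀ m : ℕ, (M - 1) ^ m *ᵥ w = (k - 1) ^ m • w := by
    intro m
    induction m with
    | zero => simp
    | succ m ih =>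
      rw [pow_succ, ← Matrix.mulVec_mulVec, Matrix.sub_mulVec, hk, Matrix.one_mulVec, pow_succ]
      have : k • w - w = (k - 1) • w := by rw [sub_smul, one_smul]
      rw [this, Matrix.mulVec_smul, ih, smul_smul, mul_comm]
  have h2 := h1 m
  rw [hm, Matrix.zero_mulVec, eq_comm, smul_eq_zero] at h2
  exact sub_eq_zero.1 (IsReduced.eq_zero _ ⟨m, h2.resolve_right hw⟩)

/-- The elements of `GL` that act trivially on `W` and on the quotient by `W`. -/
def trivialOn (W : Submodule K (Fin n → K)) : Subgroup (GL (Fin n) K) where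
  carrier := {A | (∀ u, (A : Matrix (Fin n) (Fin n) K) *ᵥ u - u ∈ W) ∧
    ∀ u ∈ W, (A : Matrix (Fin n) (Fin n) K) *ᵥ u = u}
  one_mem' := by simp
  mul_mem' := by
    rintro A A' ⟨h1, h2⟩ ⟨h1', h2'⟩
    refine ⟨fun u => ?_, fun u hu => ?_⟩
    · rw [Units.val_mul, ← Matrix.mulVec_mulVec,
        ← sub_add_sub_cancel _ ((A' : Matrix (Fin n) (Fin n) K) *ᵥ u)]
      exact W.add_mem (h1 _) (h1' u)
    · rw [Units.val_mul, ← Matrix.mulVec_mulVec, h2' u hu, h2 u hu]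
  inv_mem' := by
    rintro A ⟨h1, h2⟩
    refine ⟨fun u => ?_, fun u hu => ?_⟩
    · have := h1 ((↑A⁻¹ : Matrix (Fin n) (Fin n) K) *ᵥ u)
      rw [mulVec_inv_mulVec] at this
      rw [← neg_sub]
      exact W.neg_mem this
    · have := inv_mulVec_mulVec A u
      rwa [h2 u hu] at this

theorem trivialOn_le_subspaceStabilizer (W : Submodule K (Fin n → K)) :
    trivialOn W ≤ subspaceStabilizer W := by
  rintro A ⟨h1, h2⟩ u
  refine ⟨fun h => ?_, fun h => by rwa [h2 u h]⟩
  have := W.sub_mem h (h1 u)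
  rwa [sub_sub_cancel] at this

theorem isNilpotent_of_mem_trivialOn {W : Submodule K (Fin n → K)} {A : GL (Fin n) K}
    (hA : A ∈ trivialOn W) : IsNilpotent ((A : Matrix (Fin n) (Fin n) K) - 1) := by
  refine ⟨2, Matrix.ext_of_mulVec_single fun j => ?_⟩
  rw [sq, ← Matrix.mulVec_mulVec, Matrix.zero_mulVec, Matrix.sub_mulVec _ _ (Pi.single j 1),
    Matrix.one_mulVec, Matrix.sub_mulVec, Matrix.one_mulVec, hA.2 _ (hA.1 _), sub_self]

theorem le_unipotentRadical (W : Submodule K (Fin n → K)) :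
    (trivialOn W).map ProjGenLinGroup.mk ≤
      unipotentRadical ((subspaceStabilizer W).map ProjGenLinGroup.mk) := by
  refine le_sSup ⟨Subgroup.map_mono (trivialOn_le_subspaceStabilizer W), ?_, ?_⟩
  · rintro _ ⟨H, hH, rfl⟩ _ ⟨A, hA, rfl⟩
    refine ⟨H * A * H⁻¹, ⟨fun u => ?_, fun u hu => ?_⟩, by rw [map_mul, map_mul, map_inv]⟩
    · have h1 := (hH _).2 (hA.1 ((↑H⁻¹ : Matrix (Fin n) (Fin n) K) *ᵥ u))
      rw [Matrix.mulVec_sub, mulVec_inv_mulVec] at h1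
      rwa [Units.val_mul, Units.val_mul, ← Matrix.mulVec_mulVec, ← Matrix.mulVec_mulVec]
    · have h1 : (↑H⁻¹ : Matrix (Fin n) (Fin n) K) *ᵥ u ∈ W := by
        rw [← hH, mulVec_inv_mulVec]; exact hu
      rw [Units.val_mul, Units.val_mul, ← Matrix.mulVec_mulVec, ← Matrix.mulVec_mulVec, hA.2 _ h1,
        mulVec_inv_mulVec]
  · rintro _ ⟨A, hA, rfl⟩
    exact ⟨A, isNilpotent_of_mem_trivialOn hA, rfl⟩

section Commutator

variable [PrimeNormBounds K]

theorem exists_lt_norm (r : ℝ) : ∃ s : K, r < ‖s‖ := by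
  obtain ⟨a, ha0, ha1⟩ := exists_norm_lt_one K
  have hp := norm_pos_iff.2 ha0
  have : 1 < ‖a⁻¹‖ := by
    rw [norm_inv]
    exact (one_lt_inv₀ hp).2 ha1
  obtain ⟨m, hm⟩ := pow_unbounded_of_one_lt r this
  exact ⟨a⁻¹ ^ m, by rwa [norm_pow]⟩

/-- The commutator of `A` with the transvection along `s • w` lies in `U`, so it is unipotent up to
a scalar of absolute value one, and its trace is bounded. That trace is `n - s² τ` with `τ` the
product in question. As `s` can be arbitrarily large, `τ = 0`. -/
theorem dotProduct_mul_eq_zero_of_unipotent [NeZero n]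
    {P U : Subgroup (ProjGenLinGroup (Fin n) K)}
    (hUP : ∀ g ∈ P, ∀ u ∈ U, g * u * g⁻¹ ∈ U) (hU : ∀ u ∈ U, IsUnipotentElt u)
    {A : GL (Fin n) K} (hA : ProjGenLinGroup.mk A ∈ U) {w f : Fin n → K} (h : f ⬝ᵥ w = 0)
    (hE : ∀ (s : K) (E : GL (Fin n) K), (E : Matrix (Fin n) (Fin n) K) =
      1 + Matrix.vecMulVec (s • w) f → ProjGenLinGroup.mk E ∈ P) :
    (f ⬝ᵥ (A : Matrix (Fin n) (Fin n) K) *ᵥ w) *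
      (f ⬝ᵥ (↑A⁻¹ : Matrix (Fin n) (Fin n) K) *ᵥ w) = 0 := by
  set τ := (f ⬝ᵥ (A : Matrix (Fin n) (Fin n) K) *ᵥ w) *
      (f ⬝ᵥ (↑A⁻¹ : Matrix (Fin n) (Fin n) K) *ᵥ w) with hτ
  have key : ∀ s : K, ‖s‖ ^ 2 * ‖τ‖ ≤ 2 * ‖(n : K)‖ := by
    intro s
    have hs : f ⬝ᵥ (s • w) = 0 := by rw [dotProduct_smul, h, smul_zero]
    obtain ⟨E, hE1, hE2⟩ := exists_gl_transvection hs
    have hmem : ProjGenLinGroup.mk (E * A * E⁻¹ * A⁻¹) ∈ U := by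
      have := U.mul_mem (hUP _ (hE s E hE1) _ hA) (U.inv_mem hA)
      rwa [← map_inv, ← map_inv, ← map_mul, ← map_mul, ← map_mul] at this
    obtain ⟨T, hT, hTe⟩ := hU _ hmem
    obtain ⟨c, hc⟩ := ProjGenLinGroup.mk_eq_mk_iff.1 hTe
    have hcT : ((E * A * E⁻¹ * A⁻¹ : GL (Fin n) K) : Matrix (Fin n) (Fin n) K) =
        (c : K) • (T : Matrix (Fin n) (Fin n) K) := by
      rw [← hc]
      ext i j
      simp [Matrix.scalar_apply, mul_comm]
    -- Commutators and unipotent matrices have determinant one, so the scalar ambiguity is a root of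
    -- unity.
    have hdet : (c : K) ^ n = 1 := by
      have h1 := congrArg Matrix.det hcT
      rw [Matrix.det_smul, det_eq_one_of_isNilpotent hT, mul_one, Fintype.card_fin] at h1
      rw [← h1, ← Matrix.GeneralLinearGroup.val_det_apply]
      simp only [map_mul, map_inv]
      simp
    have hcn : ‖(c : K)‖ = 1 := by
      have := congrArg norm hdet
      rw [norm_pow, norm_one] at this
      exact (pow_eq_one_iff_of_nonneg (norm_nonneg _) (NeZero.ne n)).1 this
    have htr : (n : K) - s ^ 2 * τ = c * n := by
      have h1 := congrArg Matrix.trace hcT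
      rw [Matrix.trace_smul, trace_eq_of_isNilpotent hT, smul_eq_mul] at h1
      rw [← h1]
      set e := Matrix.vecMulVec (s • w) f with he
      have h2 : ((E * A * E⁻¹ * A⁻¹ : GL (Fin n) K) : Matrix (Fin n) (Fin n) K) =
          1 + e - (A : Matrix (Fin n) (Fin n) K) * (e * (↑A⁻¹ : Matrix (Fin n) (Fin n) K)) -
            e * ((A : Matrix (Fin n) (Fin n) K) * (e * (↑A⁻¹ : Matrix (Fin n) (Fin n) K))) := by
        have h3 : (A : Matrix (Fin n) (Fin n) K) * (↑A⁻¹ : Matrix (Fin n) (Fin n) K) = 1 := by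
          rw [← Units.val_mul, mul_inv_cancel, Units.val_one]
        rw [Units.val_mul, Units.val_mul, Units.val_mul, hE1, hE2, mul_assoc, mul_assoc, sub_mul,
          mul_sub, one_mul, h3, add_mul, one_mul, mul_sub, mul_one]
        abel
      have h3 : e.trace = 0 := by
        rw [he, Matrix.trace_vecMulVec, dotProduct_comm, hs]
      have h4 : ((A : Matrix (Fin n) (Fin n) K) *
          (e * (↑A⁻¹ : Matrix (Fin n) (Fin n) K))).trace = 0 := by
        rw [Matrix.trace_mul_comm, mul_assoc, ← Units.val_mul, inv_mul_cancel, Units.val_one,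
          mul_one, h3]
      rw [h2, Matrix.trace_sub, Matrix.trace_sub, Matrix.trace_add, h3, h4, Matrix.trace_one,
        Fintype.card_fin, add_zero, sub_zero]
      congr 1
      rw [he, trace_vecMulVec_mul, ← Matrix.mulVec_mulVec, ← Matrix.mulVec_mulVec,
        vecMulVec_mulVec_eq_smul, Matrix.mulVec_smul, Matrix.mulVec_smul, Matrix.mulVec_smul,
        dotProduct_smul, dotProduct_smul, dotProduct_smul, hτ]
      simp only [smul_eq_mul]
      ring
    have h1 : s ^ 2 * τ = n - c * n := by rw [← htr]; ring
    calc ‖s‖ ^ 2 * ‖τ‖ = ‖(n : K) - c * n‖ := by rw [← h1, norm_mul (s ^ 2), norm_pow]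
      _ ≤ ‖(n : K)‖ + ‖(c : K) * n‖ := norm_sub_le _ _
      _ = 2 * ‖(n : K)‖ := by rw [norm_mul, hcn]; ring
  by_contra h0
  have hp := norm_pos_iff.2 h0
  obtain ⟨s, hs⟩ := exists_lt_norm (K := K) (1 + 2 * ‖(n : K)‖ / ‖τ‖)
  have h1 := key s
  rw [← le_div_iff₀ hp] at h1
  have h2 : 0 ≤ 2 * ‖(n : K)‖ / ‖τ‖ := by positivity
  nlinarith

/-- For `w` in `W` the transvections along `w` lie in `P_W`. If `A w` were not a multiple of `w`,
neither would `A⁻¹ w` be, and a form vanishing at `w` but at neither of them would contradict the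
commutator estimate. So `w` is an eigenvector, with eigenvalue one by unipotence. The dual argument
for forms vanishing on `W` gives triviality on the quotient. -/
theorem unipotentRadical_eq [NeZero n] (W : Submodule K (Fin n → K)) :
    unipotentRadical ((subspaceStabilizer W).map ProjGenLinGroup.mk) =
      (trivialOn W).map ProjGenLinGroup.mk := by
  refine le_antisymm (sSup_le ?_) (le_unipotentRadical W)
  rintro U ⟨hUP, hUn, hU⟩ g hg
  obtain ⟨A, hA, rfl⟩ := hU g hg
  have hAW : A ∈ subspaceStabilizer W :=
    mem_of_mk_mem_map (scalar_mem_subspaceStabilizer W) (hUP hg)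
  have hE : ∀ (w f : Fin n → K), f ⬝ᵥ w = 0 → (w ∈ W ∨ ∀ u ∈ W, f ⬝ᵥ u = 0) →
      (f ⬝ᵥ (A : Matrix (Fin n) (Fin n) K) *ᵥ w) *
      (f ⬝ᵥ (↑A⁻¹ : Matrix (Fin n) (Fin n) K) *ᵥ w) = 0 := by
    intro w f hfw hwf
    refine dotProduct_mul_eq_zero_of_unipotent hUn hU hg hfw fun s E hE => ⟨E, fun u => ?_, rfl⟩
    rw [hE, Matrix.add_mulVec, Matrix.one_mulVec, vecMulVec_mulVec_eq_smul]
    rcases hwf with hw | hf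
    · exact W.add_mem_iff_left (W.smul_mem _ (W.smul_mem _ hw))
    · have h1 : f ⬝ᵥ u = 0 → (u + (f ⬝ᵥ u) • s • w ∈ W ↔ u ∈ W) := by
        intro h0
        rw [h0, zero_smul, add_zero]
      constructor
      · intro hu
        have h2 := hf _ hu
        rw [dotProduct_add, dotProduct_smul, dotProduct_smul, hfw, smul_zero, smul_zero,
          add_zero] at h2
        exact (h1 h2).1 hu
      · intro hu
        exact (h1 (hf u hu)).2 hu
  refine ⟨A, ⟨fun v => ?_, fun w hw => ?_⟩, rfl⟩
  · by_contra hv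
    obtain ⟨f, hf, hfv⟩ := exists_dotProduct_ne_zero hv
    refine hfv ?_
    have hspan : f ᵥ* (A : Matrix (Fin n) (Fin n) K) ∈ Submodule.span K {f} := by
      by_contra h1
      have h2 : f ᵥ* (↑A⁻¹ : Matrix (Fin n) (Fin n) K) ∉ Submodule.span K {f} := by
        intro h2
        obtain ⟨k, hk⟩ := Submodule.mem_span_singleton.1 h2
        have h3 : k • (f ᵥ* (A : Matrix (Fin n) (Fin n) K)) = f := by
          rw [← Matrix.smul_vecMul, hk, Matrix.vecMul_vecMul, ← Units.val_mul, inv_mul_cancel,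
            Units.val_one, Matrix.vecMul_one]
        have hk0 : k ≠ 0 := by
          rintro rfl
          rw [zero_smul] at h3
          exact hfv (by rw [← h3, zero_dotProduct])
        exact h1 (Submodule.mem_span_singleton.2 ⟨k⁻¹, by
          conv_lhs => rw [← h3]
          rw [smul_smul, inv_mul_cancel₀ hk0, one_smul]⟩)
      obtain ⟨w, hw, hw1, hw2⟩ := exists_dotProduct_ne_zero_and h1 h2
      have h3 := hE w f (by rwa [dotProduct_comm]) (Or.inr hf)
      rw [dotProduct_mulVec, dotProduct_mulVec, dotProduct_comm _ w, dotProduct_comm _ w] at h3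
      exact mul_ne_zero hw1 hw2 h3
    obtain ⟨k, hk⟩ := Submodule.mem_span_singleton.1 hspan
    have hf0 : f ≠ 0 := by rintro rfl; simp at hfv
    have hAt : IsNilpotent ((A : Matrix (Fin n) (Fin n) K)ᵀ - 1) := by
      rw [← Matrix.transpose_one, ← Matrix.transpose_sub]
      obtain ⟨m, hm⟩ := hA
      exact ⟨m, by rw [← Matrix.transpose_pow, hm, Matrix.transpose_zero]⟩
    have hk1 : k = 1 := eq_one_of_isNilpotent_of_mulVec hAt hf0 (by
      rw [Matrix.mulVec_transpose, hk])
    rw [dotProduct_sub, dotProduct_mulVec, ← hk, hk1, one_smul, sub_self]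
  · rcases eq_or_ne w 0 with rfl | hw0
    · rw [Matrix.mulVec_zero]
    have hspan : (A : Matrix (Fin n) (Fin n) K) *ᵥ w ∈ Submodule.span K {w} := by
      by_contra h1
      have h2 : (↑A⁻¹ : Matrix (Fin n) (Fin n) K) *ᵥ w ∉ Submodule.span K {w} := by
        intro h2
        obtain ⟨k, hk⟩ := Submodule.mem_span_singleton.1 h2
        have h3 : k • ((A : Matrix (Fin n) (Fin n) K) *ᵥ w) = w := by
          rw [← Matrix.mulVec_smul, hk, mulVec_inv_mulVec]
        have hk0 : k ≠ 0 := by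
          rintro rfl
          rw [zero_smul] at h3
          exact hw0 h3.symm
        exact h1 (Submodule.mem_span_singleton.2 ⟨k⁻¹, by
          conv_lhs => rw [← h3]
          rw [smul_smul, inv_mul_cancel₀ hk0, one_smul]⟩)
      obtain ⟨f, hf, hf1, hf2⟩ := exists_dotProduct_ne_zero_and h1 h2
      exact mul_ne_zero hf1 hf2 (hE w f hf (Or.inl hw))
    obtain ⟨k, hk⟩ := Submodule.mem_span_singleton.1 hspan
    have hk1 : k = 1 := eq_one_of_isNilpotent_of_mulVec hA hw0 hk.symm
    rw [← hk, hk1, one_smul]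

end Commutator

/-! ### Opposite parabolic subgroups -/

/-- A transvection along `w` in `W` by a form `f` vanishing on `W` lies in the radical of `P_W`. It
also stabilizes `W'` if `w` lies in `W'` or `f` vanishes on `W'`, and then the Levi condition makes
it trivial. The first case gives trivial intersection, the second gives that the sum is everything.
-/
theorem isCompl_of_isOpposite {W W' : Submodule K (Fin n → K)} (hW : W ≠ ⊥) (hW₁ : W ≠ ⊤)
    (h : IsOpposite ((subspaceStabilizer W).map ProjGenLinGroup.mk)
      ((subspaceStabilizer W').map ProjGenLinGroup.mk)) : IsCompl W W' := by
  have key : ∀ w ∈ W, ∀ f : Fin n → K, (∀ u ∈ W, f ⬝ᵥ u = 0) → f ≠ 0 →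
      (w ∈ W' ∨ ∀ u ∈ W', f ⬝ᵥ u = 0) → w = 0 := by
    intro w hw f hf hf0 hwf
    obtain ⟨E, hE, -⟩ := exists_gl_transvection (hf w hw)
    have hEv : ∀ v, (E : Matrix (Fin n) (Fin n) K) *ᵥ v = v + (f ⬝ᵥ v) • w := by
      intro v
      rw [hE, Matrix.add_mulVec, Matrix.one_mulVec, vecMulVec_mulVec_eq_smul]
    have hEW : E ∈ trivialOn W := by
      refine ⟨fun u => ?_, fun u hu => ?_⟩
      · rw [hEv, add_sub_cancel_left]
        exact W.smul_mem _ hw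
      · rw [hEv, hf u hu, zero_smul, add_zero]
    have hEW' : E ∈ subspaceStabilizer W' := by
      intro u
      rw [hEv]
      rcases hwf with hw' | hf'
      · exact W'.add_mem_iff_left (W'.smul_mem _ hw')
      · constructor
        · intro hu
          have h2 := hf' _ hu
          rw [dotProduct_add, dotProduct_smul, hf w hw, smul_zero, add_zero] at h2
          rwa [h2, zero_smul, add_zero] at hu
        · intro hu
          rwa [hf' u hu, zero_smul, add_zero]
    have h1 : ProjGenLinGroup.mk E ∈ (⊥ : Subgroup (ProjGenLinGroup (Fin n) K)) := by
      rw [← h.1.2.1]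
      exact ⟨⟨⟨E, trivialOn_le_subspaceStabilizer W hEW, rfl⟩, ⟨E, hEW', rfl⟩⟩,
        le_unipotentRadical W ⟨E, hEW, rfl⟩⟩
    rw [Subgroup.mem_bot, ← map_one ProjGenLinGroup.mk] at h1
    obtain ⟨c, hc, -⟩ := mk_eq_iff_smul h1.symm
    by_contra hw0
    obtain ⟨v, hv⟩ : ∃ v, f ⬝ᵥ v ≠ 0 := by
      by_contra! h0
      exact hf0 (dotProduct_eq_zero f h0)
    have h2 := hc w
    have h3 := hc v
    rw [hEv, hf w hw, zero_smul, add_zero, Units.val_one, Matrix.one_mulVec] at h2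
    rw [hEv, Units.val_one, Matrix.one_mulVec] at h3
    have hc1 : (c : K) = 1 := by
      have h4 : ((c : K) - 1) • w = 0 := by rw [sub_smul, one_smul, ← h2, sub_self]
      exact sub_eq_zero.1 ((smul_eq_zero.1 h4).resolve_right hw0)
    rw [hc1, one_smul, add_eq_left, smul_eq_zero] at h3
    exact h3.elim hv hw0
  constructor
  · rw [Submodule.disjoint_def]
    intro w hw hw'
    obtain ⟨x, hx⟩ : ∃ x, x ∉ W := by
      by_contra! h0
      exact hW₁ (Submodule.eq_top_iff'.2 h0)
    obtain ⟨f, hf, hfx⟩ := exists_dotProduct_ne_zero hx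
    exact key w hw f hf (by rintro rfl; simp at hfx) (Or.inl hw')
  · rw [codisjoint_iff, Submodule.eq_top_iff']
    by_contra! h0
    obtain ⟨x, hx⟩ := h0
    obtain ⟨f, hf, hfx⟩ := exists_dotProduct_ne_zero hx
    obtain ⟨w, hw, hw0⟩ := Submodule.exists_mem_ne_zero_of_ne_bot hW
    exact hw0 (key w hw f (fun u hu => hf u (Submodule.mem_sup_left hu))
      (by rintro rfl; simp at hfx) (Or.inr fun u hu => hf u (Submodule.mem_sup_right hu)))

/-- With respect to the idempotent `p` both elements are block triangular, and taking the block
diagonal part is multiplicative on such elements. -/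
theorem mul_eq_one_of_triangular {R : Type*} [Ring R] {a b p : R} (hab : a * b = 1)
    (hp : p * p = p) (ha : p * a * p = a * p) (hb : p * b * p = b * p) :
    (a * p + (1 - p) * a) * (b * p + (1 - p) * b) = 1 := by
  have h1 : a * p * (b * p) = p := by
    rw [mul_assoc, ← mul_assoc p, hb, ← mul_assoc, hab, one_mul]
  have h2 : a * p * ((1 - p) * b) = 0 := by
    rw [← mul_assoc, mul_assoc a, mul_sub, hp, mul_one, sub_self, mul_zero, zero_mul]
  have h3 : (1 - p) * a * (b * p) = 0 := by
    rw [← mul_assoc, mul_assoc _ a b, hab, mul_one, sub_mul, hp, one_mul, sub_self]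
  have h4 : (1 - p) * a * ((1 - p) * b) = 1 - p := by
    have h5 : (1 - p) * a * (1 - p) = (1 - p) * a := by
      rw [mul_sub, mul_one, sub_mul 1 p a, one_mul, sub_mul a, ha, sub_self, sub_zero]
    rw [← mul_assoc, h5, mul_assoc, hab, mul_one]
  rw [add_mul, mul_add, mul_add, h1, h2, h3, h4]
  abel

theorem mem_subspaceStabilizer_of_forall {W : Submodule K (Fin n → K)} {A : GL (Fin n) K}
    (h : ∀ u ∈ W, (A : Matrix (Fin n) (Fin n) K) *ᵥ u ∈ W)
    (h' : ∀ u ∈ W, (↑A⁻¹ : Matrix (Fin n) (Fin n) K) *ᵥ u ∈ W) : A ∈ subspaceStabilizer W :=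
  fun u => ⟨fun hu => by simpa using h' _ hu, h u⟩

/-- The block diagonal part `L` of `A` with respect to `W ⊕ W'` stabilizes both summands, and `L⁻¹
A` is trivial on `W` and on the quotient. An element of the radical that stabilizes `W'` moves
vectors of `W'` only within `W ∩ W'`, hence is trivial. -/
theorem isLevi_of_isCompl [PrimeNormBounds K] [NeZero n] {W W' : Submodule K (Fin n → K)}
    (h : IsCompl W W') : IsLevi ((subspaceStabilizer W).map ProjGenLinGroup.mk ⊓
      (subspaceStabilizer W').map ProjGenLinGroup.mk)
      ((subspaceStabilizer W).map ProjGenLinGroup.mk) := by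
  rw [IsLevi, unipotentRadical_eq]
  refine ⟨inf_le_left, ?_, ?_⟩
  · rw [eq_bot_iff]
    rintro _ ⟨⟨-, hW'⟩, ⟨A, ⟨h1, h2⟩, rfl⟩⟩
    have hA := mem_of_mk_mem_map (scalar_mem_subspaceStabilizer W') hW'
    have hA1 : A = 1 := by
      refine Units.ext (Matrix.ext_of_mulVec_single fun j => ?_)
      rw [Units.val_one, Matrix.one_mulVec]
      obtain ⟨w, hw, w', hw', e⟩ := Submodule.mem_sup.1
        (h.sup_eq_top.symm ▸ Submodule.mem_top : (Pi.single j 1 : Fin n → K) ∈ W ⊔ W')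
      have h3 : (A : Matrix (Fin n) (Fin n) K) *ᵥ w' - w' = 0 :=
        Submodule.disjoint_def.1 h.disjoint _ (h1 w') (W'.sub_mem ((hA w').2 hw') hw')
      rw [← e, Matrix.mulVec_add, h2 w hw, sub_eq_zero.1 h3]
    rw [hA1, map_one]
    exact Subgroup.mem_bot.2 rfl
  · refine le_antisymm (sup_le inf_le_left (Subgroup.map_mono
      (trivialOn_le_subspaceStabilizer W))) ?_
    rintro _ ⟨A, hA, rfl⟩
    have hA' := (subspaceStabilizer W).inv_mem hA
    set a : Matrix (Fin n) (Fin n) K := ↑A with ha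
    set b : Matrix (Fin n) (Fin n) K := ↑A⁻¹ with hb
    have hab : a * b = 1 := by rw [ha, hb, ← Units.val_mul, mul_inv_cancel, Units.val_one]
    have hba : b * a = 1 := by rw [ha, hb, ← Units.val_mul, inv_mul_cancel, Units.val_one]
    set p : Matrix (Fin n) (Fin n) K := LinearMap.toMatrix' (W.projection W' h) with hp
    have hpv : ∀ v, p *ᵥ v = W.projection W' h v := fun v => LinearMap.toMatrix'_mulVec _ _
    have hpW : ∀ v, p *ᵥ v ∈ W := fun v => by
      rw [hpv]; exact Submodule.projection_apply_mem h v
    have hpid : ∀ w ∈ W, p *ᵥ w = w := fun w hw => by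
      rw [hpv]; exact Submodule.projection_apply_of_mem_left h hw
    have hp0 : ∀ w ∈ W', p *ᵥ w = 0 := fun w hw => by
      rw [hpv]; exact (Submodule.projection_apply_eq_zero_iff h).2 hw
    have hpsub : ∀ v, v - p *ᵥ v ∈ W' := fun v => by
      rw [hpv]; exact Submodule.sub_projection_mem h v
    have hpp : p * p = p := Matrix.ext_of_mulVec_single fun j => by
      rw [← Matrix.mulVec_mulVec, hpid _ (hpW _)]
    have htri : ∀ m : Matrix (Fin n) (Fin n) K, (∀ w ∈ W, m *ᵥ w ∈ W) → p * m * p = m * p :=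
      fun m hm => Matrix.ext_of_mulVec_single fun j => by
        rw [← Matrix.mulVec_mulVec, ← Matrix.mulVec_mulVec, hpid _ (hm _ (hpW _)),
          Matrix.mulVec_mulVec]
    have haW : ∀ w ∈ W, a *ᵥ w ∈ W := fun w hw => (hA w).2 hw
    have hbW : ∀ w ∈ W, b *ᵥ w ∈ W := fun w hw => (hA' w).2 hw
    let L : GL (Fin n) K := ⟨a * p + (1 - p) * a, b * p + (1 - p) * b,
      mul_eq_one_of_triangular hab hpp (htri a haW) (htri b hbW),
      mul_eq_one_of_triangular hba hpp (htri b hbW) (htri a haW)⟩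
    have hL : ∀ (m : Matrix (Fin n) (Fin n) K) (v : Fin n → K), (m * p + (1 - p) * m) *ᵥ v =
        m *ᵥ (p *ᵥ v) + (m *ᵥ v - p *ᵥ (m *ᵥ v)) := by
      intro m v
      rw [Matrix.add_mulVec, ← Matrix.mulVec_mulVec, ← Matrix.mulVec_mulVec, Matrix.sub_mulVec,
        Matrix.one_mulVec]
    have hLW : ∀ m : Matrix (Fin n) (Fin n) K, (∀ w ∈ W, m *ᵥ w ∈ W) →
        ∀ w ∈ W, (m * p + (1 - p) * m) *ᵥ w ∈ W := by
      intro m hm w hw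
      rw [hL, hpid w hw, hpid _ (hm w hw), sub_self, add_zero]
      exact hm w hw
    have hLW' : ∀ m : Matrix (Fin n) (Fin n) K, ∀ w ∈ W', (m * p + (1 - p) * m) *ᵥ w ∈ W' := by
      intro m w hw
      rw [hL, hp0 w hw, Matrix.mulVec_zero, zero_add]
      exact hpsub _
    have hLmem : L ∈ subspaceStabilizer W :=
      mem_subspaceStabilizer_of_forall (hLW a haW) (hLW b hbW)
    have hLmem' : L ∈ subspaceStabilizer W' :=
      mem_subspaceStabilizer_of_forall (hLW' a) (hLW' b)
    have hbav : ∀ v, b *ᵥ (a *ᵥ v) = v := fun v => by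
      rw [Matrix.mulVec_mulVec, hba, Matrix.one_mulVec]
    have hT : ∀ v, ((L⁻¹ * A : GL (Fin n) K) : Matrix (Fin n) (Fin n) K) *ᵥ v =
        b *ᵥ (p *ᵥ (a *ᵥ v)) + (v - p *ᵥ v) := by
      intro v
      rw [Units.val_mul, ← Matrix.mulVec_mulVec]
      refine (hL b (a *ᵥ v)).trans ?_
      rw [hbav]
    have hTmem : L⁻¹ * A ∈ trivialOn W := by
      refine ⟨fun u => ?_, fun u hu => ?_⟩
      · have : b *ᵥ (p *ᵥ (a *ᵥ u)) + (u - p *ᵥ u) - u = b *ᵥ (p *ᵥ (a *ᵥ u)) - p *ᵥ u := by abel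
        rw [hT, this]
        exact W.sub_mem (hbW _ (hpW _)) (hpW _)
      · rw [hT, hpid _ (haW u hu), hbav, hpid u hu, sub_self, add_zero]
    rw [← mul_inv_cancel_left L A, map_mul]
    exact Subgroup.mul_mem_sup ⟨⟨L, hLmem, rfl⟩, ⟨L, hLmem', rfl⟩⟩ ⟨_, hTmem, rfl⟩

theorem isOpposite_iff_isCompl [PrimeNormBounds K] [NeZero n] {W W' : Submodule K (Fin n → K)}
    (hW : W ≠ ⊥) (hW₁ : W ≠ ⊤) :
    IsOpposite ((subspaceStabilizer W).map ProjGenLinGroup.mk)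
      ((subspaceStabilizer W').map ProjGenLinGroup.mk) ↔ IsCompl W W' := by
  refine ⟨isCompl_of_isOpposite hW hW₁, fun h => ⟨isLevi_of_isCompl h, ?_⟩⟩
  rw [inf_comm]
  exact isLevi_of_isCompl h.symm

/-! ### Coordinates -/

theorem glStabilizer_eq {V : Type*} [AddCommGroup V] [Module K V]
    (b : Module.Basis (Fin n) K V) (W : Submodule K V) :
    glStabilizer b W =
      subspaceStabilizer (W.map (b.equivFun : V →ₗ[K] Fin n → K)) := by
  have h1 : ∀ (A : GL (Fin n) K) (v : V), b.equivFun (Matrix.toLin b b A v) =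
      (A : Matrix (Fin n) (Fin n) K) *ᵥ b.equivFun v := by
    intro A v
    rw [Matrix.toLin_apply]
    simp only [map_sum, map_smul]
    ext i
    simp [Finset.sum_apply, Finsupp.single_apply]
  have h2 : ∀ (A : GL (Fin n) K) (v : V), b.equivFun.symm
      ((A : Matrix (Fin n) (Fin n) K) *ᵥ b.equivFun v) = Matrix.toLin b b A v := by
    intro A v
    rw [← h1, LinearEquiv.symm_apply_apply]
  have hmem : ∀ (A : GL (Fin n) K), A ∈ glStabilizer b W ↔
      W.map (Matrix.toLin b b (A : Matrix (Fin n) (Fin n) K)) = W := fun A => Iff.rfl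
  have hto : ∀ A ∈ glStabilizer b W, ∀ u ∈ W.map (b.equivFun : V →ₗ[K] Fin n → K),
      (A : Matrix (Fin n) (Fin n) K) *ᵥ u ∈ W.map (b.equivFun : V →ₗ[K] Fin n → K) := by
    rintro A hA _ ⟨v, hv, rfl⟩
    refine ⟨Matrix.toLin b b A v, ?_, h1 A v⟩
    rw [SetLike.mem_coe, ← (hmem A).1 hA]
    exact ⟨v, hv, rfl⟩
  ext A
  constructor
  · intro hA
    exact mem_subspaceStabilizer_of_forall (hto A hA)
      (hto A⁻¹ ((glStabilizer b W).inv_mem hA))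
  · intro hA
    have hfrom : ∀ A ∈ subspaceStabilizer (W.map (b.equivFun : V →ₗ[K] Fin n → K)), ∀ v ∈ W,
        Matrix.toLin b b (A : Matrix (Fin n) (Fin n) K) v ∈ W := by
      intro A hA v hv
      obtain ⟨w, hw, e⟩ := (hA (b.equivFun v)).2 ⟨v, hv, rfl⟩
      rw [← h2, ← e]
      simpa using hw
    rw [hmem]
    refine le_antisymm ?_ fun v hv => ?_
    · rintro _ ⟨v, hv, rfl⟩
      exact hfrom A hA v hv
    · refine ⟨_, hfrom A⁻¹ ((subspaceStabilizer _).inv_mem hA) v hv, ?_⟩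
      rw [← Matrix.toLin_mul_apply, ← Units.val_mul, mul_inv_cancel, Units.val_one,
        Matrix.toLin_one, LinearMap.id_apply]

end

end BTBuilding

/-! ### Transport to coordinates and conclusion -/

theorem lemma2p3 (p : ℕ) [Fact p.Prime] {K : Type*} [NormedField K] [NormedAlgebra ℚ_[p] K]
    [FiniteDimensional ℚ_[p] K] {V : Type*} [AddCommGroup V] [Module K V] {n : ℕ}
    (b : Module.Basis (Fin n) K V) (B : BTBuilding.InvScalarProduct n)
    (W W' : Submodule K V) (hW₀ : W ≠ ⊥) (hW₁ : W ≠ ⊤) (hW'₀ : W' ≠ ⊥) (hW'₁ : W' ≠ ⊤) :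
    (∃! y : BTBuilding.XBar n K, BTBuilding.IsVertexOf b W y) ∧
    (∃! y' : BTBuilding.XBar n K, BTBuilding.IsVertexOf b W' y') ∧
    ∀ y y' : BTBuilding.XBar n K, BTBuilding.IsVertexOf b W y → BTBuilding.IsVertexOf b W' y' →
      (BTBuilding.ConnectedByGeodesic B y y' ↔ IsCompl W W') ∧
      (BTBuilding.ConnectedByGeodesic B y y' ↔
        BTBuilding.IsOpposite (BTBuilding.parabolic b W) (BTBuilding.parabolic b W')) := by
  have := BTBuilding.isUltrametricDist_of_padic p K
  have := BTBuilding.primeNormBounds_of_padic p K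
  have hinj : Function.Injective (Submodule.map (b.equivFun : V →ₗ[K] Fin n → K)) :=
    Submodule.map_injective_of_injective b.equivFun.injective
  have hpar : ∀ W : Submodule K V, BTBuilding.parabolic b W =
      (BTBuilding.subspaceStabilizer (W.map (b.equivFun : V →ₗ[K] Fin n → K))).map
        Matrix.ProjGenLinGroup.mk := fun W => by
    rw [BTBuilding.parabolic, BTBuilding.glStabilizer_eq]
  have hbot : ∀ W : Submodule K V, W ≠ ⊥ → W.map (b.equivFun : V →ₗ[K] Fin n → K) ≠ ⊥ :=
    fun W hW h => hW (hinj (h.trans (Submodule.map_bot _).symm))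
  have htop : ∀ W : Submodule K V, W ≠ ⊤ → W.map (b.equivFun : V →ₗ[K] Fin n → K) ≠ ⊤ :=
    fun W hW h => hW (hinj (h.trans (by rw [Submodule.map_top, LinearEquiv.range])))
  -- A nonzero proper subspace exists only in dimension at least two.
  have hn : 2 ≤ n := by
    have h1 : 0 < Module.finrank K (W.map (b.equivFun : V →ₗ[K] Fin n → K)) := by
      rw [Module.finrank_pos_iff]
      exact Submodule.nontrivial_iff_ne_bot.2 (hbot W hW₀)
    have h2 := Submodule.finrank_lt (htop W hW₁)
    rw [Module.finrank_fin_fun] at h2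
    omega
  have := BTBuilding.neZero_of_two_le hn
  have hvert : ∀ (W : Submodule K V) (y : BTBuilding.XBar n K), BTBuilding.IsVertexOf b W y ↔
      y ∈ BTBuilding.boundary n K ∧
        MulAction.stabilizer (Matrix.ProjGenLinGroup (Fin n) K) y = (BTBuilding.subspaceStabilizer
          (W.map (b.equivFun : V →ₗ[K] Fin n → K))).map Matrix.ProjGenLinGroup.mk := fun W y => by
    rw [BTBuilding.IsVertexOf, hpar]
  have hcompl : IsCompl W W' ↔ IsCompl (W.map (b.equivFun : V →ₗ[K] Fin n → K))
      (W'.map (b.equivFun : V →ₗ[K] Fin n → K)) :=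
    (Submodule.orderIsoMapComap b.equivFun).isCompl_iff
  refine ⟨?_, ?_, fun y y' hy hy' => ?_⟩
  · simpa only [hvert] using
      BTBuilding.existsUnique_mem_boundary_stabilizer (hbot W hW₀) (htop W hW₁)
  · simpa only [hvert] using
      BTBuilding.existsUnique_mem_boundary_stabilizer (hbot W' hW'₀) (htop W' hW'₁)
  · rw [hvert] at hy hy'
    obtain ⟨A, I, c, hA, hc, rfl⟩ := BTBuilding.exists_isImageCoordSpan_of_stabilizer
      (hbot W hW₀) (htop W hW₁) hy.1 hy.2
    obtain ⟨A', I', c', hA', hc', rfl⟩ := BTBuilding.exists_isImageCoordSpan_of_stabilizer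
      (hbot W' hW'₀) (htop W' hW'₁) hy'.1 hy'.2
    have h1 : BTBuilding.ConnectedByGeodesic B
        (BTBuilding.XBar.mk (Matrix.ProjGenLinGroup.mk A) (Sum.inr c))
        (BTBuilding.XBar.mk (Matrix.ProjGenLinGroup.mk A') (Sum.inr c')) ↔ IsCompl W W' := by
      rw [hcompl]
      exact ⟨BTBuilding.ConnectedByGeodesic.isCompl hn hA hc hA' hc',
        BTBuilding.connectedByGeodesic_of_isCompl hn B hA hc hA' hc'⟩
    refine ⟨h1, h1.trans ?_⟩
    rw [hpar, hpar, BTBuilding.isOpposite_iff_isCompl (hbot W hW₀) (htop W hW₁), hcompl]
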